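/- Let $K$ be a number field, $S$ a finite set of places of $K$ containing all infinite places, and $\mathcal O_S$ the ring of $S$-integers. Let $\mathcal X$ be a normal scheme, $\mathcal X\to\mathrm{Spec}(\mathcal O_S)$ a flat proper morphism whose generic fiber $X$ is a smooth rational curve (that is, $X_{\bar K}\simeq\mathbb P^1_{\bar K}$), and let $\mathcal D\subset\mathcal X$ be a reduced effective Cartier divisor, not necessarily flat over $\mathcal O_S$, whose generic fiber $D\subset X$ is reduced of degree two over $K$. An $\mathcal O_S$-integral point of $(\mathcal X,\mathcal D)$ is a section $\mathrm{Spec}(\mathcal O_S)\to\mathcal X$ that does not meet $\mathcal D$. Assume that $(\mathcal X,\mathcal D)$ has an $\mathcal O_S$-integral point. (1) Let $G$ be a $K$-form of $\mathbb G_m$ (a group scheme over $K$ that becomes isomorphic to $\mathbb G_m$ over a finite extension of $K$) such that $X\setminus D$ is a $G$-torsor. Assume $\mathrm{rank}(G,\mathcal O_S)>0$, i.e. that for some flat group scheme $\mathcal G$ of finite type over $\mathcal O_S$ with generic fiber $G$ the group $\mathcal G(\mathcal O_S)$ has positive rank. Then the $\mathcal O_S$-integral points of $(\mathcal X,\mathcal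 D)$ are Zariski dense in $\mathcal X$. (2) In particular, the $\mathcal O_S$-integral points of $(\mathcal X,\mathcal D)$ are Zariski dense in $\mathcal X$ if either (a) $D$ is reducible over $K$ and $|S|>1$, or (b) $D$ is irreducible over $K$ and at least one place in $S$ splits completely in the quadratic extension $K(D)/K$. -/

import Mathlib

open CategoryTheory AlgebraicGeometry NumberField IsDedekindDomain
open MonoidalCategory CartesianMonoidalCategory
open scoped LaurentPolynomial MonObj Obj

universe u

noncomputable section

namespace ConicPoints

section Schemes

/-- `Spec A` as a scheme over `Spec R`, for an `R`-algebra `A`. -/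
abbrev specOver (R A : Type u) [CommRing R] [CommRing A] [Algebra R A] :
    Over (Spec (.of R)) :=
  Over.mk (Spec.map (CommRingCat.ofHom (algebraMap R A)))

/-- The base change `Y ×_R A` of an `R`-scheme `Y` to an `R`-algebra `A`. -/
abbrev baseChange {R : Type u} (A : Type u) [CommRing R] [CommRing A] [Algebra R A]
    (Y : Over (Spec (.of R))) : Over (Spec (.of A)) :=
  (Over.pullback (Spec.map (CommRingCat.ofHom (algebraMap R A)))).obj Y

attribute [local instance] MvPolynomial.gradedAlgebra

/-- The projective line over `k`, as a scheme over `Spec k`. -/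
def projectiveLine (k : Type u) [CommRing k] : Over (Spec (.of k)) :=
  Over.mk (Proj.toSpecZero (MvPolynomial.homogeneousSubmodule (Fin 2) k) ≫
    Spec.map (CommRingCat.ofHom
      (algebraMap k (MvPolynomial.homogeneousSubmodule (Fin 2) k 0))))

/-- A smooth (complete, geometrically connected) rational curve over a field `K`: a `K`-scheme that
becomes isomorphic to the projective line over the algebraic closure of `K`. -/
def IsSmoothRationalCurve {K : Type u} [Field K] (X : Over (Spec (.of K))) : Prop :=
  Nonempty (baseChange (AlgebraicClosure K) X ≅ projectiveLine (AlgebraicClosure K))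

/-- A scheme is normal if its local rings are integrally closed domains. -/
def IsNormalScheme (X : Scheme.{u}) : Prop :=
  ∀ x : X, IsDomain (X.presheaf.stalk x) ∧ IsIntegrallyClosed (X.presheaf.stalk x)

/-- A closed subscheme, given by its ideal sheaf, is an effective Cartier divisor if its ideal is
locally generated by one non-zero-divisor. -/
def IsEffectiveCartier {X : Scheme.{u}} (I : X.IdealSheafData) : Prop :=
  ∀ x : X, ∃ V : X.affineOpens, x ∈ V.1 ∧
    ∃ f ∈ nonZeroDivisors Γ(X, V.1), I.ideal V = Ideal.span {f}

/-- The open complement of the closed subscheme with ideal sheaf `I`. -/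
def openComplement {X : Scheme.{u}} (I : X.IdealSheafData) : X.Opens :=
  I.support.compl

end Schemes

section Groups

/-- The multiplicative group over `k`. -/
abbrev Gm (k : Type u) [Field k] : Over (Spec (.of k)) :=
  (Spec (.of k[T;T⁻¹])).asOver (Spec (.of k))

/-- `G` is a `K`-form of the multiplicative group: it becomes isomorphic to it, as a group scheme,
over a finite field extension of `K`. -/
def IsFormOfGm {K : Type u} [Field K] (G : Over (Spec (.of K))) [GrpObj G] : Prop :=
  ∃ (L : Type u) (_ : Field L) (_ : Algebra K L) (_ : FiniteDimensional K L)
    (e : baseChange L G ≅ Gm L), IsMonHom e.hom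

/-- The `K`-scheme `U` is a torsor under the `K`-group scheme `G`: it is nonempty and `G` acts on it
in such a way that `(g, x) ↦ (g • x, x)` is an isomorphism `G × U ≅ U × U`. -/
def IsTorsor {K : Type u} [Field K] (G U : Over (Spec (.of K))) [GrpObj G] : Prop :=
  Nonempty U.left ∧ ∃ _ : ModObj G U, IsIso (ModObj.leftSMul G U)

/-- The (torsion-free) rank of a group: the supremum of all `n` such that the group contains
a copy of `ℤⁿ`. For an abelian group this is the usual rank. -/
def groupRank (Γ : Type u) [Group Γ] : ℕ∞ :=
  ⨆ (n : ℕ) (_ : ∃ f : Multiplicative (Fin n → ℤ) →* Γ, Function.Injective f), (n : ℕ∞)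

end Groups

section Arithmetic

variable (K : Type u) [Field K] [NumberField K] (S : Finset (HeightOneSpectrum (𝓞 K)))

/-- The ring of `S`-integers of `K`. Only the finite places of `S` are listed; the infinite places
always belong to it. -/
abbrev OS : Type u := (S : Set (HeightOneSpectrum (𝓞 K))).integer K

/-- The number of places in `S`, the infinite ones included. -/
def numPlaces : ℕ := S.card + Nat.card (InfinitePlace K)

/-- Some place in `S` (finite or infinite) splits completely in the finite extension `L` of `K`,
i.e. there are exactly `[L : K]` places of `L` above it. -/
def ExistsSplitPlace (L : Type u) [Field L] [NumberField L] [Algebra K L] : Prop :=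
  (∃ v ∈ S, (v.asIdeal.primesOver (𝓞 L)).ncard = Module.finrank K L) ∨
    ∃ v : InfinitePlace K,
      {w : InfinitePlace L | w.comap (algebraMap K L) = v}.ncard = Module.finrank K L

variable {K S}

/-- The generic fibre of a scheme over the ring of `S`-integers. -/
abbrev genericFibre (Y : Over (Spec (.of (OS K S)))) : Over (Spec (.of K)) :=
  baseChange K Y

/-- The group scheme `𝒢` over the `S`-integers is a model of the `K`-group scheme `G`: it is flat
and of finite type, and its generic fibre is isomorphic to `G` as a group scheme. -/
structure IsModel (𝒢 : Over (Spec (.of (OS K S)))) [GrpObj 𝒢]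
    (G : Over (Spec (.of K))) [GrpObj G] : Prop where
  flat : Flat 𝒢.hom
  locallyOfFiniteType : LocallyOfFiniteType 𝒢.hom
  quasiCompact : QuasiCompact 𝒢.hom
  generic : ∃ e : genericFibre 𝒢 ≅ G, IsMonHom e.hom

/-- The rank of the group of sections of a group scheme over the `S`-integers. -/
def sectionRank (𝒢 : Over (Spec (.of (OS K S)))) [GrpObj 𝒢] : ℕ∞ :=
  groupRank (Over.mk (𝟙 (Spec (.of (OS K S)))) ⟶ 𝒢)

variable {𝒳 : Scheme.{u}} (π : 𝒳 ⟶ Spec (.of (OS K S))) (𝒟 : 𝒳.IdealSheafData)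

/-- The generic fibre of the closed subscheme with ideal sheaf `𝒟`. -/
abbrev genericDivisor : Over (Spec (.of K)) :=
  genericFibre (Over.mk (𝒟.subschemeι ≫ π))

/-- The generic fibre of the complement of the closed subscheme with ideal sheaf `𝒟`. -/
abbrev genericComplement : Over (Spec (.of K)) :=
  genericFibre (Over.mk ((openComplement 𝒟).ι ≫ π))

/-- A rational curve with rational bisection over the `S`-integers. The divisor need not be flat
over the base. -/
structure IsRationalCurveWithBisection : Prop where
  normal : IsNormalScheme 𝒳
  flat : Flat π
  proper : IsProper π
  rational : IsSmoothRationalCurve (genericFibre (Over.mk π))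
  cartier : IsEffectiveCartier 𝒟
  reduced : IsReduced 𝒟.subscheme
  generic_reduced : IsReduced (genericDivisor π 𝒟).left
  generic_finite : IsFinite (genericDivisor π 𝒟).hom
  generic_degree : ∀ x, (genericDivisor π 𝒟).hom.finrank x = 2

/-- The integral points of the pair: the sections of `π` that do not meet the divisor. -/
def integralPoints : Set (Spec (.of (OS K S)) ⟶ 𝒳) :=
  {s | s ≫ π = 𝟙 _ ∧ ∀ p, s p ∉ 𝒟.support}

/-- The integral points of the pair are Zariski dense: the images of the generic point of the base
under these sections (i.e. the `K`-points that they define) are dense. -/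
def IntegralPointsDense : Prop :=
  Dense {x : 𝒳 | ∃ s ∈ integralPoints π 𝒟,
    x ∈ Set.range (Spec.map (CommRingCat.ofHom (algebraMap (OS K S) K)) ≫ s)}

end Arithmetic

end ConicPoints

end

/-! Write `R` for the ring of `S`-integers, `U` for the complement of the divisor, and `P₀` for the
given integral point. The proof moves `P₀` by a one-parameter family of `K`-points of `U`, shows
that infinitely many of them are integral, and concludes because infinitely many distinct points of
a curve are dense.

Integrality. Let `T` be a scheme over `R` with sections `g n`, and let `φ` be a morphism from its
generic fibre to `U` with `φ (g 0) = P₀` generically. Suppose that for each nonzero `c` in a local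
ring of `R` the `g n` with `n` in some `k ℕ` all agree with `g 0` modulo `c`. The morphism `φ`
extends over `R[1/f]` for some `f ≠ 0` (`exists_spread`), so `φ (g n)` is integral at every prime
not containing `f`. At each of the finitely many other primes, `φ (g 0)` is integral because `P₀`
is, and integrality survives a sufficiently small `p`-adic perturbation
(`exists_extension_of_congruent`). Hence all `φ (g n)` with `n` divisible by a fixed integer are
integral at every prime, and the local sections glue (`exists_section_of_forall_prime`). This is
`exists_sections`.

Torsor case. `T` is the group model, `g n` the powers of a section `g` of infinite order, `φ` the
orbit map of `P₀`. The congruences hold because `R` has finite quotients, so a group of finite type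
has finitely many points modulo `c`. The points differ because a generically trivial section is
torsion and the action is free.

Criteria (a) and (b). Over the algebraic closure `k` of `K`, `U` becomes `Spec k[T;T⁻¹]`, and a
Galois automorphism maps `T` to a multiple of `T` or of `T⁻¹` according to whether it fixes or swaps
the two points of the divisor (`exists_torus_chart`). If `P₀` is `T = t` and `ε` is a unit integral
over `R` that is fixed or inverted in the same way, the points `T = t ε ^ n` are Galois invariant,
hence `K`-points (`exists_integral_family`). In case (a) `ε` is a unit of `R`; in case (b) it is a
norm-one quotient `a / τ a` provided by the split place (`exists_norm_one`). -/

noncomputable section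

/-! ### Gluing sections from the local rings -/

namespace ConicPoints

/-- The morphism of spectra given by an algebra. -/
abbrev specMap (A B : Type u) [CommRing A] [CommRing B] [Algebra A B] :
    Spec (.of B) ⟶ Spec (.of A) :=
  Spec.map (CommRingCat.ofHom (algebraMap A B))

lemma specMap_comp (A B C : Type u) [CommRing A] [CommRing B] [CommRing C] [Algebra A B]
    [Algebra B C] [Algebra A C] [IsScalarTower A B C] :
    specMap B C ≫ specMap A B = specMap A C := by
  rw [specMap, specMap, specMap, ← Spec.map_comp, ← CommRingCat.ofHom_comp,
    IsScalarTower.algebraMap_eq A B C]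

section Localization

variable (R K : Type u) [CommRing R] [IsDomain R] [Field K] [Algebra R K] [IsFractionRing R K]

/-- The local ring of a domain at a prime, inside the fraction field. -/
abbrev localRing (p : PrimeSpectrum R) : Subalgebra R K :=
  Localization.subalgebra.ofField K p.asIdeal.primeCompl p.asIdeal.primeCompl_le_nonZeroDivisors

instance (p : PrimeSpectrum R) : IsLocalization.AtPrime (localRing R K p) p.asIdeal :=
  inferInstanceAs (IsLocalization p.asIdeal.primeCompl _)

instance (p : PrimeSpectrum R) : IsLocalRing (localRing R K p) :=
  IsLocalization.AtPrime.isLocalRing _ p.asIdeal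

end Localization

lemma exists_iso_fromSpecStalk {R : Type u} [CommRing R] (A : Type u) [CommRing A] [Algebra R A] (p : PrimeSpectrum R)
    [IsLocalization.AtPrime A p.asIdeal] :
    ∃ i : Spec ((Spec (.of R)).presheaf.stalk p) ≅ Spec (.of A),
      (Spec (.of R)).fromSpecStalk p = i.hom ≫ specMap R A := by
  let e := IsLocalization.algEquiv p.asIdeal.primeCompl A
    ((Spec.structureSheaf R).presheaf.stalk p)
  refine ⟨Scheme.Spec.mapIso (RingEquiv.toCommRingCatIso e.toRingEquiv).op, ?_⟩
  refine (Spec.fromSpecStalk_eq' (CommRingCat.of R) p).trans ?_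
  refine Eq.trans ?_ (Spec.map_comp _ _)
  congr 1
  ext r
  exact (e.commutes r).symm

/-- Two morphisms from the spectrum of a domain to an affine scheme that agree over an extension
are equal. -/
lemma hom_ext_of_injective {A B C : Type u} [CommRing A] [CommRing B] [CommRing C] [Algebra A B]
    (h : Function.Injective (algebraMap A B)) {f g : Spec (.of A) ⟶ Spec (.of C)}
    (hfg : specMap A B ≫ f = specMap A B ≫ g) : f = g := by
  obtain ⟨f, rfl⟩ := Spec.map_surjective f
  obtain ⟨g, rfl⟩ := Spec.map_surjective g
  rw [← Spec.map_comp, ← Spec.map_comp] at hfg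
  congr 1
  ext x
  exact h (congr($(Spec.map_injective hfg) x))

lemma specMap_stalkSpecializes_fromSpecStalkOfMem {X Y : Scheme.{u}} (f : X.PartialMap Y) {x y : X}
    (h : x ⤳ y) (hy : y ∈ f.domain) (hx : x ∈ f.domain) :
    Spec.map (X.presheaf.stalkSpecializes h) ≫ f.fromSpecStalkOfMem hy =
      f.fromSpecStalkOfMem hx := by
  simp only [Scheme.PartialMap.fromSpecStalkOfMem]
  rw [← Category.assoc]
  congr 1
  rw [← cancel_mono f.domain.ι, Category.assoc, Scheme.Opens.fromSpecStalkOfMem_ι,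
    Scheme.Opens.fromSpecStalkOfMem_ι, Scheme.SpecMap_stalkSpecializes_fromSpecStalk]

/-- As `Y` is of finite type, each morphism from a stalk spreads to a partial map defined near the
point. These partial maps agree at the generic point, so they represent one rational map, whose
domain of definition is then everything; separatedness makes it a morphism there. -/
lemma exists_hom_of_forall_stalk {X Y S : Scheme.{u}} [IsIntegral X] [Y.IsSeparated] (sX : X ⟶ S)
    (sY : Y ⟶ S) [LocallyOfFiniteType sY] (z : ∀ x : X, Spec (X.presheaf.stalk x) ⟶ Y)
    (hz : ∀ x, z x ≫ sY = X.fromSpecStalk x ≫ sX)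
    (hz' : ∀ x, Spec.map (X.presheaf.stalkSpecializes (genericPoint_specializes x)) ≫ z x =
      z (genericPoint X)) :
    ∃ s : X ⟶ Y, X.fromSpecStalk (genericPoint X) ≫ s = z (genericPoint X) := by
  let f (x : X) : X.PartialMap Y := Scheme.PartialMap.ofFromSpecStalk sX sY (z x) (hz x)
  have hfx (x : X) : x ∈ (f x).domain :=
    Scheme.PartialMap.mem_domain_ofFromSpecStalk sX sY (z x) (hz x)
  have hη (x : X) : genericPoint X ∈ (f x).domain :=
    (genericPoint_specializes x).mem_open (f x).domain.2 (hfx x)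
  have hfη (x : X) : (f x).fromSpecStalkOfMem (hη x) = z (genericPoint X) := by
    rw [← hz' x, ← specMap_stalkSpecializes_fromSpecStalkOfMem _ (genericPoint_specializes x)
      (hfx x) (hη x)]
    congr 1
    exact Scheme.PartialMap.fromSpecStalkOfMem_ofFromSpecStalk sX sY (z x) (hz x)
  let r := (f (genericPoint X)).toRationalMap
  have hr (x : X) : (f x).toRationalMap = r := by
    refine Scheme.PartialMap.toRationalMap_eq_iff.mpr ?_
    exact Scheme.PartialMap.equiv_of_fromSpecStalkOfMem_eq (x := genericPoint X) _ _ (hη _) (hη _)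
      ((hfη _).trans (hfη _).symm)
  have htop : r.toPartialMap.domain = ⊤ := by
    rw [eq_top_iff]
    intro x _
    exact Scheme.RationalMap.mem_domain.mpr ⟨f x, hfx x, hr x⟩
  refine ⟨X.topIso.inv ≫ (X.isoOfEq htop).inv ≫ r.toPartialMap.hom, ?_⟩
  have h1 : r.toPartialMap.toRationalMap.fromFunctionField = r.fromFunctionField := by
    rw [Scheme.RationalMap.toRationalMap_toPartialMap]
  have h2 : r.fromFunctionField = z (genericPoint X) := hfη _
  rw [h2] at h1
  rw [← h1]
  simp only [Scheme.RationalMap.fromFunctionField_toRationalMap,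
    Scheme.PartialMap.fromSpecStalkOfMem]
  simp only [← Category.assoc]
  congr 1
  rw [← cancel_mono (r.toPartialMap.domain).ι]
  simp

lemma exists_section_of_forall_stalk {R K : Type u} [CommRing R] [IsDomain R] [Field K]
    [Algebra R K] [IsFractionRing R K] {Y : Scheme.{u}} (π : Y ⟶ Spec (.of R)) [IsSeparated π]
    [LocallyOfFiniteType π] (y : Spec (.of K) ⟶ Y) (hy : y ≫ π = specMap R K)
    (A : Spec (.of R) → Type u) [∀ x, CommRing (A x)] [∀ x, Algebra R (A x)]
    [∀ x, Algebra (A x) K] [∀ x, IsScalarTower R (A x) K]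
    (i : ∀ x, Spec ((Spec (.of R)).presheaf.stalk x) ≅ Spec (.of (A x)))
    (hi : ∀ x, (Spec (.of R)).fromSpecStalk x = (i x).hom ≫ specMap R (A x))
    (j : Spec ((Spec (.of R)).presheaf.stalk (genericPoint (Spec (.of R)))) ≅ Spec (.of K))
    (hj : (Spec (.of R)).fromSpecStalk (genericPoint (Spec (.of R))) = j.hom ≫ specMap R K)
    (z : ∀ x, Spec (.of (A x)) ⟶ Y) (hz : ∀ x, z x ≫ π = specMap R (A x))
    (hz' : ∀ x, specMap (A x) K ≫ z x = y) :
    ∃ s : Spec (.of R) ⟶ Y, s ≫ π = 𝟙 _ ∧ specMap R K ≫ s = y := by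
  have : Y.IsSeparated :=
    (IsSeparated.hasAffineProperty.iff_of_isAffine (f := π)).mp inferInstance
  have hij (p : Spec (.of R)) :
      Spec.map ((Spec (.of R)).presheaf.stalkSpecializes (genericPoint_specializes p)) ≫
        (i p).hom = j.hom ≫ specMap (A p) K := by
    have : Mono (specMap R (A p)) := by
      have h : specMap R (A p) = (i p).inv ≫ (Spec (.of R)).fromSpecStalk p := by
        rw [hi, Iso.inv_hom_id_assoc]
      rw [h]
      infer_instance
    rw [← cancel_mono (specMap R (A p)), Category.assoc, Category.assoc, ← hi,
      specMap_comp, Scheme.SpecMap_stalkSpecializes_fromSpecStalk, hj]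
  have hiη : (i (genericPoint (Spec (.of R)))).hom =
      j.hom ≫ specMap (A (genericPoint (Spec (.of R)))) K := by
    rw [← hij, TopCat.Presheaf.stalkSpecializes_refl, Spec.map_id, Category.id_comp]
  obtain ⟨s, hs⟩ := exists_hom_of_forall_stalk (X := Spec (.of R)) (𝟙 _) π
    (fun p ↦ (i p).hom ≫ z p) (fun p ↦ by rw [Category.assoc, hz, Category.comp_id, hi])
    (fun p ↦ by rw [← Category.assoc, hij, Category.assoc, hz', hiη, Category.assoc, hz'])
  have h2 : specMap R K ≫ s = y := by
    rw [← cancel_epi j.hom, ← Category.assoc, ← hj, hs, hiη, Category.assoc, hz']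
  refine ⟨s, hom_ext_of_injective (IsFractionRing.injective R K) ?_, h2⟩
  rw [reassoc_of% h2, Category.comp_id, hy]

theorem exists_section_of_forall_prime {R K : Type u} [CommRing R] [IsDomain R] [Field K]
    [Algebra R K] [IsFractionRing R K] {Y : Scheme.{u}} (π : Y ⟶ Spec (.of R)) [IsSeparated π]
    [LocallyOfFiniteType π] (y : Spec (.of K) ⟶ Y) (hy : y ≫ π = specMap R K)
    (H : ∀ p : PrimeSpectrum R, ∃ z : Spec (.of (localRing R K p)) ⟶ Y,
      z ≫ π = specMap R _ ∧ specMap (localRing R K p) K ≫ z = y) :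
    ∃ s : Spec (.of R) ⟶ Y, s ≫ π = 𝟙 _ ∧ specMap R K ≫ s = y := by
  choose z hz hz' using H
  choose i hi using fun p ↦ exists_iso_fromSpecStalk (localRing R K p) p
  obtain ⟨q, hq⟩ : ∃ q : PrimeSpectrum R, q = genericPoint (Spec (.of R)) := ⟨_, rfl⟩
  have hq' : q = ⊥ := hq.trans (genericPoint_eq_bot_of_affine (.of R))
  -- The local ring at the generic point is `K` itself.
  have : IsLocalization.AtPrime K q.asIdeal := by
    subst hq'
    have : (⊥ : PrimeSpectrum R).asIdeal.primeCompl = nonZeroDivisors R := by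
      ext x
      simp [Ideal.primeCompl]
    rw [IsLocalization.AtPrime, this]
    infer_instance
  have hj := exists_iso_fromSpecStalk K q
  rw [hq] at hj
  obtain ⟨j, hj⟩ := hj
  exact exists_section_of_forall_stalk π y hy (fun p ↦ localRing R K p) i hi j hj z hz hz'

end ConicPoints

end

/-! ### Spreading out a morphism from the generic fibre -/

noncomputable section

namespace ConicPoints

/-- The ring homomorphism `R → Γ(T, ⊤)` given by a morphism `T ⟶ Spec R`. -/
def globalMap {R : Type u} [CommRing R] {T : Scheme.{u}} (τ : T ⟶ Spec (.of R)) : R →+* Γ(T, ⊤) :=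
  ((Scheme.ΓSpecIso (.of R)).inv ≫ τ.appTop).hom

lemma globalMap_comp {R : Type u} [CommRing R] {T Z : Scheme.{u}} (τ : T ⟶ Spec (.of R))
    (a : Z ⟶ T) (r : R) : globalMap (a ≫ τ) r = a.appTop (globalMap τ r) := by
  simp only [globalMap, Scheme.Hom.comp_appTop]
  rfl

lemma toSpecΓ_globalMap {R : Type u} [CommRing R] {T : Scheme.{u}} (τ : T ⟶ Spec (.of R)) :
    T.toSpecΓ ≫ Spec.map (CommRingCat.ofHom (globalMap τ)) = τ := by
  rw [globalMap, CommRingCat.ofHom_hom, Spec.map_comp, ← Category.assoc, ← Scheme.toSpecΓ_naturality,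
    Category.assoc]
  exact (congrArg (τ ≫ ·) (toSpecΓ_SpecMap_ΓSpecIso_inv (.of R))).trans (Category.comp_id τ)

lemma isUnit_globalMap {R K : Type u} [CommRing R] [CommRing K] [Algebra R K] {Z : Scheme.{u}}
    (a : Z ⟶ Spec (.of K)) (r : R) (hr : IsUnit (algebraMap R K r)) :
    IsUnit (globalMap (a ≫ specMap R K) r) := by
  have : globalMap (a ≫ specMap R K) r = globalMap a (algebraMap R K r) := by
    have h := congr($(Scheme.ΓSpecIso_inv_naturality (CommRingCat.ofHom (algebraMap R K))) r)
    simp only [globalMap, Scheme.Hom.comp_appTop]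
    exact congr(a.appTop $h).symm
  rw [this]
  exact hr.map _

/-- A morphism whose pullback of `r` is a unit factors through the basic open of `r`. -/
lemma range_subset_basicOpen {T Z : Scheme.{u}} (a : Z ⟶ T) (r : Γ(T, ⊤))
    (h : IsUnit (a.appTop r)) : Set.range a ⊆ T.basicOpen r := by
  rintro _ ⟨z, rfl⟩
  have : a ⁻¹ᵁ T.basicOpen r = ⊤ := by
    rw [Scheme.preimage_basicOpen]
    exact Scheme.basicOpen_of_isUnit _ h
  change z ∈ a ⁻¹ᵁ T.basicOpen r
  rw [this]
  trivial

lemma isUnit_of_basicOpen_eq_top {Z : Scheme.{u}} (s : Γ(Z, ⊤)) (h : Z.basicOpen s = ⊤) :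
    IsUnit s := by
  have key : ∀ (V : Z.Opens) (_ : V = ⊤) (i : V ⟶ ⊤), IsUnit (Z.presheaf.map i.op s) →
      IsUnit s := by
    rintro _ rfl i hi
    rw [Subsingleton.elim i (𝟙 _), op_id, CategoryTheory.Functor.map_id] at hi
    exact hi
  exact key _ h _ (Z.toRingedSpace.isUnit_res_basicOpen s)

lemma isUnit_appTop_of_range_subset {T Z : Scheme.{u}} (a : Z ⟶ T) (r : Γ(T, ⊤))
    (h : Set.range a ⊆ T.basicOpen r) : IsUnit (a.appTop r) := by
  refine isUnit_of_basicOpen_eq_top _ ?_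
  refine (Scheme.preimage_basicOpen a r).symm.trans ?_
  rw [eq_top_iff]
  exact fun z _ ↦ h ⟨z, rfl⟩

section Spread

variable {R K : Type u} [CommRing R] [IsDomain R] [Field K] [Algebra R K] [IsFractionRing R K]
  {T TK Y : Scheme.{u}} (τ : T ⟶ Spec (.of R))

/-- The opens of `T` obtained by inverting one nonzero element of `R`. -/
abbrev GenericOpens := {V : T.Opens // ∃ f : R, f ≠ 0 ∧ V = T.basicOpen (globalMap τ f)}

instance : Nonempty (GenericOpens τ) := ⟨_, 1, one_ne_zero, rfl⟩

instance : IsCodirectedOrder (GenericOpens τ) where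
  directed := by
    rintro ⟨_, f, hf, rfl⟩ ⟨_, g, hg, rfl⟩
    refine ⟨⟨_, f * g, mul_ne_zero hf hg, rfl⟩, ?_, ?_⟩
    · change T.basicOpen _ ≤ T.basicOpen _
      rw [map_mul, Scheme.basicOpen_mul]
      exact inf_le_left
    · change T.basicOpen _ ≤ T.basicOpen _
      rw [map_mul, Scheme.basicOpen_mul]
      exact inf_le_right

/-- The diagram of the open subschemes obtained by inverting one nonzero element of `R`. -/
abbrev genericOpensDiagram : GenericOpens τ ⥤ Scheme.{u} where
  obj V := V.1
  map f := T.homOfLE f.le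

/-- The inclusions of the open subschemes obtained by inverting one nonzero element of `R`. -/
def genericOpensι : genericOpensDiagram τ ⟶ (Functor.const _).obj T where
  app V := V.1.ι
  naturality V W f := by simp

instance (V : GenericOpens τ) : IsOpenImmersion ((genericOpensι τ).app V) :=
  inferInstanceAs (IsOpenImmersion V.1.ι)

lemma genericOpensι_w {V W : GenericOpens τ} (f : V ⟶ W) :
    (genericOpensDiagram τ).map f ≫ (genericOpensι τ).app W = (genericOpensι τ).app V :=
  T.homOfLE_ι f.le

instance (V : GenericOpens τ) : IsAffineHom V.1.ι := by
  obtain ⟨_, f, hf, rfl⟩ := V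
  infer_instance

instance {V W : GenericOpens τ} (f : V ⟶ W) : IsAffineHom ((genericOpensDiagram τ).map f) := by
  have : IsAffineHom (T.homOfLE f.le ≫ W.1.ι) := by
    rw [Scheme.homOfLE_ι]
    infer_instance
  exact IsAffineHom.of_comp (T.homOfLE f.le) W.1.ι

variable {τ} {fst : TK ⟶ T} {snd : TK ⟶ Spec (.of K)} (hp : IsPullback fst snd τ (specMap R K))

include hp in
lemma range_fst_subset (V : GenericOpens τ) : Set.range fst ⊆ Set.range ((genericOpensι τ).app V) := by
  obtain ⟨_, f, hf, rfl⟩ := V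
  refine Set.Subset.trans ?_ (Scheme.Opens.range_ι _).ge
  refine range_subset_basicOpen _ _ ?_
  rw [← globalMap_comp, hp.w]
  exact isUnit_globalMap snd f (by simpa using hf)

-- Once the nonzero elements of `R` act invertibly, the universal property of the fraction field
-- supplies the missing morphism to `Spec K`.
include hp in
lemma exists_lift_of_isUnit {Z : Scheme.{u}} (a : Z ⟶ T)
    (hu : ∀ f : R, f ≠ 0 → IsUnit (globalMap (a ≫ τ) f)) : ∃ l : Z ⟶ TK, l ≫ fst = a := by
  have hu' (f : nonZeroDivisors R) : IsUnit (globalMap (a ≫ τ) f) :=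
    hu f (nonZeroDivisors.coe_ne_zero f)
  let b : Z ⟶ Spec (.of K) := Z.toSpecΓ ≫ Spec.map (CommRingCat.ofHom
    (IsLocalization.lift (M := nonZeroDivisors R) (S := K) hu'))
  refine ⟨hp.lift a b ?_, hp.lift_fst _ _ _⟩
  rw [Category.assoc, ← Spec.map_comp, ← CommRingCat.ofHom_comp, IsLocalization.lift_comp,
    toSpecΓ_globalMap]

lemma mono_specMap_fractionRing : Mono (specMap R K) := by
  have : Epi (CommRingCat.ofHom (algebraMap R K)) :=
    IsLocalization.epi (nonZeroDivisors R) K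
  have : Mono (Scheme.Spec.map (CommRingCat.ofHom (algebraMap R K)).op) := inferInstance
  exact this

include hp in
lemma mono_fst : Mono fst := by
  have := mono_specMap_fractionRing (R := R) (K := K)
  exact (MorphismProperty.monomorphisms Scheme).of_isPullback hp.flip this

/-- The projection from the generic fibre. -/
def genericLift (V : GenericOpens τ) : TK ⟶ (genericOpensDiagram τ).obj V :=
  IsOpenImmersion.lift ((genericOpensι τ).app V) fst (range_fst_subset hp V)

lemma genericLift_ι (V : GenericOpens τ) : genericLift hp V ≫ (genericOpensι τ).app V = fst :=
  IsOpenImmersion.lift_fac _ _ _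

lemma genericLift_map {V W : GenericOpens τ} (f : V ⟶ W) :
    genericLift hp V ≫ (genericOpensDiagram τ).map f = genericLift hp W := by
  rw [← cancel_mono ((genericOpensι τ).app W), Category.assoc, genericOpensι_w, genericLift_ι,
    genericLift_ι]

/-- The generic fibre as a cone over the opens obtained by inverting one element. -/
abbrev genericCone : Limits.Cone (genericOpensDiagram τ) where
  pt := TK
  π :=
    { app V := genericLift hp V
      naturality _ _ f := (Category.id_comp _).trans (genericLift_map hp f).symm }

lemma cone_app_comp_ι (s : Limits.Cone (genericOpensDiagram τ)) (V W : GenericOpens τ) :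
    s.π.app V ≫ (genericOpensι τ).app V = s.π.app W ≫ (genericOpensι τ).app W := by
  obtain ⟨X, f, g, -⟩ := IsCofilteredOrEmpty.cone_objs V W
  rw [← s.w f, ← s.w g, Category.assoc, Category.assoc, (genericOpensι τ).naturality,
    (genericOpensι τ).naturality]
  rfl

include hp in
lemma exists_lift_cone (s : Limits.Cone (genericOpensDiagram τ)) (W : GenericOpens τ) :
    ∃ l : s.pt ⟶ TK, l ≫ fst = s.π.app W ≫ (genericOpensι τ).app W := by
  refine exists_lift_of_isUnit hp _ fun f hf ↦ ?_
  rw [globalMap_comp]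
  refine isUnit_appTop_of_range_subset _ _ ?_
  rw [cone_app_comp_ι s W ⟨_, f, hf, rfl⟩]
  rintro _ ⟨x, rfl⟩
  exact (s.π.app (⟨_, f, hf, rfl⟩ : GenericOpens τ) x).2

/-- The generic fibre is the limit of the opens obtained by inverting one element. -/
def isLimitGenericCone : Limits.IsLimit (genericCone hp) :=
  let one : GenericOpens τ := ⟨_, 1, one_ne_zero, rfl⟩
  { lift s := (exists_lift_cone hp s one).choose
    fac s V := by
      have h := (exists_lift_cone hp s one).choose_spec
      generalize (exists_lift_cone hp s one).choose = l at *
      rw [← cancel_mono ((genericOpensι τ).app V), cone_app_comp_ι s V one, ← h, Category.assoc]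
      exact congrArg (l ≫ ·) (genericLift_ι hp V)
    uniq s m hm := by
      have := mono_fst hp
      refine (cancel_mono fst).mp ?_
      rw [(exists_lift_cone hp s one).choose_spec, ← hm, Category.assoc]
      exact congrArg (m ≫ ·) (genericLift_ι hp one).symm }

-- A morphism from a cofiltered limit of quasi-compact quasi-separated schemes with affine
-- transition maps to a target of finite presentation factors through one term. The generic fibre is
-- such a limit, of the loci where one nonzero `f` is inverted.
include hp in
theorem exists_spread [QuasiCompact τ] [QuasiSeparated τ] (π : Y ⟶ Spec (.of R))
    [LocallyOfFinitePresentation π] (φ : TK ⟶ Y) (hφ : φ ≫ π = fst ≫ τ) :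
    ∃ f : R, f ≠ 0 ∧ ∃ ψ : (T.basicOpen (globalMap τ f)).toScheme ⟶ Y,
      ψ ≫ π = (T.basicOpen (globalMap τ f)).ι ≫ τ ∧
      ∃ l : TK ⟶ T.basicOpen (globalMap τ f), l ≫ (T.basicOpen (globalMap τ f)).ι = fst ∧
        l ≫ ψ = φ := by
  have : CompactSpace T := (quasiCompact_iff_compactSpace τ).mp inferInstance
  have : QuasiSeparatedSpace T := (quasiSeparated_iff_quasiSeparatedSpace τ).mp inferInstance
  have (V : GenericOpens τ) : CompactSpace ((genericOpensDiagram τ).obj V) :=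
    (quasiCompact_iff_compactSpace (V.1.ι ≫ τ)).mp inferInstance
  have (V : GenericOpens τ) : QuasiSeparatedSpace ((genericOpensDiagram τ).obj V) :=
    (quasiSeparated_iff_quasiSeparatedSpace (V.1.ι ≫ τ)).mp inferInstance
  let t : genericOpensDiagram τ ⟶ (Functor.const _).obj (Spec (.of R)) :=
    genericOpensι τ ≫ (Functor.const _).map τ
  have ht : (genericCone hp).π ≫ t = (Functor.const _).map (φ ≫ π) := by
    ext V
    rw [hφ]
    exact (Category.assoc _ _ _).symm.trans (congrArg (· ≫ τ) (genericLift_ι hp V))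
  obtain ⟨V, ψ, h₁, h₂⟩ := Scheme.exists_π_app_comp_eq_of_locallyOfFinitePresentation
    (genericOpensDiagram τ) t π (genericCone hp) (isLimitGenericCone hp) φ ht
  have h₃ := genericLift_ι hp V
  change genericLift hp V ≫ ψ = φ at h₁
  generalize genericLift hp V = l at h₁ h₃
  obtain ⟨_, f, hf, rfl⟩ := V
  exact ⟨f, hf, ψ, h₂, l, h₃, h₁⟩

end Spread

end ConicPoints

end

/-! ### Integrality under small perturbations -/

noncomputable section

namespace ConicPoints

/-- Values at a ring-valued point of a function regular near it stay integral under small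
perturbations of the point. -/
lemma exists_congruence {R A K B C D : Type u} [CommRing R] [CommRing A] [IsDomain A]
    [IsLocalRing A] [Field K] [Algebra A K] [CommRing B] [CommRing C] [CommRing D] [Algebra B D]
    (hAK : Function.Injective (algebraMap A K)) {m : A} (hm : m ∈ IsLocalRing.maximalIdeal A)
    (hm0 : m ≠ 0)
    (h : B) [IsLocalization.Away h D] (θ : C →+* D) (ρ : R →+* C) (hρ : ρ.FiniteType)
    (g₀ : B →+* A) (ψ₀ : D →+* K) (hψ₀ : ψ₀.comp (algebraMap B D) = (algebraMap A K).comp g₀)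
    (z₀ : C →+* A) (hz₀ : (algebraMap A K).comp z₀ = ψ₀.comp θ) :
    ∃ c : A, c ≠ 0 ∧ c ∈ IsLocalRing.maximalIdeal A ∧
      ∀ g : B →+* A, (∀ b, c ∣ g b - g₀ b) → g h ≠ 0 ∧
      ∀ ψ : D →+* K, ψ.comp (algebraMap B D) = (algebraMap A K).comp g →
        (∀ r, ψ (θ (ρ r)) ∈ (algebraMap A K).range) →
        ∃ z : C →+* A, (algebraMap A K).comp z = ψ.comp θ := by
  have hψ₀' (b : B) : ψ₀ (algebraMap B D b) = algebraMap A K (g₀ b) := congr($hψ₀ b)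
  set v := g₀ h with hv
  have hv0 : v ≠ 0 := by
    intro h0
    have := (IsLocalization.Away.algebraMap_isUnit (S := D) h).map ψ₀
    rw [hψ₀', ← hv, h0, map_zero] at this
    exact not_isUnit_zero this
  let := ρ.toAlgebra
  have : Algebra.FiniteType R C := hρ
  obtain ⟨s, hs⟩ := this.out
  -- One exponent `n` clears the denominators of the finitely many generators.
  obtain ⟨n, hn⟩ : ∃ n : ℕ, ∀ x ∈ s, ∃ b : B, θ x * algebraMap B D h ^ n = algebraMap B D b := by
    have key : ∀ x : C, ∃ (n : ℕ) (b : B), θ x * algebraMap B D h ^ n = algebraMap B D b :=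
      fun x ↦ IsLocalization.Away.surj h (θ x)
    choose n b hb using key
    refine ⟨s.sup n, fun x hx ↦ ⟨b x * h ^ (s.sup n - n x), ?_⟩⟩
    rw [map_mul, map_pow, ← hb, mul_assoc, ← pow_add, Nat.add_sub_cancel' (Finset.le_sup hx)]
  -- Modulo this element `h` keeps its value `v` up to a unit: the new value is `v (1 + m v ^ n d)`,
  -- and `m` lies in the maximal ideal. The remaining `v ^ n` absorbs the denominator of the
  -- generators.
  refine ⟨m * v ^ (n + 1), mul_ne_zero hm0 (pow_ne_zero _ hv0), Ideal.mul_mem_right _ _ hm,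
    fun g hg ↦ ?_⟩
  obtain ⟨e, he, hge⟩ : ∃ e : A, IsUnit e ∧ g h = v * e := by
    obtain ⟨d, hd⟩ := hg h
    refine ⟨1 + m * (v ^ n * d), ?_, by rw [sub_eq_iff_eq_add] at hd; rw [hd]; ring⟩
    by_contra hne
    refine (IsLocalRing.maximalIdeal.isMaximal A).ne_top ((Ideal.eq_top_iff_one _).mpr ?_)
    rw [show (1 : A) = (1 + m * (v ^ n * d)) - m * (v ^ n * d) by ring]
    exact Ideal.sub_mem _ ((IsLocalRing.mem_maximalIdeal _).mpr hne) (Ideal.mul_mem_right _ _ hm)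
  refine ⟨by rw [hge]; exact mul_ne_zero hv0 he.ne_zero, fun ψ hψ hR ↦ ?_⟩
  have hψ' (b : B) : ψ (algebraMap B D b) = algebraMap A K (g b) := congr($hψ b)
  have hmem (x : C) : ψ (θ x) ∈ (algebraMap A K).range := by
    have hx : x ∈ Algebra.adjoin R (s : Set C) := hs ▸ Algebra.mem_top
    induction hx using Algebra.adjoin_induction with
    | algebraMap r => exact hR r
    | add x y _ _ hx hy => rw [map_add, map_add]; exact add_mem hx hy
    | mul x y _ _ hx hy => rw [map_mul, map_mul]; exact mul_mem hx hy
    | mem x hx =>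
      obtain ⟨b, hb⟩ := hn x hx
      have h1 := congr(ψ₀ $hb)
      have h2 := congr(ψ $hb)
      simp only [map_mul, map_pow, hψ₀', hψ'] at h1 h2
      have h3 : ψ₀ (θ x) = algebraMap A K (z₀ x) := congr($hz₀.symm x)
      rw [h3, ← map_pow, ← map_mul] at h1
      have h4 := hAK h1
      obtain ⟨d, hd⟩ := hg b
      obtain ⟨e', he'⟩ := (he.pow n).exists_left_inv
      -- If `x = b / h ^ n`, the new value is `(z₀ x * v ^ n + m * v ^ (n + 1) * d) / (v * e) ^ n`,
      -- in which `v ^ n` cancels.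
      refine ⟨(z₀ x + m * v * d) * e', ?_⟩
      have h5 : algebraMap A K (g h ^ n) ≠ 0 := by
        rw [Ne, map_eq_zero_iff _ hAK, hge]
        exact pow_ne_zero _ (mul_ne_zero hv0 he.ne_zero)
      refine mul_right_cancel₀ h5 ?_
      rw [map_pow, h2, ← map_pow, ← map_mul]
      congr 1
      rw [hge, mul_pow]
      rw [← hv] at h4
      rw [sub_eq_iff_eq_add, ← h4] at hd
      rw [hd]
      linear_combination ((z₀ x + m * v * d) * v ^ n) * he'
  choose z hz using hmem
  refine ⟨⟨⟨⟨z, hAK ?_⟩, fun x y ↦ hAK ?_⟩, hAK ?_, fun x y ↦ hAK ?_⟩, ?_⟩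
  · simp [hz]
  · simp [hz]
  · simp [hz]
  · simp [hz]
  · ext x
    exact hz x

lemma exists_ringHom_fromSpec {X : Scheme.{u}} {W : X.Opens} (hW : IsAffineOpen W) {A : Type u}
    [CommRing A] (a : Spec (.of A) ⟶ X) (ha : Set.range a ⊆ W) :
    ∃ κ : Γ(X, W) →+* A, Spec.map (CommRingCat.ofHom κ) ≫ hW.fromSpec = a := by
  refine ⟨(Spec.preimage (IsOpenImmersion.lift hW.fromSpec a (by simpa using ha))).hom, ?_⟩
  rw [CommRingCat.ofHom_hom, Spec.map_preimage, IsOpenImmersion.lift_fac]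

lemma ringHom_ext_of_fromSpec {X : Scheme.{u}} {W : X.Opens} (hW : IsAffineOpen W) {A : Type u}
    [CommRing A] {κ κ' : Γ(X, W) →+* A}
    (h : Spec.map (CommRingCat.ofHom κ) ≫ hW.fromSpec =
      Spec.map (CommRingCat.ofHom κ') ≫ hW.fromSpec) : κ = κ' := by
  rw [cancel_mono] at h
  exact congrArg CommRingCat.Hom.hom (Spec.map_injective h)

lemma specMap_comp_map {A B C : Type u} [CommRing A] [CommRing B] [CommRing C] [Algebra A B]
    (f : C →+* A) : specMap A B ≫ Spec.map (CommRingCat.ofHom f) =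
      Spec.map (CommRingCat.ofHom ((algebraMap A B).comp f)) := by
  rw [CommRingCat.ofHom_comp, Spec.map_comp]

lemma range_subset_of_closedPoint_mem {A : Type u} [CommRing A] [IsLocalRing A] {X : Scheme.{u}}
    (a : Spec (.of A) ⟶ X) {W : X.Opens} (h : a (IsLocalRing.closedPoint A) ∈ W) :
    Set.range a ⊆ W := by
  rintro _ ⟨x, rfl⟩
  exact ((IsLocalRing.specializes_closedPoint (R := A) x).map a.continuous).mem_open W.2 h

/-- The geometric form of `exists_congruence`. As `A` is local, morphisms from `Spec A` land in an
affine neighbourhood of the image of the closed point, so everything reduces to ring homomorphisms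
out of affine charts of `T` and `Y`. -/
theorem exists_extension_of_congruent {R A K : Type u} [CommRing R] [CommRing A] [IsDomain A]
    [IsLocalRing A] [Field K] [Algebra R A] [Algebra A K] [Algebra R K] [IsScalarTower R A K]
    (hAK : Function.Injective (algebraMap A K)) {m : A} (hm : m ∈ IsLocalRing.maximalIdeal A)
    (hm0 : m ≠ 0) {T Y : Scheme.{u}} {O : T.Opens} (φ : O.toScheme ⟶ Y)
    (π : Y ⟶ Spec (.of R)) [LocallyOfFiniteType π] (g₀ : Spec (.of A) ⟶ T)
    (z₀ : Spec (.of A) ⟶ Y) (y₀ : Spec (.of K) ⟶ O)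
    (hy₀ : y₀ ≫ O.ι = specMap A K ≫ g₀) (hz₀ : specMap A K ≫ z₀ = y₀ ≫ φ) :
    ∃ c : A, c ≠ 0 ∧ ∀ g : Spec (.of A) ⟶ T,
      specMap A (A ⧸ Ideal.span {c}) ≫ g = specMap A (A ⧸ Ideal.span {c}) ≫ g₀ →
      ∀ y : Spec (.of K) ⟶ O, y ≫ O.ι = specMap A K ≫ g → y ≫ φ ≫ π = specMap R K →
      ∃ z : Spec (.of A) ⟶ Y, z ≫ π = specMap R A ∧ specMap A K ≫ z = y ≫ φ := by
  obtain ⟨_, ⟨V, hV, rfl⟩, hzV, -⟩ := Y.isBasis_affineOpens.exists_subset_of_mem_open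
    (Set.mem_univ (z₀ (IsLocalRing.closedPoint A))) isOpen_univ
  obtain ⟨_, ⟨W, hW, rfl⟩, hgW, -⟩ := T.isBasis_affineOpens.exists_subset_of_mem_open
    (Set.mem_univ (g₀ (IsLocalRing.closedPoint A))) isOpen_univ
  obtain ⟨κ₀, hκ₀⟩ := exists_ringHom_fromSpec hW g₀ (range_subset_of_closedPoint_mem g₀ hgW)
  obtain ⟨ζ₀, hζ₀⟩ := exists_ringHom_fromSpec hV z₀ (range_subset_of_closedPoint_mem z₀ hzV)
  let pt : Spec (.of K) := IsLocalRing.closedPoint K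
  have hQ : (y₀ ≫ O.ι) pt ∈ O.ι ''ᵁ (φ ⁻¹ᵁ V) := by
    refine ⟨y₀ pt, ?_, rfl⟩
    change (y₀ ≫ φ) pt ∈ V
    rw [← hz₀]
    exact range_subset_of_closedPoint_mem z₀ hzV ⟨specMap A K pt, rfl⟩
  have hQW : (y₀ ≫ O.ι) pt ∈ W := by
    rw [hy₀]
    exact range_subset_of_closedPoint_mem g₀ hgW ⟨specMap A K pt, rfl⟩
  -- On this basic open of the chart `W`, the morphism `φ` is defined and maps into the affine `V`.
  -- It contains the generic point of `g₀`, but not necessarily its closed point; hence the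
  -- denominators `h`.
  obtain ⟨h, hhQ, hh⟩ := hW.exists_basicOpen_le ⟨_, hQ⟩ hQW
  have hD := hW.basicOpen h
  have := hW.isLocalization_basicOpen h
  have hDW : Spec.map (CommRingCat.ofHom (algebraMap Γ(T, W) Γ(T, T.basicOpen h))) ≫ hW.fromSpec =
      hD.fromSpec := hW.map_fromSpec hD (homOfLE (T.basicOpen_le h)).op
  have hDO : T.basicOpen h ≤ O := hhQ.trans (by rintro _ ⟨x, -, rfl⟩; exact x.2)
  let Θ : Spec Γ(T, T.basicOpen h) ⟶ O := IsOpenImmersion.lift O.ι hD.fromSpec (by simpa using hDO)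
  have hΘ : Θ ≫ O.ι = hD.fromSpec := IsOpenImmersion.lift_fac _ _ _
  obtain ⟨θ, hθ⟩ := exists_ringHom_fromSpec hV (Θ ≫ φ) (by
    rintro _ ⟨x, rfl⟩
    have hx : (Θ ≫ O.ι) x ∈ O.ι ''ᵁ (φ ⁻¹ᵁ V) := by
      rw [hΘ]
      refine hhQ ?_
      have : hD.fromSpec x ∈ Set.range hD.fromSpec := ⟨x, rfl⟩
      rwa [hD.range_fromSpec] at this
    obtain ⟨w, hw, hwx⟩ := hx
    have : w = Θ x := O.ι.injective hwx
    rw [this] at hw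
    exact hw)
  obtain ⟨ψ₀, hψ₀⟩ := exists_ringHom_fromSpec hD (y₀ ≫ O.ι) (range_subset_of_closedPoint_mem _ hh)
  have hψ₀Θ : Spec.map (CommRingCat.ofHom ψ₀) ≫ Θ = y₀ := by
    rw [← cancel_mono O.ι, Category.assoc, hΘ, hψ₀]
  let ρ : R →+* Γ(Y, V) := (Spec.preimage (hV.fromSpec ≫ π)).hom
  have hρ' : Spec.map (CommRingCat.ofHom ρ) = hV.fromSpec ≫ π := Spec.map_preimage _
  have hρ : ρ.FiniteType := by
    rw [← CommRingCat.hom_ofHom ρ, ← HasRingHomProperty.Spec_iff (P := @LocallyOfFiniteType), hρ']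
    have := hV.isOpenImmersion_fromSpec
    infer_instance
  obtain ⟨c, hc0, hcm, hc⟩ := exists_congruence hAK hm hm0 h θ ρ hρ κ₀ ψ₀ (by
      apply ringHom_ext_of_fromSpec hW
      rw [CommRingCat.ofHom_comp, Spec.map_comp, Category.assoc, hDW, hψ₀, hy₀, ← specMap_comp_map,
        Category.assoc, hκ₀]) ζ₀ (by
      apply ringHom_ext_of_fromSpec hV
      rw [← specMap_comp_map, Category.assoc, hζ₀, hz₀, CommRingCat.ofHom_comp, Spec.map_comp,
        Category.assoc, hθ, ← Category.assoc, hψ₀Θ])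
  refine ⟨c, hc0, fun g hg y hy hyπ ↦ ?_⟩
  have hgW' : g (IsLocalRing.closedPoint A) ∈ W := by
    -- As `c` is in the maximal ideal, the closed point of `Spec A` lies on `Spec (A ⧸ c)`, where
    -- `g` and `g₀` agree.
    obtain ⟨x, hx⟩ : IsLocalRing.closedPoint A ∈
        Set.range (PrimeSpectrum.comap (algebraMap A (A ⧸ Ideal.span {c}))) := by
      refine (range_comap_of_surjective _ (algebraMap A (A ⧸ Ideal.span {c}))
        Ideal.Quotient.mk_surjective).ge ?_
      suffices c ∈ (IsLocalRing.closedPoint A).asIdeal by simpa [PrimeSpectrum.mem_zeroLocus]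
      exact hcm
    have hx' : (specMap A (A ⧸ Ideal.span {c}) ≫ g) x = (specMap A (A ⧸ Ideal.span {c}) ≫ g₀) x := by
      rw [hg]
    have hx₁ : g (specMap A (A ⧸ Ideal.span {c}) x) = g₀ (specMap A (A ⧸ Ideal.span {c}) x) := hx'
    have hx₂ : specMap A (A ⧸ Ideal.span {c}) x = IsLocalRing.closedPoint A := hx
    rw [hx₂] at hx₁
    exact hx₁ ▸ hgW
  obtain ⟨κ, hκ⟩ := exists_ringHom_fromSpec hW g (range_subset_of_closedPoint_mem g hgW')
  obtain ⟨hh0, hc'⟩ := hc κ (fun b ↦ by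
    rw [← Ideal.mem_span_singleton, ← Ideal.Quotient.eq]
    have : (algebraMap A (A ⧸ Ideal.span {c})).comp κ =
        (algebraMap A (A ⧸ Ideal.span {c})).comp κ₀ := by
      apply ringHom_ext_of_fromSpec hW
      rw [← specMap_comp_map, ← specMap_comp_map, Category.assoc, Category.assoc, hκ, hκ₀, hg]
    exact congr($this b))
  have hu : IsUnit ((algebraMap A K).comp κ h) := by
    rw [isUnit_iff_ne_zero, RingHom.comp_apply, Ne, map_eq_zero_iff _ hAK]
    exact hh0
  let ψ : Γ(T, T.basicOpen h) →+* K := IsLocalization.Away.lift h hu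
  have hψ : ψ.comp (algebraMap _ _) = (algebraMap A K).comp κ := IsLocalization.Away.lift_comp h hu
  have hψΘ : Spec.map (CommRingCat.ofHom ψ) ≫ Θ = y := by
    rw [← cancel_mono O.ι, Category.assoc, hΘ, ← hDW, ← Category.assoc, ← Spec.map_comp,
      ← CommRingCat.ofHom_comp, hψ, ← specMap_comp_map, Category.assoc, hκ, hy]
  have hyV : y ≫ φ = Spec.map (CommRingCat.ofHom (ψ.comp θ)) ≫ hV.fromSpec := by
    rw [CommRingCat.ofHom_comp, Spec.map_comp, Category.assoc, hθ, ← Category.assoc, hψΘ]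
  obtain ⟨z, hz⟩ := hc' ψ hψ fun r ↦ by
    have hR : Spec.map (CommRingCat.ofHom ((ψ.comp θ).comp ρ)) = specMap R K := by
      rw [CommRingCat.ofHom_comp, Spec.map_comp, hρ', ← Category.assoc, ← hyV, Category.assoc, hyπ]
    have : (ψ.comp θ).comp ρ = algebraMap R K := congrArg CommRingCat.Hom.hom (Spec.map_injective hR)
    refine ⟨algebraMap R A r, ?_⟩
    rw [← IsScalarTower.algebraMap_apply, ← this]
    rfl
  have hz' : specMap A K ≫ Spec.map (CommRingCat.ofHom z) ≫ hV.fromSpec = y ≫ φ := by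
    rw [← Category.assoc, specMap_comp_map, hz, hyV]
  refine ⟨Spec.map (CommRingCat.ofHom z) ≫ hV.fromSpec, hom_ext_of_injective hAK ?_, hz'⟩
  rw [← Category.assoc, hz', Category.assoc, hyπ, specMap_comp]

/-- Among the translates by a congruence-periodic family of sections, infinitely many extend to
sections of the target. -/
theorem exists_sections {R K : Type u} [CommRing R] [IsDomain R] [Field K] [Algebra R K]
    [IsFractionRing R K] (hfin : ∀ f : R, f ≠ 0 → {p : PrimeSpectrum R | f ∈ p.asIdeal}.Finite)
    {T TK Y : Scheme.{u}} {τ : T ⟶ Spec (.of R)} {fst : TK ⟶ T} {snd : TK ⟶ Spec (.of K)}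
    (hp : IsPullback fst snd τ (specMap R K)) [QuasiCompact τ] [QuasiSeparated τ]
    (π : Y ⟶ Spec (.of R)) [IsSeparated π] [LocallyOfFinitePresentation π] (φ : TK ⟶ Y)
    (hφ : φ ≫ π = fst ≫ τ) (g : ℕ → (Spec (.of R) ⟶ T)) (hg : ∀ n, g n ≫ τ = 𝟙 _)
    (H : ∀ (p : PrimeSpectrum R) (c : localRing R K p), c ≠ 0 → ∃ k > 0, ∀ n,
      specMap R (localRing R K p ⧸ Ideal.span {c}) ≫ g (k * n) =
        specMap R (localRing R K p ⧸ Ideal.span {c}) ≫ g 0)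
    (y : ℕ → (Spec (.of K) ⟶ TK)) (hy : ∀ n, y n ≫ fst = specMap R K ≫ g n)
    (P₀ : Spec (.of R) ⟶ Y) (hP₀ : specMap R K ≫ P₀ = y 0 ≫ φ) :
    ∃ k > 0, ∀ n, ∃ s : Spec (.of R) ⟶ Y, s ≫ π = 𝟙 _ ∧ specMap R K ≫ s = y (k * n) ≫ φ := by
  obtain ⟨f, hf, ψ, hψ, l, hl, hlψ⟩ := exists_spread hp π φ hφ
  have hyψ (n) : (y n ≫ l) ≫ ψ = y n ≫ φ := by rw [Category.assoc, hlψ]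
  have hyl (n) : (y n ≫ l) ≫ (T.basicOpen (globalMap τ f)).ι = specMap R K ≫ g n := by
    rw [Category.assoc, hl, hy]
  have hyπ (n) : (y n ≫ l) ≫ ψ ≫ π = specMap R K := by
    rw [hψ, ← Category.assoc, hyl, Category.assoc, hg, Category.comp_id]
  have key (p : PrimeSpectrum R) (hfp : f ∈ p.asIdeal) : ∃ k > 0, ∀ n,
      ∃ z : Spec (.of (localRing R K p)) ⟶ Y, z ≫ π = specMap R _ ∧
        specMap (localRing R K p) K ≫ z = y (k * n) ≫ φ := by
    have hinj : Function.Injective (algebraMap (localRing R K p) K) := Subtype.val_injective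
    obtain ⟨c, hc0, hc⟩ := exists_extension_of_congruent (A := localRing R K p) hinj
      (m := algebraMap R _ f) ((IsLocalization.AtPrime.to_map_mem_maximal_iff _ p.asIdeal f).mpr hfp)
      (by
        intro h0
        have := congrArg (algebraMap (localRing R K p) K) h0
        rw [← IsScalarTower.algebraMap_apply, map_zero,
          map_eq_zero_iff _ (IsFractionRing.injective R K)] at this
        exact hf this) ψ π
      (specMap R (localRing R K p) ≫ g 0) (specMap R (localRing R K p) ≫ P₀) (y 0 ≫ l)
      (by rw [hyl, ← Category.assoc, specMap_comp])
      (by rw [hyψ, ← hP₀, ← Category.assoc, specMap_comp])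
    obtain ⟨k, hk, hkn⟩ := H p c hc0
    refine ⟨k, hk, fun n ↦ ?_⟩
    obtain ⟨z, hz, hz'⟩ := hc (specMap R (localRing R K p) ≫ g (k * n))
      (by rw [← Category.assoc, ← Category.assoc, specMap_comp, hkn]) (y (k * n) ≫ l)
      (by rw [hyl, ← Category.assoc, specMap_comp]) (hyπ _)
    exact ⟨z, hz, by rw [hz', hyψ]⟩
  choose! k hk hkn using key
  -- A common multiple of the local periods at the primes containing `f`.
  refine ⟨∏ p ∈ (hfin f hf).toFinset, k p,
    Finset.prod_pos fun p hp ↦ hk p (by simpa using hp), fun n ↦ ?_⟩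
  refine exists_section_of_forall_prime π _ (by rw [← hyψ, Category.assoc, hyπ]) fun p ↦ ?_
  by_cases hfp : f ∈ p.asIdeal
  · obtain ⟨d, hd⟩ := Finset.dvd_prod_of_mem k (show p ∈ (hfin f hf).toFinset by simpa using hfp)
    rw [hd, mul_assoc]
    exact hkn p hfp _
  · set N := (∏ p ∈ (hfin f hf).toFinset, k p) * n
    -- Away from `f` the section factors through the locus where the spread-out morphism `ψ` is
    -- defined.
    have hu : IsUnit ((specMap R (localRing R K p) ≫ g N).appTop (globalMap τ f)) := by
      rw [← globalMap_comp, Category.assoc, hg, Category.comp_id, ← Category.id_comp (specMap R _)]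
      exact isUnit_globalMap _ _ (IsLocalization.map_units (M := p.asIdeal.primeCompl) _ ⟨f, hfp⟩)
    let a : Spec (.of (localRing R K p)) ⟶ T.basicOpen (globalMap τ f) :=
      IsOpenImmersion.lift (T.basicOpen (globalMap τ f)).ι _
        ((range_subset_basicOpen _ _ hu).trans (Scheme.Opens.range_ι _).ge)
    have ha : a ≫ (T.basicOpen (globalMap τ f)).ι = specMap R (localRing R K p) ≫ g N :=
      IsOpenImmersion.lift_fac _ _ _
    refine ⟨a ≫ ψ, ?_, ?_⟩
    · rw [Category.assoc, hψ, ← Category.assoc, ha, Category.assoc, hg, Category.comp_id]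
    · rw [← hyψ, ← Category.assoc]
      congr 1
      rw [← cancel_mono (T.basicOpen (globalMap τ f)).ι, Category.assoc, ha, hyl, ← Category.assoc,
        specMap_comp]

end ConicPoints

end

/-! ### Arithmetic of the `S`-integers and units of infinite order -/

noncomputable section

namespace ConicPoints

/-- If `c = a / s`, then `A / a` maps to `B / c`. The map is onto: a denominator `t` becomes a unit
of finite order in `B / c`, because its powers already repeat in the finite ring `A / a`, so its
inverse is a power of `t`. -/
lemma finite_quotient_of_isLocalization {A B : Type*} [CommRing A] [CommRing B] [Algebra A B]
    (M : Submonoid A) [IsLocalization M B] (h : ∀ a : A, a ≠ 0 → Finite (A ⧸ Ideal.span {a}))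
    {c : B} (hc : c ≠ 0) : Finite (B ⧸ Ideal.span {c}) := by
  obtain ⟨⟨a, s⟩, has⟩ := IsLocalization.surj M c
  have ha : a ≠ 0 := by
    rintro rfl
    rw [map_zero] at has
    exact hc (((IsLocalization.map_units B s).mul_left_eq_zero).mp has)
  have := h a ha
  let f : A →+* B ⧸ Ideal.span {c} := (Ideal.Quotient.mk _).comp (algebraMap A B)
  have hfa : ∀ x ∈ Ideal.span {a}, f x = 0 := by
    intro x hx
    obtain ⟨y, rfl⟩ := Ideal.mem_span_singleton.mp hx
    rw [map_mul]
    simp only [f, RingHom.comp_apply, ← has, map_mul]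
    rw [Ideal.Quotient.eq_zero_iff_mem.mpr (Ideal.mem_span_singleton_self c), zero_mul, zero_mul]
  refine Finite.of_surjective (Ideal.Quotient.lift _ f hfa) fun b ↦ ?_
  obtain ⟨b, rfl⟩ := Ideal.Quotient.mk_surjective b
  obtain ⟨⟨x, t⟩, hxt⟩ := IsLocalization.surj M b
  obtain ⟨i, j, hij, hpow⟩ := Finite.exists_ne_map_eq_of_infinite
    fun n : ℕ ↦ (Ideal.Quotient.mk (Ideal.span {a}) (t : A)) ^ n
  wlog hlt : i < j generalizing i j
  · exact this j i hij.symm hpow.symm (lt_of_le_of_ne (not_lt.mp hlt) hij.symm)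
  have hu : IsUnit (f t) := (IsLocalization.map_units B t).map (Ideal.Quotient.mk (Ideal.span {c}))
  have hft : f t ^ i = f t ^ j := by simpa using congr(Ideal.Quotient.lift _ f hfa $hpow)
  obtain ⟨d, rfl⟩ := Nat.exists_eq_add_of_lt hlt
  have h1 : f t ^ (d + 1) = 1 := by
    have : f t ^ i * f t ^ (d + 1) = f t ^ i * 1 := by rw [← pow_add, mul_one, hft, add_assoc]
    exact (hu.pow i).mul_left_cancel this
  refine ⟨Ideal.Quotient.mk _ (x * t ^ d), ?_⟩
  have hx : f x = Ideal.Quotient.mk _ b * f t := by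
    simp only [f, RingHom.comp_apply, ← hxt, map_mul]
  rw [Ideal.Quotient.lift_mk, map_mul, map_pow, hx, mul_assoc, ← pow_succ', h1, mul_one]

lemma finite_primes_of_finite_quotient {A : Type*} [CommRing A] (f : A)
    [Finite (A ⧸ Ideal.span {f})] : {p : PrimeSpectrum A | f ∈ p.asIdeal}.Finite := by
  have : {p : PrimeSpectrum A | f ∈ p.asIdeal} =
      Set.range (PrimeSpectrum.comap (Ideal.Quotient.mk (Ideal.span {f}))) := by
    rw [range_comap_of_surjective _ _ Ideal.Quotient.mk_surjective]
    ext p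
    simp [PrimeSpectrum.mem_zeroLocus]
  rw [this]
  exact Set.finite_range _

lemma isNoetherianRing_of_finite_quotient {A : Type*} [CommRing A]
    (h : ∀ a : A, a ≠ 0 → Finite (A ⧸ Ideal.span {a})) : IsNoetherianRing A := by
  refine isNoetherianRing_iff_ideal_fg A |>.mpr fun I ↦ ?_
  by_cases hI : I = ⊥
  · rw [hI]
    exact Submodule.fg_bot
  obtain ⟨a, haI, ha⟩ := Submodule.exists_mem_ne_zero_of_ne_bot hI
  have := h a ha
  refine Submodule.fg_of_fg_map_of_fg_inf_ker (Submodule.mkQ (Ideal.span {a})) ?_ ?_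
  · exact IsNoetherian.noetherian _
  · rw [Submodule.ker_mkQ, inf_eq_right.mpr ((Ideal.span_singleton_le_iff_mem I).mpr haI)]
    exact Submodule.fg_span_singleton a

section ClassGroup

variable {A : Type*} [CommRing A] [IsDedekindDomain A] [Finite (ClassGroup A)]
  (v : HeightOneSpectrum A)

lemma exists_pow_eq_span : ∃ n > 0, ∃ a : A, v.asIdeal ^ n = Ideal.span {a} := by
  have hv : v.asIdeal ∈ nonZeroDivisors (Ideal A) := mem_nonZeroDivisors_of_ne_zero v.ne_bot
  refine ⟨Nat.card (ClassGroup A), Nat.card_pos, ?_⟩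
  have h := pow_card_eq_one' (x := ClassGroup.mk0 ⟨v.asIdeal, hv⟩)
  rw [← map_pow, SubmonoidClass.mk_pow, ClassGroup.mk0_eq_one_iff] at h
  exact ⟨_, (Ideal.span_singleton_generator _).symm⟩

/-- An element supported at one given prime. -/
lemma exists_mem_iff_eq : ∃ a : A, a ≠ 0 ∧ ∀ w : HeightOneSpectrum A, a ∈ w.asIdeal ↔ w = v := by
  obtain ⟨n, hn, a, ha⟩ := exists_pow_eq_span v
  refine ⟨a, ?_, fun w ↦ ?_⟩
  · rintro rfl
    rw [Ideal.span_singleton_zero] at ha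
    exact v.ne_bot (pow_eq_zero_iff hn.ne' |>.mp ha)
  · rw [← Ideal.span_singleton_le_iff_mem, ← ha]
    refine ⟨fun h ↦ ?_, ?_⟩
    · have := v.isPrime.isMaximal v.ne_bot |>.eq_of_le w.isPrime.ne_top (w.isPrime.le_of_pow_le h)
      exact HeightOneSpectrum.ext this.symm
    · rintro rfl
      exact Ideal.pow_le_self hn.ne'

end ClassGroup

section OS

variable (K : Type u) [Field K] [NumberField K] (S : Finset (HeightOneSpectrum (𝓞 K)))

/-- The integers of `K` that become units in the `S`-integers. -/
abbrev sUnits : Submonoid (𝓞 K) := (IsUnit.submonoid (OS K S)).comap (algebraMap (𝓞 K) (OS K S))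

variable {K} in
lemma isUnit_OS (x : OS K S) (hx : ∀ v ∉ S, v.valuation K (x : K) = 1) (h0 : (x : K) ≠ 0) :
    IsUnit x := by
  refine IsUnit.of_mul_eq_one ⟨(x : K)⁻¹, fun v hv ↦ ?_⟩ (Subtype.ext ?_)
  · rw [map_inv₀, hx v hv, inv_one]
  · exact mul_inv_cancel₀ h0

variable {K} in
lemma isUnit_OS_of_forall_notMem (a : 𝓞 K) (ha : a ≠ 0)
    (h : ∀ v : HeightOneSpectrum (𝓞 K), a ∈ v.asIdeal → v ∈ S) :
    IsUnit (algebraMap (𝓞 K) (OS K S) a) := by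
  refine isUnit_OS _ _ (fun v hv ↦ ?_) ?_
  · exact (HeightOneSpectrum.valuation_eq_one_iff_notMem (K := K) v).mpr fun hav ↦ hv (h v hav)
  · exact fun h0 ↦ ha ((map_eq_zero_iff _ (IsFractionRing.injective (𝓞 K) K)).mp h0)

variable {K} in
lemma exists_valuation_pow_le {v : HeightOneSpectrum (𝓞 K)} {a : 𝓞 K} (ha : a ∈ v.asIdeal)
    (x : K) : ∃ n : ℕ, v.valuation K ((algebraMap (𝓞 K) K a) ^ n * x) ≤ 1 := by
  by_cases hx : x = 0
  · exact ⟨0, by simp [hx]⟩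
  have hv : v.valuation K x ≠ 0 := (Valuation.ne_zero_iff _).mpr hx
  obtain ⟨n, hn⟩ := exists_pow_lt₀ ((v.valuation_lt_one_iff_mem (K := K) a).mpr ha)
    (Units.mk0 _ hv)⁻¹
  refine ⟨n, ?_⟩
  rw [map_mul, map_pow]
  refine (mul_le_mul_left hn.le _).trans ?_
  simp [hv]

/-- By finiteness of the class group, each place of `S` carries an integer supported at it alone.
Powers of these integers, which are `S`-units, clear the denominator of any `S`-integer. -/
instance : IsLocalization (sUnits K S) (OS K S) where
  map_units m := m.2
  exists_of_eq {x y} h := by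
    refine ⟨1, ?_⟩
    have := congrArg (algebraMap (OS K S) K) h
    rw [← IsScalarTower.algebraMap_apply, ← IsScalarTower.algebraMap_apply] at this
    rw [IsFractionRing.injective (𝓞 K) K this]
  surj x := by
    classical
    choose a ha0 ha using fun v : HeightOneSpectrum (𝓞 K) ↦ exists_mem_iff_eq v
    choose n hn using fun v : HeightOneSpectrum (𝓞 K) ↦
      exists_valuation_pow_le ((ha v v).mpr rfl) (x : K)
    let b : 𝓞 K := ∏ v ∈ S, a v ^ n v
    have hb0 : b ≠ 0 := Finset.prod_ne_zero_iff.mpr fun v _ ↦ pow_ne_zero _ (ha0 v)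
    have hbS : ∀ v : HeightOneSpectrum (𝓞 K), b ∈ v.asIdeal → v ∈ S := by
      intro v hv
      obtain ⟨w, hw, hwv⟩ := (v.isPrime.prod_mem_iff).mp hv
      rwa [(ha w v).mp (v.isPrime.mem_of_pow_mem _ hwv)]
    obtain ⟨y, hy⟩ := HeightOneSpectrum.mem_integers_of_valuation_le_one (R := 𝓞 K) K
      (algebraMap (𝓞 K) K b * x) (fun v ↦ by
        by_cases hv : v ∈ S
        · rw [show b = (∏ w ∈ S.erase v, a w ^ n w) * a v ^ n v from
            (Finset.prod_erase_mul _ _ hv).symm, map_mul (algebraMap (𝓞 K) K), mul_assoc, map_mul, map_pow]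
          exact mul_le_one' (v.valuation_le_one _) (hn v)
        · rw [map_mul]
          exact mul_le_one' (v.valuation_le_one _) (x.2 v hv))
    refine ⟨⟨y, ⟨b, isUnit_OS_of_forall_notMem S b hb0 hbS⟩⟩, Subtype.ext ?_⟩
    rw [mul_comm]
    exact hy.symm

instance : IsFractionRing (OS K S) K := by
  have : sUnits K S ≤ nonZeroDivisors (𝓞 K) := by
    intro m hm
    refine mem_nonZeroDivisors_of_ne_zero ?_
    rintro rfl
    have : IsUnit (algebraMap (𝓞 K) (OS K S) 0) := hm
    rw [map_zero] at this
    exact not_isUnit_zero this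
  exact IsFractionRing.isFractionRing_of_isDomain_of_isLocalization (sUnits K S) (OS K S) K

/-- The `S`-integers are an intersection of valuation rings, and each of these is integrally closed.
-/
instance : IsIntegrallyClosed (OS K S) := by
  refine (isIntegrallyClosed_iff K).mpr fun {x} hx ↦ ?_
  refine ⟨⟨x, fun v hvS ↦ ?_⟩, rfl⟩
  have hv : (v.valuation K).Integers (v.valuation K).integer := Valuation.integer.integers _
  refine hv.mem_of_integral ?_
  let f : OS K S →+* (v.valuation K).integer := 
    (algebraMap (OS K S) K).codRestrict _ fun y ↦ y.2 v hvS
  obtain ⟨p, hp, hpx⟩ := hx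
  exact ⟨p.map f, hp.map f, by rw [Polynomial.eval₂_map]; exact hpx⟩

lemma finite_quotient_OS (c : OS K S) (hc : c ≠ 0) : Finite (OS K S ⧸ Ideal.span {c}) :=
  finite_quotient_of_isLocalization (sUnits K S)
    (fun a ha ↦ Ideal.finiteQuotientOfFreeOfNeBot _ (by simpa using ha)) hc

instance : IsNoetherianRing (OS K S) :=
  isNoetherianRing_of_finite_quotient (finite_quotient_OS K S)

/-- There is a unit of infinite order if there is more than one place. -/
lemma exists_unit_OS (h : 1 < numPlaces K S) :
    ∃ ε : OS K S, IsUnit ε ∧ ∀ n > 0, ε ^ n ≠ 1 := by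
  obtain rfl | ⟨v, hv⟩ := S.eq_empty_or_nonempty
  · rw [numPlaces, Finset.card_empty, zero_add, Nat.card_eq_fintype_card,
      Fintype.one_lt_card_iff] at h
    obtain ⟨w, w', hw⟩ := h
    -- This unit has absolute value below one at every place other than `w`, in particular at `w'`,
    -- so it is not a root of unity.
    obtain ⟨x, hx⟩ := Units.dirichletUnitTheorem.exists_unit K w
    refine ⟨algebraMap (𝓞 K) (OS K _) x, x.isUnit.map _, fun n hn h1 ↦ ?_⟩
    have h2 : (algebraMap (𝓞 K) K x) ^ n = 1 := congrArg (algebraMap (OS K ∅) K) h1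
    have h3 := congrArg w' h2
    rw [map_pow, map_one] at h3
    have h4 := hx w' hw.symm
    rw [(pow_eq_one_iff_of_nonneg (apply_nonneg _ _) hn.ne').mp h3, Real.log_one] at h4
    exact lt_irrefl _ h4
  -- An integer supported at `v` alone is an `S`-unit; if a power of it were one, `v` would contain
  -- one.
  · obtain ⟨a, ha0, ha⟩ := exists_mem_iff_eq v
    refine ⟨algebraMap (𝓞 K) (OS K S) a, isUnit_OS_of_forall_notMem S a ha0 fun w hw ↦ ?_,
      fun n hn h1 ↦ ?_⟩
    · rwa [(ha w).mp hw]
    · have h2 : a ^ n = 1 := by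
        refine IsFractionRing.injective (𝓞 K) K ?_
        rw [map_pow, map_one]
        exact congrArg (algebraMap (OS K S) K) h1
      refine v.isPrime.ne_top ((Ideal.eq_top_iff_one _).mpr ?_)
      rw [← h2]
      exact Ideal.pow_mem_of_mem _ ((ha v).mpr rfl) n hn

variable {K}

lemma exists_conj {L : Type*} [Field L] [Algebra K L] (hL : Module.finrank K L = 2) :
    ∃ τ : L ≃ₐ[K] L, τ ≠ 1 ∧ (∀ σ : L ≃ₐ[K] L, σ = 1 ∨ σ = τ) ∧ (∀ x, τ (τ x) = x) ∧
      ∀ x, τ x = x → x ∈ Set.range (algebraMap K L) := by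
  have : FiniteDimensional K L := Module.finite_of_finrank_eq_succ hL
  have : Algebra.IsQuadraticExtension K L := ⟨hL⟩
  have hc : Nat.card (L ≃ₐ[K] L) = 2 := (IsGalois.card_aut_eq_finrank K L).trans hL
  obtain ⟨τ, hτ, hu⟩ := (Nat.card_eq_two_iff' (1 : L ≃ₐ[K] L)).mp hc
  have hall (σ : L ≃ₐ[K] L) : σ = 1 ∨ σ = τ := or_iff_not_imp_left.mpr fun h ↦ hu σ h
  refine ⟨τ, hτ, hall, fun x ↦ ?_, fun x hx ↦ ?_⟩
  · have : τ * τ = 1 := by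
      refine (hall (τ * τ)).resolve_right fun h ↦ hτ ?_
      simpa using h
    exact congr($this x)
  · refine (IsGalois.mem_range_algebraMap_iff_fixed x).mpr fun σ ↦ ?_
    obtain rfl | rfl := hall σ
    · rfl
    · exact hx

/-- Take `a` supported at a single prime `P` above `v` and `ε = a / τ a`. As `v` has two primes
above it, `τ` moves `P`, so `τ a` is prime to `P`, while `a` is not; hence no power of `ε` is one.
The norm of `a` is supported at `v`, hence an `S`-unit, and this makes `ε` integral. -/
lemma exists_norm_one_of_finite {L : Type u} [Field L] [NumberField L] [Algebra K L]
    (τ : L ≃ₐ[K] L) (hττ : ∀ x, τ (τ x) = x) (hτ : ∀ x, τ x = x → x ∈ Set.range (algebraMap K L))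
    {v : HeightOneSpectrum (𝓞 K)} (hv : v ∈ S) (h : 1 < (v.asIdeal.primesOver (𝓞 L)).ncard) :
    ∃ ε : L, ε ≠ 0 ∧ IsIntegral (OS K S) ε ∧ τ ε = ε⁻¹ ∧ ∀ n > 0, ε ^ n ≠ 1 := by
  obtain ⟨P, hP, Q, hQ, hPQ⟩ := (Set.one_lt_ncard (Set.finite_of_ncard_pos (by lia))).mp h
  let t : 𝓞 L ≃+* 𝓞 L := RingOfIntegers.mapRingEquiv τ
  have ht (x : 𝓞 L) : algebraMap (𝓞 L) L (t x) = τ (algebraMap (𝓞 L) L x) := rfl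
  have htt (x : 𝓞 L) : t (t x) = x :=
    IsFractionRing.injective (𝓞 L) L (by rw [ht, ht, hττ])
  have htK (x : 𝓞 K) : t (algebraMap (𝓞 K) (𝓞 L) x) = algebraMap (𝓞 K) (𝓞 L) x := by
    refine IsFractionRing.injective (𝓞 L) L ?_
    rw [ht]
    exact τ.commutes (x : K)
  have hnorm (x : 𝓞 L) : ∃ y : 𝓞 K, algebraMap (𝓞 K) (𝓞 L) y = x * t x := by
    obtain ⟨y, hy⟩ := hτ (algebraMap (𝓞 L) L (x * t x)) (by
      rw [← ht, map_mul, htt, mul_comm])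
    have hyi : IsIntegral ℤ (algebraMap K L y) := by
      rw [hy]
      exact RingOfIntegers.isIntegral_coe _
    refine ⟨⟨y, (isIntegral_algebraMap_iff (algebraMap K L).injective).mp hyi⟩,
      IsFractionRing.injective (𝓞 L) L ?_⟩
    exact hy
  have hP0 : P ≠ ⊥ := Ideal.ne_bot_of_mem_primesOver v.ne_bot hP
  have hQ0 : Q ≠ ⊥ := Ideal.ne_bot_of_mem_primesOver v.ne_bot hQ
  let P' : HeightOneSpectrum (𝓞 L) := ⟨P, hP.1, hP0⟩
  obtain ⟨a, ha0, ha⟩ := exists_mem_iff_eq P'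
  have haP (I : Ideal (𝓞 L)) (hI : I.IsPrime) (haI : a ∈ I) : I = P :=
    congrArg HeightOneSpectrum.asIdeal
      ((ha ⟨I, hI, fun h0 ↦ ha0 (by simpa [h0] using haI)⟩).mp haI)
  -- Otherwise `t` preserves `P`. For `x` in `Q` but not in `P`, the norm `x * t x` lies in `v`,
  -- hence in `P`; so `t x`, and therefore `x`, would lie in `P`.
  have hatP : t a ∉ P := by
    intro htP
    have h1 : P.comap t = P := haP _ (hP.1.comap t) htP
    obtain ⟨x, hxQ, hxP⟩ : ∃ x ∈ Q, x ∉ P := by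
      by_contra! hle
      have := hP.1
      exact hPQ ((hQ.1.isMaximal hQ0).eq_of_le hP.1.ne_top hle).symm
    obtain ⟨y, hy⟩ := hnorm x
    have hyv : y ∈ v.asIdeal := by
      rw [hQ.2.over]
      change algebraMap (𝓞 K) (𝓞 L) y ∈ Q
      rw [hy]
      exact Ideal.mul_mem_right _ _ hxQ
    rw [hP.2.over] at hyv
    have hyP : algebraMap (𝓞 K) (𝓞 L) y ∈ P := hyv
    rw [hy] at hyP
    refine hxP ((hP.1.mem_or_mem hyP).resolve_right fun h2 ↦ hxP ?_)
    rw [← h1]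
    exact h2
  obtain ⟨N, hN⟩ := hnorm a
  have hta0 : t a ≠ 0 := (map_ne_zero_iff _ t.injective).mpr ha0
  have hN0 : N ≠ 0 := by
    rintro rfl
    rw [map_zero] at hN
    exact mul_ne_zero ha0 hta0 hN.symm
  have hNS (w : HeightOneSpectrum (𝓞 K)) (hw : N ∈ w.asIdeal) : w ∈ S := by
    have := w.isPrime
    obtain ⟨I, hI, hIw⟩ := Ideal.exists_ideal_over_prime_of_isIntegral_of_isDomain (S := 𝓞 L)
      w.asIdeal (by simp [(RingHom.injective_iff_ker_eq_bot _).mp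
        (FaithfulSMul.algebraMap_injective (𝓞 K) (𝓞 L))])
    suffices w.asIdeal = v.asIdeal by rwa [HeightOneSpectrum.ext this]
    have hNI : algebraMap (𝓞 K) (𝓞 L) N ∈ I := by
      rw [← hIw] at hw
      exact hw
    rw [hN] at hNI
    obtain h1 | h1 := hI.mem_or_mem hNI
    · rw [← hIw, haP I hI h1, hP.2.over]
    · rw [← hIw, hP.2.over, ← haP _ (hI.comap t) h1]
      ext x
      change algebraMap (𝓞 K) (𝓞 L) x ∈ I ↔ t (algebraMap (𝓞 K) (𝓞 L) x) ∈ I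
      rw [htK]
  obtain ⟨M, hM⟩ := (isUnit_OS_of_forall_notMem S N hN0 hNS).exists_right_inv
  have hM' : algebraMap K L N * algebraMap K L M = 1 := by
    rw [← map_mul, ← map_one (algebraMap K L)]
    exact congrArg (algebraMap K L) (congrArg (algebraMap (OS K S) K) hM)
  have hN' : algebraMap K L N = algebraMap (𝓞 L) L a * τ (algebraMap (𝓞 L) L a) := by
    rw [← ht, ← map_mul, ← hN]
    rfl
  have ha0' : algebraMap (𝓞 L) L a ≠ 0 :=
    (map_ne_zero_iff _ (IsFractionRing.injective (𝓞 L) L)).mpr ha0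
  have hta0' : τ (algebraMap (𝓞 L) L a) ≠ 0 := (map_ne_zero_iff _ τ.injective).mpr ha0'
  refine ⟨algebraMap (𝓞 L) L a / τ (algebraMap (𝓞 L) L a), div_ne_zero ha0' hta0', ?_, ?_,
    fun n hn h1 ↦ hatP ?_⟩
  -- That is, `ε = a ^ 2 / N` with `N = a * τ a` the norm, invertible in the `S`-integers with
  -- inverse `M`.
  · have : algebraMap (𝓞 L) L a / τ (algebraMap (𝓞 L) L a) =
        algebraMap (𝓞 L) L a ^ 2 * algebraMap (OS K S) L M := by
      rw [div_eq_iff hta0']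
      have : algebraMap (OS K S) L M = algebraMap K L M := rfl
      rw [this]
      rw [hN'] at hM'
      linear_combination (-algebraMap (𝓞 L) L a) * hM'
    rw [this]
    refine IsIntegral.mul (IsIntegral.pow ?_ 2) isIntegral_algebraMap
    exact (RingOfIntegers.isIntegral_coe a).tower_top
  · rw [map_div₀, hττ, inv_div]
  · rw [div_pow, div_eq_one_iff_eq (pow_ne_zero _ hta0'), ← ht, ← map_pow, ← map_pow] at h1
    have h2 := IsFractionRing.injective (𝓞 L) L h1
    refine hP.1.mem_of_pow_mem n ?_
    rw [← h2]
    exact Ideal.pow_mem_of_mem _ ((ha P').mpr rfl) n hn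

/-- The conjugation `τ` exchanges the two places `w` and `w'` above `v`. Take a unit `x` that is
small at every place but `w`, and `ε = x / τ x`. If `ε ^ n = 1`, then `x` has the same absolute
value at `w` and `w'`; but it is below one at `w'` and, by the product formula, at least one at `w`.
-/
lemma exists_norm_one_of_infinite {L : Type u} [Field L] [NumberField L] [Algebra K L]
    [IsGalois K L] (τ : L ≃ₐ[K] L) (hττ : ∀ x, τ (τ x) = x) (hτ : ∀ σ : L ≃ₐ[K] L, σ = 1 ∨ σ = τ)
    {v : InfinitePlace K} (h : 1 < {w : InfinitePlace L | w.comap (algebraMap K L) = v}.ncard) :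
    ∃ ε : L, ε ≠ 0 ∧ IsIntegral (OS K S) ε ∧ τ ε = ε⁻¹ ∧ ∀ n > 0, ε ^ n ≠ 1 := by
  obtain ⟨w, hw, w', hw', hww⟩ := (Set.one_lt_ncard (Set.toFinite _)).mp h
  obtain ⟨σ, hσ⟩ := InfinitePlace.exists_smul_eq_of_comap_eq (hw.trans hw'.symm)
  obtain rfl : σ = τ := (hτ σ).resolve_left fun h1 ↦ hww (by rw [← hσ, h1, one_smul])
  have hσw (x : L) : w' (σ x) = w x := by
    rw [← hσ, InfinitePlace.smul_apply, AlgEquiv.symm_apply_apply]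
  obtain ⟨x, hx⟩ := Units.dirichletUnitTheorem.exists_unit L w
  have hlog : 0 ≤ Real.log (w x) := by
    by_contra! hlt
    have hs := Units.sum_mult_mul_log x
    have : ∑ y : InfinitePlace L, y.mult * Real.log (y x) < 0 := by
      refine Finset.sum_neg (fun y _ ↦ ?_) ⟨w, Finset.mem_univ _⟩
      refine mul_neg_of_pos_of_neg (by exact_mod_cast InfinitePlace.mult_pos) ?_
      by_cases hy : y = w
      · rwa [hy]
      · exact hx y hy
    exact this.ne hs
  have hx0 : (x : L) ≠ 0 := by simp
  have hsx0 : σ (x : L) ≠ 0 := (map_ne_zero_iff _ σ.injective).mpr hx0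
  refine ⟨x / σ x, div_ne_zero hx0 hsx0, ?_, ?_, fun n hn h1 ↦ ?_⟩
  · rw [div_eq_mul_inv, ← map_inv₀]
    have h1 : IsIntegral ℤ (x : L) := RingOfIntegers.isIntegral_coe _
    have h2 : IsIntegral ℤ (σ (x : L)⁻¹) := by
      refine IsIntegral.map (σ : L →ₐ[K] L) ?_
      have : (x : L)⁻¹ = ((x⁻¹ : (𝓞 L)ˣ) : 𝓞 L) := by simp
      rw [this]
      exact RingOfIntegers.isIntegral_coe _
    exact (h1.mul h2).tower_top
  · rw [map_div₀, hττ, inv_div]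
  · rw [div_pow, div_eq_one_iff_eq (pow_ne_zero _ hsx0)] at h1
    have h2 := congrArg w' h1
    rw [map_pow, map_pow, hσw,
      pow_left_inj₀ (apply_nonneg _ _) (apply_nonneg _ _) hn.ne'] at h2
    have h3 := hx w' hww.symm
    rw [h2] at h3
    exact h3.not_ge hlog

/-- There is an element of norm one and infinite order, integral over the `S`-integers, if a place
of `S` splits. -/
lemma exists_norm_one {L : Type u} [Field L] [NumberField L] [Algebra K L]
    (hL : Module.finrank K L = 2) (h : ExistsSplitPlace K S L) :
    ∃ (τ : L ≃ₐ[K] L) (ε : L), τ ≠ 1 ∧ (∀ σ : L ≃ₐ[K] L, σ = 1 ∨ σ = τ) ∧ ε ≠ 0 ∧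
      IsIntegral (OS K S) ε ∧ τ ε = ε⁻¹ ∧ ∀ n > 0, ε ^ n ≠ 1 := by
  obtain ⟨τ, hτ1, hτ, hττ, hτK⟩ := exists_conj hL
  have : Algebra.IsQuadraticExtension K L := ⟨hL⟩
  rw [ExistsSplitPlace, hL] at h
  obtain ⟨v, hv, h⟩ | ⟨v, h⟩ := h
  · obtain ⟨ε, hε⟩ := exists_norm_one_of_finite S τ hττ hτK hv (by lia)
    exact ⟨τ, ε, hτ1, hτ, hε⟩
  · have : FiniteDimensional K L := Module.finite_of_finrank_eq_succ hL
    obtain ⟨ε, hε⟩ := exists_norm_one_of_infinite S τ hττ hτ (v := v) (by lia)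
    exact ⟨τ, ε, hτ1, hτ, hε⟩

end OS

end ConicPoints

end

/-! ### The projective line minus two rational points: coordinate ring -/

noncomputable section

namespace ConicPoints

section ProjectiveLine

attribute [local instance] MvPolynomial.gradedAlgebra

open HomogeneousLocalization

lemma map_eq_pow_mul {σ k B : Type*} [Finite σ] [CommRing k] [CommRing B]
    (χ : MvPolynomial σ k →+* B) (w : B) (g : σ → B) (hg : ∀ i, χ (.X i) = w * g i) {d : ℕ}
    {F : MvPolynomial σ k} (hF : F.IsHomogeneous d) :
    χ F = w ^ d * F.eval₂ (χ.comp MvPolynomial.C) g := by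
  have := Fintype.ofFinite σ
  have h : χ F = F.eval₂ (χ.comp MvPolynomial.C) fun i ↦ χ (.X i) := by
    conv_lhs => rw [← MvPolynomial.eval₂_eta F]
    rw [← MvPolynomial.coe_eval₂Hom, ← RingHom.comp_apply, MvPolynomial.comp_eval₂Hom]
    rfl
  rw [h, MvPolynomial.eval₂_eq', MvPolynomial.eval₂_eq', Finset.mul_sum]
  refine Finset.sum_congr rfl fun m hm ↦ ?_
  have hd : ∑ i, m i = d := by
    rw [← hF (MvPolynomial.mem_support_iff.mp hm), Finsupp.weight_apply, Finsupp.sum_fintype]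
    · simp
    · simp
  simp only [hg, mul_pow, Finset.prod_mul_distrib, Finset.prod_pow_eq_pow_sum, hd]
  ring

lemma val_mk_mul_pow {A : Type*} [CommRing A] {σ : Type*} [SetLike σ A] [AddSubgroupClass σ A]
    {𝒜 : ℕ → σ} [GradedRing 𝒜] {f : A} {d : ℕ} (n : ℕ) (hf : f ∈ 𝒜 d) (x : A)
    (hx : x ∈ 𝒜 (n • d)) : (Away.mk 𝒜 hf n x hx).val * (algebraMap A (Localization.Away f) f) ^ n =
      algebraMap A (Localization.Away f) x := by
  rw [Away.val_mk, Localization.mk_eq_mk', ← map_pow]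
  exact IsLocalization.mk'_spec _ _ _

variable (k : Type u) [Field k]

/-- The coordinate ring of the projective line. -/
abbrev lineGrading : ℕ → Submodule k (MvPolynomial (Fin 2) k) :=
  MvPolynomial.homogeneousSubmodule (Fin 2) k

variable {k}

/-- A linear form in two variables. -/
def lin (a b : k) : MvPolynomial (Fin 2) k := .C a * .X 0 + .C b * .X 1

lemma lin_mem (a b : k) : lin a b ∈ lineGrading k 1 := by
  refine Submodule.add_mem _ ?_ ?_ <;>
  · rw [← zero_add 1]
    exact (MvPolynomial.isHomogeneous_C _ _).mul (MvPolynomial.isHomogeneous_X _ _)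

lemma lin_mul_mem (a b c d : k) : lin a b * lin c d ∈ lineGrading k 2 :=
  SetLike.mul_mem_graded (lin_mem a b) (lin_mem c d)

/-- A form without constant term lies in the ideal generated by the variables, so a point containing
both would contain the irrelevant ideal. -/
lemma not_X_mem (p : Proj (lineGrading k)) : ¬ ∀ i, .X i ∈ p.asHomogeneousIdeal := by
  intro h
  refine p.not_irrelevant_le fun F hF ↦ ?_
  rw [HomogeneousIdeal.mem_irrelevant_iff] at hF
  have hF' : F ∈ Ideal.span (Set.range (MvPolynomial.X : Fin 2 → MvPolynomial (Fin 2) k)) := by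
    have : MvPolynomial.constantCoeff F = 0 := by
      rw [MvPolynomial.constantCoeff_eq]
      have h2 : MvPolynomial.homogeneousComponent 0 F = 0 := by
        rw [← hF, GradedRing.proj_apply]
        exact (MvPolynomial.decomposition.decompose'_apply F 0).symm
      rw [MvPolynomial.homogeneousComponent_zero] at h2
      simpa using h2
    rw [← Set.image_univ, MvPolynomial.mem_ideal_span_X_image]
    intro m hm
    by_contra! h0
    obtain rfl : m = 0 := Finsupp.ext fun i ↦ h0 i (Set.mem_univ i)
    exact MvPolynomial.mem_support_iff.mp hm this
  refine (Ideal.span_le (I := p.asHomogeneousIdeal.toIdeal)).mpr ?_ hF'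
  rintro _ ⟨i, rfl⟩
  exact h i

section Coordinates

variable {a₀ b₀ a₁ b₁ : k} (hdet : a₀ * b₁ - b₀ * a₁ = 1)

include hdet

lemma X_eq_lin (i : Fin 2) : (.X i : MvPolynomial (Fin 2) k) =
    .C (![b₁, -a₁] i) * lin a₀ b₀ + .C (![-b₀, a₀] i) * lin a₁ b₁ := by
  have h : (MvPolynomial.C (a₀ * b₁ - b₀ * a₁) : MvPolynomial (Fin 2) k) = 1 := by
    rw [hdet, map_one]
  simp only [map_sub, map_mul] at h
  fin_cases i
  · simp [lin]
    linear_combination (-MvPolynomial.X 0) * h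
  · simp [lin]
    linear_combination (-MvPolynomial.X 1) * h

lemma lin_notMem {p : Proj (lineGrading k)} (hp : lin a₀ b₀ ∈ p.asHomogeneousIdeal) :
    lin a₁ b₁ ∉ p.asHomogeneousIdeal := by
  refine fun h ↦ not_X_mem p fun i ↦ ?_
  rw [X_eq_lin hdet i]
  exact Ideal.add_mem _ (Ideal.mul_mem_left _ _ hp) (Ideal.mul_mem_left _ _ h)

/-- Modulo `p` the coordinates are the zero `(-b₀, a₀)` of the first form, scaled by the second
form, which is nonzero there. A form of degree `d` therefore reduces to its value at that zero times
a nonzero `d`-th power. So a linear form in `p` determines `p`. -/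
lemma mem_iff_eval_eq_zero {p : Proj (lineGrading k)} (hp : lin a₀ b₀ ∈ p.asHomogeneousIdeal)
    {d : ℕ} {F : MvPolynomial (Fin 2) k} (hF : F.IsHomogeneous d) :
    F ∈ p.asHomogeneousIdeal ↔ F.eval ![-b₀, a₀] = 0 := by
  let I := p.asHomogeneousIdeal.toIdeal
  have : I.IsPrime := p.isPrime
  let χ := Ideal.Quotient.mk I
  have hχ : χ (lin a₀ b₀) = 0 := Ideal.Quotient.eq_zero_iff_mem.mpr hp
  have hχ' : χ (lin a₁ b₁) ≠ 0 := fun h ↦ lin_notMem hdet hp (Ideal.Quotient.eq_zero_iff_mem.mp h)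
  have h := map_eq_pow_mul χ (χ (lin a₁ b₁)) (fun i ↦ χ (.C (![-b₀, a₀] i))) (fun i ↦ by
    conv_lhs => rw [X_eq_lin hdet i, map_add, map_mul, hχ, mul_zero, zero_add, map_mul, mul_comm])
    hF
  have h' : F.eval₂ (χ.comp MvPolynomial.C) (fun i ↦ χ (.C (![-b₀, a₀] i))) =
      (χ.comp MvPolynomial.C) (F.eval ![-b₀, a₀]) := by
    rw [MvPolynomial.eval, ← MvPolynomial.coe_eval₂Hom, ← RingHom.comp_apply (χ.comp MvPolynomial.C),
      MvPolynomial.comp_eval₂Hom]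
    rfl
  rw [h'] at h
  have hFI : F ∈ p.asHomogeneousIdeal ↔ χ F = 0 := Ideal.Quotient.eq_zero_iff_mem.symm
  rw [hFI, h, mul_eq_zero, or_iff_right (pow_ne_zero _ hχ'), map_eq_zero]

lemma point_ext {p q : Proj (lineGrading k)} (hp : lin a₀ b₀ ∈ p.asHomogeneousIdeal)
    (hq : lin a₀ b₀ ∈ q.asHomogeneousIdeal) : p = q := by
  refine ProjectiveSpectrum.ext (HomogeneousIdeal.ext' fun d F hF ↦ ?_)
  exact (mem_iff_eval_eq_zero hdet hp hF).trans (mem_iff_eval_eq_zero hdet hq hF).symm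

end Coordinates

/-- The scalars in a chart of the projective line. -/
abbrev lineConst (f : MvPolynomial (Fin 2) k) : k →+* Away (lineGrading k) f :=
  (fromZeroRingHom _ _).comp (algebraMap k (lineGrading k 0))

lemma val_lineConst (f : MvPolynomial (Fin 2) k) (c : k) :
    (lineConst f c).val = algebraMap (MvPolynomial (Fin 2) k) (Localization.Away f) (.C c) :=
  Localization.mk_one_eq_algebraMap _

section Chart

variable (a₀ b₀ a₁ b₁ : k)

/-- The quotient of two linear forms, on the locus where both are invertible. -/
def linQuot : Away (lineGrading k) (lin a₀ b₀ * lin a₁ b₁) :=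
  Away.mk _ (lin_mul_mem a₀ b₀ a₁ b₁) 1 (lin a₀ b₀ * lin a₀ b₀) (lin_mul_mem a₀ b₀ a₀ b₀)

/-- The inverse of the quotient of two linear forms. -/
def linQuotInv : Away (lineGrading k) (lin a₀ b₀ * lin a₁ b₁) :=
  Away.mk _ (lin_mul_mem a₀ b₀ a₁ b₁) 1 (lin a₁ b₁ * lin a₁ b₁) (lin_mul_mem a₁ b₁ a₁ b₁)

lemma isUnit_lin_left : IsUnit (algebraMap _
    (Localization.Away (lin a₀ b₀ * lin a₁ b₁)) (lin a₀ b₀)) :=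
  isUnit_of_dvd_unit (map_dvd _ (Dvd.intro _ rfl)) (IsLocalization.Away.algebraMap_isUnit (lin a₀ b₀ * lin a₁ b₁))

lemma isUnit_lin_right : IsUnit (algebraMap _
    (Localization.Away (lin a₀ b₀ * lin a₁ b₁)) (lin a₁ b₁)) :=
  isUnit_of_dvd_unit (map_dvd _ (Dvd.intro_left _ rfl)) (IsLocalization.Away.algebraMap_isUnit (lin a₀ b₀ * lin a₁ b₁))

lemma linQuot_val_mul : (linQuot a₀ b₀ a₁ b₁).val * algebraMap _ _ (lin a₁ b₁) =
    algebraMap _ _ (lin a₀ b₀) := by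
  have h := val_mk_mul_pow 1 (lin_mul_mem a₀ b₀ a₁ b₁) (lin a₀ b₀ * lin a₀ b₀)
    (lin_mul_mem a₀ b₀ a₀ b₀)
  rw [pow_one, map_mul, map_mul] at h
  refine (isUnit_lin_left a₀ b₀ a₁ b₁).mul_left_cancel (Eq.trans ?_ h)
  rw [linQuot]
  ring

lemma linQuotInv_val_mul : (linQuotInv a₀ b₀ a₁ b₁).val * algebraMap _ _ (lin a₀ b₀) =
    algebraMap _ _ (lin a₁ b₁) := by
  have h := val_mk_mul_pow 1 (lin_mul_mem a₀ b₀ a₁ b₁) (lin a₁ b₁ * lin a₁ b₁)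
    (lin_mul_mem a₁ b₁ a₁ b₁)
  rw [pow_one, map_mul, map_mul] at h
  refine (isUnit_lin_right a₀ b₀ a₁ b₁).mul_left_cancel (Eq.trans ?_ h)
  rw [linQuotInv]
  ring

lemma linQuot_mul_inv : linQuot a₀ b₀ a₁ b₁ * linQuotInv a₀ b₀ a₁ b₁ = 1 := by
  refine val_injective _ ?_
  rw [val_mul, val_one]
  refine (isUnit_lin_left a₀ b₀ a₁ b₁).mul_right_cancel ?_
  rw [mul_assoc, linQuotInv_val_mul, linQuot_val_mul, one_mul]

/-- The quotient of two linear forms, as a unit. -/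
def linUnit : (Away (lineGrading k) (lin a₀ b₀ * lin a₁ b₁))ˣ where
  val := linQuot a₀ b₀ a₁ b₁
  inv := linQuotInv a₀ b₀ a₁ b₁
  val_inv := linQuot_mul_inv a₀ b₀ a₁ b₁
  inv_val := (mul_comm _ _).trans (linQuot_mul_inv a₀ b₀ a₁ b₁)

/-- The comparison map from Laurent polynomials to a chart of the projective line. -/
def chartHom : k[T;T⁻¹] →+* Away (lineGrading k) (lin a₀ b₀ * lin a₁ b₁) :=
  LaurentPolynomial.eval₂ (lineConst _) (linUnit a₀ b₀ a₁ b₁)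

lemma chartHom_C (c : k) : chartHom a₀ b₀ a₁ b₁ (LaurentPolynomial.C c) = lineConst _ c :=
  LaurentPolynomial.eval₂_C _ _ _

lemma chartHom_T : chartHom a₀ b₀ a₁ b₁ (LaurentPolynomial.T 1) = linQuot a₀ b₀ a₁ b₁ := by
  have := LaurentPolynomial.eval₂_T_n (lineConst _) (linUnit a₀ b₀ a₁ b₁) 1
  rw [pow_one] at this
  exact this

lemma chartHom_T_neg : chartHom a₀ b₀ a₁ b₁ (LaurentPolynomial.T (-1)) =
    linQuotInv a₀ b₀ a₁ b₁ := by
  have := LaurentPolynomial.eval₂_T_neg_n (lineConst _) (linUnit a₀ b₀ a₁ b₁) 1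
  rw [pow_one] at this
  exact this

variable {a₀ b₀ a₁ b₁} (hdet : a₀ * b₁ - b₀ * a₁ = 1)

include hdet

-- There is a retraction: substitute for the coordinates the pair at which the two linear forms take
-- the values `T` and `1`.
open LaurentPolynomial in
lemma chartHom_injective : Function.Injective (chartHom a₀ b₀ a₁ b₁) := by
  have hC : (C a₀ * C b₁ - C b₀ * C a₁ : k[T;T⁻¹]) = 1 := by
    rw [← map_mul, ← map_mul, ← map_sub, hdet, map_one]
  let h : MvPolynomial (Fin 2) k →+* k[T;T⁻¹] :=
    MvPolynomial.eval₂Hom C ![C b₁ * T 1 - C b₀, C a₀ - C a₁ * T 1]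
  have h₀ : h (lin a₀ b₀) = T 1 := by
    simp [h, lin]
    linear_combination (T 1 : k[T;T⁻¹]) * hC
  have h₁ : h (lin a₁ b₁) = 1 := by
    simp [h, lin]
    linear_combination hC
  let Ψ : Localization.Away (lin a₀ b₀ * lin a₁ b₁) →+* k[T;T⁻¹] :=
    IsLocalization.Away.lift (lin a₀ b₀ * lin a₁ b₁) (g := h) (by
      rw [map_mul, h₀, h₁, mul_one]
      exact isUnit_T 1)
  have hΨ (F) : Ψ (algebraMap _ _ F) = h F := IsLocalization.Away.lift_eq _ _ _
  have : (Ψ.comp (algebraMap _ _)).comp (chartHom a₀ b₀ a₁ b₁) = RingHom.id _ := by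
    refine IsLocalization.ringHom_ext (Submonoid.powers (Polynomial.X : Polynomial k)) ?_
    refine Polynomial.ringHom_ext (fun c ↦ ?_) ?_
    · change Ψ (chartHom a₀ b₀ a₁ b₁ (Polynomial.toLaurent (Polynomial.C c))).val =
        Polynomial.toLaurent (Polynomial.C c)
      rw [Polynomial.toLaurent_C, chartHom_C, val_lineConst, hΨ]
      simp [h]
    · change Ψ (chartHom a₀ b₀ a₁ b₁ (Polynomial.toLaurent Polynomial.X)).val =
        Polynomial.toLaurent Polynomial.X
      rw [Polynomial.toLaurent_X, chartHom_T]
      have := congr(Ψ $(linQuot_val_mul a₀ b₀ a₁ b₁))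
      rwa [map_mul, hΨ, hΨ, h₀, h₁, mul_one] at this
  exact Function.LeftInverse.injective (g := Ψ.comp (algebraMap _ _)) fun x ↦ congr($this x)

-- Write `l₀`, `l₁` for the two forms. A form `F` of degree `2 n` is `l₁ ^ (2 n)` times a polynomial
-- `q` in `l₀ / l₁`, so that `F / (l₀ l₁) ^ n` is the image of `q * T ^ (-n)`.
open LaurentPolynomial in
lemma chartHom_surjective : Function.Surjective (chartHom a₀ b₀ a₁ b₁) := by
  intro x
  obtain ⟨n, F, hF, rfl⟩ := Away.mk_surjective _ (lin_mul_mem a₀ b₀ a₁ b₁) x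
  let q : k[T;T⁻¹] := F.eval₂ C fun i ↦ C (![b₁, -a₁] i) * T 1 + C (![-b₀, a₀] i)
  refine ⟨q * T (-1) ^ n, val_injective _ ?_⟩
  let χ := algebraMap (MvPolynomial (Fin 2) k) (Localization.Away (lin a₀ b₀ * lin a₁ b₁))
  let V : k[T;T⁻¹] →+* Localization.Away (lin a₀ b₀ * lin a₁ b₁) :=
    (algebraMap _ _).comp (chartHom a₀ b₀ a₁ b₁)
  have hVC (c : k) : V (C c) = χ (.C c) := by
    change (chartHom a₀ b₀ a₁ b₁ (C c)).val = _
    rw [chartHom_C, val_lineConst]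
  have hVT : V (T 1) * χ (lin a₁ b₁) = χ (lin a₀ b₀) := by
    change (chartHom a₀ b₀ a₁ b₁ (T 1)).val * _ = _
    rw [chartHom_T]
    exact linQuot_val_mul ..
  have hVT' : V (T (-1)) * χ (lin a₀ b₀) = χ (lin a₁ b₁) := by
    change (chartHom a₀ b₀ a₁ b₁ (T (-1))).val * _ = _
    rw [chartHom_T_neg]
    exact linQuotInv_val_mul ..
  have hq : χ F = χ (lin a₁ b₁) ^ (n • 2) * V q := by
    rw [map_eq_pow_mul χ (χ (lin a₁ b₁))
      (fun i ↦ V (C (![b₁, -a₁] i) * T 1 + C (![-b₀, a₀] i))) (fun i ↦ ?_) hF]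
    · congr 1
      change _ = V (F.eval₂ C _)
      rw [← MvPolynomial.coe_eval₂Hom, ← MvPolynomial.coe_eval₂Hom, ← RingHom.comp_apply V,
        MvPolynomial.comp_eval₂Hom]
      congr 2
      ext c
      exact (hVC c).symm
    · rw [map_add, map_mul, hVC, hVC]
      conv_lhs => rw [X_eq_lin hdet i]
      rw [map_add, map_mul, map_mul, ← hVT]
      ring
  have hval := val_mk_mul_pow n (lin_mul_mem a₀ b₀ a₁ b₁) F hF
  refine ((isUnit_lin_left a₀ b₀ a₁ b₁).mul (isUnit_lin_right a₀ b₀ a₁ b₁)).pow n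
    |>.mul_right_cancel ?_
  rw [← map_mul, hval]
  change V (q * T (-1) ^ n) * χ (lin a₀ b₀ * lin a₁ b₁) ^ n = χ F
  rw [hq, map_mul, map_mul, map_pow, smul_eq_mul, mul_comm n 2, pow_mul, pow_two, mul_pow, mul_pow,
    ← hVT', mul_pow]
  ring

end Chart

end ProjectiveLine

end ConicPoints

end

/-! ### Zeros of the coordinate at the two removed points -/

noncomputable section

namespace ConicPoints

lemma globalMap_comp_map {A B : Type u} [CommRing A] [CommRing B] {Z : Scheme.{u}}
    (b : Z ⟶ Spec (.of B)) (θ : A →+* B) (r : A) :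
    globalMap (b ≫ Spec.map (CommRingCat.ofHom θ)) r = globalMap b (θ r) := by
  have h := congr($(Scheme.ΓSpecIso_inv_naturality (CommRingCat.ofHom θ)) r)
  simp only [globalMap, Scheme.Hom.comp_appTop]
  exact congr(b.appTop $h).symm

/-- The function `t` on the open subscheme given by `e` extends to a neighbourhood of `p` and
vanishes there. -/
def VanishesAt {B : Type u} [CommRing B] {X : Scheme.{u}} (e : Spec (.of B) ⟶ X) (t : B) (p : X) :
    Prop :=
  ∃ (N : Scheme.{u}) (i : N ⟶ X) (_ : IsOpenImmersion i) (n : N) (s : Γ(N, ⊤)), i n = p ∧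
    n ∉ N.basicOpen s ∧ ∀ (Z : Scheme.{u}) (a : Z ⟶ N) (b : Z ⟶ Spec (.of B)), a ≫ i = b ≫ e →
      a.appTop s = globalMap b t

/-- This transports zeros along semilinear automorphisms of the line, for which `i` need not be a
morphism over the base field. -/
lemma VanishesAt.comp_iso {B B' : Type u} [CommRing B] [CommRing B'] {X X' : Scheme.{u}}
    {e : Spec (.of B) ⟶ X} {e' : Spec (.of B') ⟶ X'} {t : B} {p : X} (h : VanishesAt e t p)
    (i : X ≅ X') (α : B →+* B') (hα : Spec.map (CommRingCat.ofHom α) ≫ e ≫ i.hom = e') :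
    VanishesAt e' (α t) (i.hom p) := by
  obtain ⟨N, j, _, n, s, rfl, hs, H⟩ := h
  refine ⟨N, j ≫ i.hom, inferInstance, n, s, rfl, hs, fun Z a b hab ↦ ?_⟩
  rw [← globalMap_comp_map]
  refine H _ _ _ ?_
  rw [← cancel_mono i.hom, Category.assoc, hab, ← hα, Category.assoc, Category.assoc]

/-- A function and its inverse do not both vanish at a point. -/
lemma VanishesAt.not_of_mul_eq_one {B : Type u} [CommRing B] {X : Scheme.{u}} [PreirreducibleSpace X]
    {e : Spec (.of B) ⟶ X} [IsOpenImmersion e] [Nontrivial B] {t t' : B} {p : X}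
    (h : VanishesAt e t p) (htt : t * t' = 1) : ¬ VanishesAt e t' p := by
  rintro ⟨N', j', _, n', s', hn', hs', H'⟩
  obtain ⟨N, j, _, n, s, hn, hs, H⟩ := h
  let W := Limits.pullback j j'
  let f := Limits.pullback.fst j j'
  let f' := Limits.pullback.snd j j'
  have hff : f ≫ j = f' ≫ j' := Limits.pullback.condition
  obtain ⟨w, hw, hw'⟩ : ∃ w : W, f w = n ∧ f' w = n' :=
    Scheme.Pullback.exists_preimage_pullback n n' (hn.trans hn'.symm)
  -- Common neighbourhoods of `p` meet the dense image of `e`, where `s * s'` equals `t * t' = 1`.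
  -- So `r` is invertible nowhere on `W`; at `w` both `s` and `r` lie in the maximal ideal, and then
  -- so does `1`.
  let r : Γ(W, ⊤) := f.appTop s * f'.appTop s' - 1
  have h₁ : w ∉ W.basicOpen (f.appTop s) := by
    intro hmem
    have : w ∈ f ⁻¹ᵁ N.basicOpen s := by rwa [Scheme.preimage_basicOpen]
    exact hs (hw ▸ this)
  have h₂ : W.basicOpen r = ⊥ := by
    by_contra hne
    obtain ⟨y, hy⟩ : (W.basicOpen r : Set W).Nonempty := by
      rwa [Set.nonempty_iff_ne_empty, Ne, TopologicalSpace.Opens.coe_eq_empty]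
    have ho : IsOpen ((f ≫ j) '' W.basicOpen r) := (f ≫ j).isOpenEmbedding.isOpenMap _ (W.basicOpen r).2
    obtain ⟨x, -, ⟨z, hz, rfl⟩, ⟨q, hq⟩⟩ := (PreirreducibleSpace.isPreirreducible_univ (X := X)) _ _
      ho e.opensRange.2 ⟨_, trivial, y, hy, rfl⟩ ⟨_, trivial,
        (show e (Classical.arbitrary (PrimeSpectrum B)) ∈ e.opensRange from ⟨_, rfl⟩)⟩
    obtain ⟨v, hv, -⟩ := Scheme.Pullback.exists_preimage_pullback (f := f ≫ j) (g := e) z q hq.symm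
    let Z := Limits.pullback (f ≫ j) e
    let a : Z ⟶ W := Limits.pullback.fst _ _
    let b : Z ⟶ Spec (.of B) := Limits.pullback.snd _ _
    have hab : a ≫ f ≫ j = b ≫ e := Limits.pullback.condition
    have hr : a.appTop r = 0 := by
      have e₁ := H Z (a ≫ f) b (by rw [Category.assoc, hab])
      have e₂ := H' Z (a ≫ f') b (by rw [Category.assoc, ← hff, hab])
      rw [Scheme.Hom.comp_appTop] at e₁ e₂
      have e₁' : a.appTop (f.appTop s) = globalMap b t := e₁
      have e₂' : a.appTop (f'.appTop s') = globalMap b t' := e₂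
      rw [map_sub, map_mul, e₁', e₂', ← map_mul, htt, map_one, map_one, sub_self]
    have : v ∈ a ⁻¹ᵁ W.basicOpen r := by
      change a v ∈ W.basicOpen r
      exact hv ▸ hz
    have h0 : a ⁻¹ᵁ W.basicOpen r = ⊥ :=
      (Scheme.preimage_basicOpen a r).trans ((congrArg Z.basicOpen hr).trans (Z.basicOpen_zero _))
    rw [h0] at this
    exact this
  have h₃ : w ∉ W.basicOpen r := by rw [h₂]; exact id
  rw [Scheme.mem_basicOpen_top] at h₁ h₃
  refine (IsLocalRing.maximalIdeal.isMaximal (W.presheaf.stalk w)).ne_top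
    ((Ideal.eq_top_iff_one _).mpr ?_)
  have h₄ := Ideal.sub_mem _ (Ideal.mul_mem_right (W.presheaf.germ ⊤ w trivial (f'.appTop s')) _
    ((IsLocalRing.mem_maximalIdeal _).mpr h₁)) ((IsLocalRing.mem_maximalIdeal _).mpr h₃)
  rw [← map_mul, ← map_sub, sub_sub_cancel, map_one] at h₄
  exact h₄

section ProjectiveLine

attribute [local instance] MvPolynomial.gradedAlgebra

open HomogeneousLocalization

variable {k : Type u} [Field k]

/-- The function is `g / f`, which is regular on the chart where `f` is invertible and vanishes
wherever `g` does. -/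
lemma vanishesAt_of_away {f g x : MvPolynomial (Fin 2) k} (hf : f ∈ lineGrading k 1)
    (hg : g ∈ lineGrading k 1) (hx : x = f * g) {B : Type u} [CommRing B]
    (θ : Away (lineGrading k) x →+* B) {m : ℕ} (hx' : x ∈ lineGrading k m) (hm : 0 < m)
    {p : Proj (lineGrading k)}
    (hfp : f ∉ p.asHomogeneousIdeal) (hgp : g ∈ p.asHomogeneousIdeal) :
    VanishesAt (Spec.map (CommRingCat.ofHom θ) ≫ Proj.awayι (lineGrading k) x hx' hm)
      (θ (awayMap (lineGrading k) hg hx (Away.isLocalizationElem hf hg))) p := by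
  obtain ⟨n, hn⟩ : p ∈ (Proj.awayι (lineGrading k) f hf one_pos).opensRange := by
    rw [Proj.opensRange_awayι]
    exact hfp
  refine ⟨_, Proj.awayι (lineGrading k) f hf one_pos, inferInstance, n,
    (Scheme.ΓSpecIso (.of (Away (lineGrading k) f))).inv (Away.isLocalizationElem hf hg), hn, ?_, ?_⟩
  · rw [basicOpen_eq_of_affine, ← Proj.awayι_preimage_basicOpen (lineGrading k) hf one_pos hg one_pos]
    intro h
    have : p ∈ Proj.basicOpen (lineGrading k) g := hn ▸ h
    exact this hgp
  · intro Z a b hab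
    have h₁ : Spec.map (CommRingCat.ofHom (awayMap (lineGrading k) hg hx)) ≫
        Proj.awayι (lineGrading k) f hf one_pos = Proj.awayι (lineGrading k) x hx' hm := by
      rw [Proj.SpecMap_awayMap_awayι]
      rfl
    have h₂ : a = b ≫ Spec.map (CommRingCat.ofHom θ) ≫
        Spec.map (CommRingCat.ofHom (awayMap (lineGrading k) hg hx)) := by
      rw [← cancel_mono (Proj.awayι (lineGrading k) f hf one_pos), hab, ← h₁]
      simp only [Category.assoc]
    have h₃ : globalMap a (Away.isLocalizationElem hf hg) =
        globalMap b (θ (awayMap (lineGrading k) hg hx (Away.isLocalizationElem hf hg))) := by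
      rw [h₂, ← Category.assoc, globalMap_comp_map, globalMap_comp_map]
    exact h₃

section Chart

variable {a₀ b₀ a₁ b₁ : k} (hdet : a₀ * b₁ - b₀ * a₁ = 1)

/-- The coordinate ring of the complement of two points of the projective line. -/
def chartEquiv : k[T;T⁻¹] ≃+* Away (lineGrading k) (lin a₀ b₀ * lin a₁ b₁) :=
  RingEquiv.ofBijective _ ⟨chartHom_injective hdet, chartHom_surjective hdet⟩

lemma chartEquiv_symm_apply (x : k[T;T⁻¹]) : (chartEquiv hdet).symm (chartHom a₀ b₀ a₁ b₁ x) = x :=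
  (chartEquiv hdet).symm_apply_apply x

/-- The complement of two points of the projective line. -/
def lineChart : Spec (.of k[T;T⁻¹]) ⟶ Proj (lineGrading k) :=
  Spec.map (CommRingCat.ofHom (chartEquiv hdet).symm.toRingHom) ≫
    Proj.awayι _ _ (lin_mul_mem a₀ b₀ a₁ b₁) two_pos

instance : IsIso (Spec.map (CommRingCat.ofHom (chartEquiv hdet).symm.toRingHom)) :=
  inferInstanceAs (IsIso (Spec.map (chartEquiv hdet).symm.toCommRingCatIso.hom))

instance : IsOpenImmersion (lineChart hdet) := by
  unfold lineChart
  infer_instance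

lemma mem_range_lineChart (p : Proj (lineGrading k)) : p ∈ Set.range (lineChart hdet) ↔
    lin a₀ b₀ ∉ p.asHomogeneousIdeal ∧ lin a₁ b₁ ∉ p.asHomogeneousIdeal := by
  have : (lineChart hdet).opensRange = Proj.basicOpen (lineGrading k) (lin a₀ b₀ * lin a₁ b₁) := by
    unfold lineChart
    rw [Scheme.Hom.opensRange_comp_of_isIso, Proj.opensRange_awayι]
  change p ∈ (lineChart hdet).opensRange ↔ _
  rw [this, Proj.basicOpen_mul]
  rfl

/-- The structure morphism of the projective line. -/
abbrev lineStr (k : Type u) [Field k] : Proj (lineGrading k) ⟶ Spec (.of k) :=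
  Proj.toSpecZero (lineGrading k) ≫
    Spec.map (CommRingCat.ofHom (algebraMap k (lineGrading k 0)))

lemma awayι_lineStr {f : MvPolynomial (Fin 2) k} {m : ℕ} (hf : f ∈ lineGrading k m) (hm : 0 < m) :
    Proj.awayι (lineGrading k) f hf hm ≫ lineStr k = Spec.map (CommRingCat.ofHom (lineConst f)) := by
  rw [lineStr, ← Category.assoc, Proj.awayι_toSpecZero, ← Spec.map_comp]
  rfl

lemma lineChart_lineStr : lineChart hdet ≫ lineStr k = specMap k k[T;T⁻¹] := by
  rw [lineChart, Category.assoc, awayι_lineStr, ← Spec.map_comp, ← CommRingCat.ofHom_comp]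
  congr 2
  refine RingHom.ext fun c ↦ ?_
  change (chartEquiv hdet).symm (lineConst _ c) = _
  rw [← chartHom_C, chartEquiv_symm_apply]
  rfl

lemma vanishesAt_T {p : Proj (lineGrading k)} (hp : lin a₀ b₀ ∈ p.asHomogeneousIdeal) :
    VanishesAt (lineChart hdet) (LaurentPolynomial.T 1) p := by
  have h := vanishesAt_of_away (lin_mem a₁ b₁) (lin_mem a₀ b₀)
    (mul_comm (lin a₀ b₀) (lin a₁ b₁)) (chartEquiv hdet).symm.toRingHom
    (lin_mul_mem a₀ b₀ a₁ b₁) two_pos (lin_notMem hdet hp) hp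
  refine cast (congrArg (VanishesAt (lineChart hdet) · p) ?_) h
  refine Eq.symm ?_
  rw [← chartEquiv_symm_apply hdet (LaurentPolynomial.T 1), chartHom_T]
  refine congrArg (chartEquiv hdet).symm (val_injective _ ?_)
  refine (IsLocalization.Away.algebraMap_isUnit (S := Localization.Away (lin a₀ b₀ * lin a₁ b₁))
    (lin a₀ b₀ * lin a₁ b₁)).pow 1 |>.mul_right_cancel ?_
  rw [Away.isLocalizationElem, awayMap_mk, val_mk_mul_pow, linQuot, val_mk_mul_pow, pow_one]

lemma vanishesAt_T_neg {p : Proj (lineGrading k)} (hp : lin a₁ b₁ ∈ p.asHomogeneousIdeal) :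
    VanishesAt (lineChart hdet) (LaurentPolynomial.T (-1)) p := by
  have h := vanishesAt_of_away (lin_mem a₀ b₀) (lin_mem a₁ b₁)
    (rfl : lin a₀ b₀ * lin a₁ b₁ = _) (chartEquiv hdet).symm.toRingHom
    (lin_mul_mem a₀ b₀ a₁ b₁) two_pos (fun h ↦ lin_notMem hdet h hp) hp
  refine cast (congrArg (VanishesAt (lineChart hdet) · p) ?_) h
  refine Eq.symm ?_
  rw [← chartEquiv_symm_apply hdet (LaurentPolynomial.T (-1)), chartHom_T_neg]
  refine congrArg (chartEquiv hdet).symm (val_injective _ ?_)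
  refine (IsLocalization.Away.algebraMap_isUnit (S := Localization.Away (lin a₀ b₀ * lin a₁ b₁))
    (lin a₀ b₀ * lin a₁ b₁)).pow 1 |>.mul_right_cancel ?_
  rw [Away.isLocalizationElem, awayMap_mk, val_mk_mul_pow, linQuotInv, val_mk_mul_pow, pow_one]

end Chart

/-- The point of the spectrum of a field. -/
abbrev fieldPt (k : Type u) [Field k] : Spec (.of k) := IsLocalRing.closedPoint k

/-- If `c` is the value at the point of the quotient of the first form by the second, then the first
form minus `c` times the second vanishes there. Subtracting a multiple of the second row keeps the
determinant one. -/
lemma exists_lin_mem_of_notMem {a₀ b₀ a₁ b₁ : k} (hdet : a₀ * b₁ - b₀ * a₁ = 1)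
    (x : Spec (.of k) ⟶ Proj (lineGrading k)) (hx : x ≫ lineStr k = 𝟙 _)
    (h : lin a₁ b₁ ∉ (x (fieldPt k)).asHomogeneousIdeal) :
    ∃ a b c d : k, a * d - b * c = 1 ∧ lin a b ∈ (x (fieldPt k)).asHomogeneousIdeal := by
  let i := Proj.awayι (lineGrading k) _ (lin_mem a₁ b₁) one_pos
  have hr : Set.range x ⊆ Set.range i := by
    refine range_subset_of_closedPoint_mem x (W := i.opensRange) ?_
    rw [Proj.opensRange_awayι]
    exact h
  let κ : Away (lineGrading k) (lin a₁ b₁) →+* k := (Spec.preimage (IsOpenImmersion.lift i x hr)).hom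
  have hκ : Spec.map (CommRingCat.ofHom κ) ≫ i = x := by
    rw [CommRingCat.ofHom_hom, Spec.map_preimage, IsOpenImmersion.lift_fac]
  have hκC (c : k) : κ (lineConst _ c) = c := by
    have h₁ : Spec.map (CommRingCat.ofHom (κ.comp (lineConst _))) =
        Spec.map (CommRingCat.ofHom (RingHom.id k)) := by
      rw [CommRingCat.ofHom_comp, Spec.map_comp, ← awayι_lineStr (lin_mem a₁ b₁) one_pos,
        ← Category.assoc, hκ, hx]
      exact (Spec.map_id (.of k)).symm
    exact congr($(congrArg CommRingCat.Hom.hom (Spec.map_injective h₁)) c)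
  let c := κ (Away.isLocalizationElem (lin_mem a₁ b₁) (lin_mem a₀ b₀))
  refine ⟨a₀ - c * a₁, b₀ - c * b₁, a₁, b₁, by linear_combination hdet, ?_⟩
  by_contra hne
  have h₂ : Spec.map (CommRingCat.ofHom κ) (fieldPt k) ∈ i ⁻¹ᵁ
      Proj.basicOpen (lineGrading k) (lin (a₀ - c * a₁) (b₀ - c * b₁)) := by
    change (Spec.map (CommRingCat.ofHom κ) ≫ i) (fieldPt k) ∈
      Proj.basicOpen (lineGrading k) (lin (a₀ - c * a₁) (b₀ - c * b₁))
    rw [hκ]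
    exact hne
  rw [Proj.awayι_preimage_basicOpen (lineGrading k) _ _ (lin_mem _ _) one_pos] at h₂
  have h₃ : κ (Away.isLocalizationElem (lin_mem a₁ b₁)
      (lin_mem (a₀ - c * a₁) (b₀ - c * b₁))) ∉ IsLocalRing.maximalIdeal k := h₂
  refine h₃ ?_
  have h₄ : Away.isLocalizationElem (lin_mem a₁ b₁) (lin_mem (a₀ - c * a₁) (b₀ - c * b₁)) =
      Away.isLocalizationElem (lin_mem a₁ b₁) (lin_mem a₀ b₀) - lineConst _ c := by
    refine val_injective _ ?_
    refine (IsLocalization.Away.algebraMap_isUnit (S := Localization.Away (lin a₁ b₁))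
      (lin a₁ b₁)).pow 1 |>.mul_right_cancel ?_
    rw [val_sub, sub_mul, Away.isLocalizationElem, Away.isLocalizationElem, val_mk_mul_pow,
      val_mk_mul_pow, val_lineConst, ← map_pow, ← map_mul, ← map_sub, pow_one, pow_one, pow_one]
    simp only [lin, map_sub, map_mul]
    ring_nf
  rw [h₄, map_sub, hκC, sub_self]
  exact zero_mem _

lemma exists_lin_mem (x : Spec (.of k) ⟶ Proj (lineGrading k)) (hx : x ≫ lineStr k = 𝟙 _) :
    ∃ a b c d : k, a * d - b * c = 1 ∧ lin a b ∈ (x (fieldPt k)).asHomogeneousIdeal := by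
  obtain ⟨i, hi⟩ := not_forall.mp (not_X_mem (x (fieldPt k)))
  fin_cases i
  · exact exists_lin_mem_of_notMem (a₀ := 0) (b₀ := -1) (a₁ := 1) (b₁ := 0) (by ring) x hx
      (by simpa [lin] using hi)
  · exact exists_lin_mem_of_notMem (a₀ := 1) (b₀ := 0) (a₁ := 0) (b₁ := 1) (by ring) x hx
      (by simpa [lin] using hi)

/-- The complement of two rational points of the projective line is the multiplicative group. -/
theorem exists_lineChart (x₀ x₁ : Spec (.of k) ⟶ Proj (lineGrading k))
    (hx₀ : x₀ ≫ lineStr k = 𝟙 _) (hx₁ : x₁ ≫ lineStr k = 𝟙 _)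
    (hne : x₀ (fieldPt k) ≠ x₁ (fieldPt k)) :
    ∃ e : Spec (.of k[T;T⁻¹]) ⟶ Proj (lineGrading k), IsOpenImmersion e ∧
      e ≫ lineStr k = specMap k k[T;T⁻¹] ∧
      Set.range e = {x₀ (fieldPt k), x₁ (fieldPt k)}ᶜ ∧
      VanishesAt e (LaurentPolynomial.T 1) (x₀ (fieldPt k)) ∧
      VanishesAt e (LaurentPolynomial.T (-1)) (x₁ (fieldPt k)) := by
  obtain ⟨a₀, b₀, c₀, d₀, hdet₀, h₀⟩ := exists_lin_mem x₀ hx₀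
  obtain ⟨a₁, b₁, c₁, d₁, hdet₁, h₁⟩ := exists_lin_mem x₁ hx₁
  -- Proportional linear forms have the same zero.
  have hδ : a₀ * b₁ - b₀ * a₁ ≠ 0 := by
    intro h
    refine hne (point_ext hdet₁ ?_ h₁)
    have : lin a₁ b₁ = .C (a₁ * d₀ - b₁ * c₀) * lin a₀ b₀ := by
      have h₂ : a₁ = (a₁ * d₀ - b₁ * c₀) * a₀ := by
        linear_combination (-a₁) * hdet₀ + c₀ * h
      have h₃ : b₁ = (a₁ * d₀ - b₁ * c₀) * b₀ := by
        linear_combination (-b₁) * hdet₀ + d₀ * h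
      have h₄ : lin a₁ b₁ = lin ((a₁ * d₀ - b₁ * c₀) * a₀) ((a₁ * d₀ - b₁ * c₀) * b₀) := by
        rw [← h₂, ← h₃]
      rw [h₄]
      simp only [lin, map_mul]
      ring
    rw [this]
    exact Ideal.mul_mem_left _ _ h₀
  set δ := a₀ * b₁ - b₀ * a₁ with hδ'
  -- The second form is rescaled to make the determinant one, as the chart requires.
  have hdet : a₀ * (δ⁻¹ * b₁) - b₀ * (δ⁻¹ * a₁) = 1 := by
    rw [← mul_inv_cancel₀ hδ]
    ring
  have hdet' : (δ⁻¹ * a₁) * (δ * d₁) - (δ⁻¹ * b₁) * (δ * c₁) = 1 := by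
    rw [← hdet₁]
    field_simp
  have h₁' : lin (δ⁻¹ * a₁) (δ⁻¹ * b₁) ∈ (x₁ (fieldPt k)).asHomogeneousIdeal := by
    have : lin (δ⁻¹ * a₁) (δ⁻¹ * b₁) = .C δ⁻¹ * lin a₁ b₁ := by
      simp only [lin, map_mul]
      ring
    rw [this]
    exact Ideal.mul_mem_left _ _ h₁
  refine ⟨lineChart hdet, inferInstance, lineChart_lineStr hdet, ?_, vanishesAt_T hdet h₀,
    vanishesAt_T_neg hdet h₁'⟩
  ext p
  rw [mem_range_lineChart, ← not_or]
  refine not_congr ⟨fun h ↦ h.imp (fun h ↦ ?_) (fun h ↦ ?_), ?_⟩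
  · exact point_ext hdet₀ h h₀
  · exact point_ext hdet' h h₁'
  · rintro (rfl | rfl)
    · exact .inl h₀
    · exact .inr h₁'

instance : IrreducibleSpace (Proj (lineGrading k)) := by
  let ξ : Proj (lineGrading k) := ⟨⊥, Ideal.isPrime_bot, fun h ↦ by
    have : (MvPolynomial.X 0 : MvPolynomial (Fin 2) k) ∈ (⊥ : HomogeneousIdeal (lineGrading k)) :=
      h (HomogeneousIdeal.mem_irrelevant_of_mem _ one_pos (MvPolynomial.isHomogeneous_X _ _))
    exact MvPolynomial.X_ne_zero 0 this⟩
  have hξ (W : Set (Proj (lineGrading k))) (hW : IsOpen W) (hne : W.Nonempty) : ξ ∈ W := by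
    obtain ⟨p, hp⟩ := hne
    obtain ⟨_, ⟨_, ⟨f, rfl⟩, rfl⟩, hpf, hfW⟩ :=
      (Proj.isBasis_basicOpen (lineGrading k)).exists_subset_of_mem_open hp hW
    refine hfW fun (h0 : f ∈ (⊥ : Ideal _)) ↦ hpf ?_
    rw [Ideal.mem_bot.mp h0]
    exact zero_mem _
  exact
    { isPreirreducible_univ := fun U V hU hV ⟨x, _, hx⟩ ⟨y, _, hy⟩ ↦
        ⟨ξ, trivial, hξ U hU ⟨x, hx⟩, hξ V hV ⟨y, hy⟩⟩
      toNonempty := ⟨ξ⟩ }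

end ProjectiveLine

end ConicPoints

end

/-! ### Zariski density of infinitely many points -/

noncomputable section

namespace ConicPoints

/-- A nonzero Laurent polynomial vanishes only at finitely many points. -/
lemma LaurentPolynomial.eq_zero_of_infinite {k : Type*} [Field k] (f : k[T;T⁻¹]) {J : Type*}
    [Infinite J] (κ : J → (k[T;T⁻¹] →+* k)) (hκ : Function.Injective κ)
    (hC : ∀ i c, κ i (LaurentPolynomial.C c) = c) (h : ∀ i, κ i f = 0) : f = 0 := by
  obtain ⟨n, P, hP⟩ := LaurentPolynomial.exists_T_pow f
  have hev (i : J) (P : Polynomial k) : κ i (Polynomial.toLaurent P) =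
      P.eval (κ i (LaurentPolynomial.T 1)) := by
    have : (κ i).comp Polynomial.toLaurent = Polynomial.evalRingHom (κ i (LaurentPolynomial.T 1)) := by
      refine Polynomial.ringHom_ext (fun c ↦ ?_) ?_
      · simp [hC]
      · simp
    exact congr($this P)
  have hinj : Function.Injective fun i ↦ κ i (LaurentPolynomial.T 1) := by
    intro i j hij
    refine hκ (IsLocalization.ringHom_ext (Submonoid.powers (Polynomial.X : Polynomial k)) ?_)
    refine RingHom.ext fun P ↦ ?_
    change κ i (Polynomial.toLaurent P) = κ j (Polynomial.toLaurent P)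
    rw [hev, hev]
    exact congrArg (P.eval ·) hij
  have hP0 : P = 0 := by
    refine Polynomial.eq_zero_of_infinite_isRoot P
      ((Set.infinite_range_of_injective hinj).mono ?_)
    rintro _ ⟨i, rfl⟩
    change P.eval _ = 0
    rw [← hev, hP, map_mul, h, zero_mul]
  rw [hP0, map_zero] at hP
  exact ((LaurentPolynomial.isUnit_T n).mul_left_eq_zero).mp hP.symm

section ProjectiveLine

attribute [local instance] MvPolynomial.gradedAlgebra

variable {k : Type u} [Field k]

/-- All but at most two of the points lie in a torus chart, where a point is an evaluation of
Laurent polynomials. A nonempty open set meets the chart in a set containing a nonempty basic open,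
and its equation, if it vanished at all those points, would be zero. -/
lemma exists_mem_open_of_injective (x : ℕ → (Spec (.of k) ⟶ Proj (lineGrading k)))
    (hx : ∀ n, x n ≫ lineStr k = 𝟙 _) (hinj : Function.Injective fun n ↦ x n (fieldPt k))
    (W : (Proj (lineGrading k)).Opens) (hW : (W : Set (Proj (lineGrading k))).Nonempty) :
    ∃ n, x n (fieldPt k) ∈ W := by
  have hdet : (1 : k) * 1 - 0 * 0 = 1 := by ring
  have hdet' : (0 : k) * 0 - 1 * (-1) = 1 := by ring
  let e := lineChart hdet
  let G : Set ℕ := {n | x n (fieldPt k) ∈ Set.range e}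
  have hG : Gᶜ.Finite := by
    have : Gᶜ ⊆ {n | lin 1 0 ∈ (x n (fieldPt k)).asHomogeneousIdeal} ∪
        {n | lin 0 1 ∈ (x n (fieldPt k)).asHomogeneousIdeal} := by
      intro n hn
      have := (mem_range_lineChart hdet _).not.mp hn
      rw [not_and_or, not_not, not_not] at this
      exact this
    refine Set.Finite.subset (Set.Finite.union (Set.Subsingleton.finite ?_)
      (Set.Subsingleton.finite ?_)) this
    · exact fun n hn m hm ↦ hinj (point_ext hdet hn hm)
    · exact fun n hn m hm ↦ hinj (point_ext hdet' hn hm)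
  have : Infinite G := (compl_compl G ▸ hG.infinite_compl).to_subtype
  have hκ (n : G) : ∃ κ : k[T;T⁻¹] →+* k, Spec.map (CommRingCat.ofHom κ) ≫ e = x n := by
    have hr : Set.range (x n) ⊆ Set.range e :=
      range_subset_of_closedPoint_mem (x n) (W := e.opensRange) n.2
    refine ⟨(Spec.preimage (IsOpenImmersion.lift e (x n) hr)).hom, ?_⟩
    rw [CommRingCat.ofHom_hom, Spec.map_preimage, IsOpenImmersion.lift_fac]
  choose κ hκ using hκ
  by_contra! hn
  obtain ⟨_, _, hqW, ⟨q, rfl⟩⟩ := (PreirreducibleSpace.isPreirreducible_univ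
    (X := Proj (lineGrading k))) _ _ W.2 e.opensRange.2 (by simpa using hW)
      ⟨_, trivial, (show e (Classical.arbitrary (PrimeSpectrum k[T;T⁻¹])) ∈ e.opensRange from ⟨_, rfl⟩)⟩
  obtain ⟨_, ⟨_, ⟨f, rfl⟩, rfl⟩, hqf, hfW⟩ := PrimeSpectrum.isBasis_basic_opens.exists_subset_of_mem_open
    (show q ∈ (e ⁻¹ᵁ W : Set _) from hqW) (e ⁻¹ᵁ W).2
  have hC (n : G) (c : k) : κ n (LaurentPolynomial.C c) = c := by
    have h₁ : Spec.map (CommRingCat.ofHom ((κ n).comp (algebraMap k k[T;T⁻¹]))) =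
        Spec.map (CommRingCat.ofHom (RingHom.id k)) := by
      rw [CommRingCat.ofHom_comp, Spec.map_comp]
      have := hx n
      rw [← hκ n, Category.assoc, lineChart_lineStr] at this
      exact this.trans (Spec.map_id (.of k)).symm
    exact congr($(congrArg CommRingCat.Hom.hom (Spec.map_injective h₁)) c)
  have hf : f = 0 := by
    refine LaurentPolynomial.eq_zero_of_infinite f κ (fun n m hnm ↦ ?_) hC fun n ↦ ?_
    · refine Subtype.ext (hinj ?_)
      change x n (fieldPt k) = x m (fieldPt k)
      rw [← hκ n, ← hκ m, hnm]
    · by_contra hne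
      have h₁ : Spec.map (CommRingCat.ofHom (κ n)) (fieldPt k) ∈ e ⁻¹ᵁ W := by
        refine hfW ?_
        change κ n f ∉ IsLocalRing.maximalIdeal k
        rwa [IsLocalRing.maximalIdeal_eq_bot, Ideal.mem_bot]
      have h₂ : (Spec.map (CommRingCat.ofHom (κ n)) ≫ e) (fieldPt k) ∈ W := h₁
      rw [hκ] at h₂
      exact hn n h₂
  rw [hf] at hqf
  exact hqf (zero_mem _)

variable {R K : Type u} [CommRing R] [Field K] [Algebra R K]

/-- A smooth rational curve, geometrically: the projective line over the algebraic closure is a base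
change. -/
lemma exists_isPullback_line {𝒳 : Scheme.{u}} (π : 𝒳 ⟶ Spec (.of R))
    (h : IsSmoothRationalCurve (baseChange K (Over.mk π))) :
    ∃ Q : Proj (lineGrading (AlgebraicClosure K)) ⟶ 𝒳,
      IsPullback Q (lineStr _) π (specMap K (AlgebraicClosure K) ≫ specMap R K) := by
  obtain ⟨i⟩ := h
  let j : Proj (lineGrading (AlgebraicClosure K)) ≅ Limits.pullback (Limits.pullback.snd π (specMap R K))
      (specMap K (AlgebraicClosure K)) := (Over.forget _).mapIso i.symm
  have hj : j.hom ≫ Limits.pullback.snd _ _ = lineStr _ := Over.w i.inv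
  refine ⟨j.hom ≫ Limits.pullback.fst _ _ ≫ Limits.pullback.fst _ _, ?_⟩
  have hp := (IsPullback.of_hasPullback (Limits.pullback.snd π (specMap R K))
    (specMap K (AlgebraicClosure K))).paste_horiz (IsPullback.of_hasPullback π (specMap R K))
  have := (IsPullback.of_horiz_isIso ⟨hj.trans (Category.comp_id _).symm⟩).paste_horiz hp
  rwa [Category.id_comp] at this

/-- A nonempty open subset of a flat scheme over a domain meets the generic fibre. -/
lemma exists_mem_open_of_flat [IsDomain R] [IsFractionRing R K] {𝒳 X : Scheme.{u}} {π : 𝒳 ⟶ Spec (.of R)} [Flat π]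
    {k : Type u} [Field k] [Algebra K k] {Q : X ⟶ 𝒳} {q : X ⟶ Spec (.of k)}
    (hp : IsPullback Q q π (specMap K k ≫ specMap R K)) (W : 𝒳.Opens)
    (hW : (W : Set 𝒳).Nonempty) : ∃ x : X, Q x ∈ W := by
  obtain ⟨w, hw⟩ := hW
  let b : Spec (.of R) := (specMap K k ≫ specMap R K) (fieldPt k)
  have hb : b ⤳ π w := by
    refine (PrimeSpectrum.le_iff_specializes (R := R) _ _).mp fun r hr ↦ ?_
    have h₁ : algebraMap K k (algebraMap R K r) ∈ IsLocalRing.maximalIdeal k := hr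
    rw [IsLocalRing.maximalIdeal_eq_bot, Ideal.mem_bot, map_eq_zero,
      map_eq_zero_iff _ (IsFractionRing.injective R K)] at h₁
    rw [h₁]
    exact zero_mem _
  -- Flat morphisms lift generalizations: `w` has a generalization over the generic point of the
  -- base, and open sets are stable under generalization.
  obtain ⟨w', hw', hπ⟩ := Flat.generalizingMap π hb
  have hw'W : w' ∈ W := hw'.mem_open W.2 hw
  obtain ⟨z, hz, -⟩ := Scheme.Pullback.exists_preimage_pullback w' (fieldPt k) hπ
  refine ⟨hp.isoPullback.inv z, ?_⟩
  rw [← hz] at hw'W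
  change (hp.isoPullback.inv ≫ Q) z ∈ W
  rwa [hp.isoPullback_inv_fst]

variable {K : Type u} [Field K] [NumberField K] {S : Finset (HeightOneSpectrum (𝓞 K))}
  {𝒳 : Scheme.{u}} {π : 𝒳 ⟶ Spec (.of (OS K S))} {𝒟 : 𝒳.IdealSheafData}

/-- The `K`-points lift to points of the projective line over the algebraic closure, which stay
distinct because the extension of fields gives an epimorphism of spectra. By flatness every nonempty
open of `𝒳` has nonempty preimage in that line, hence contains one of the points. -/
theorem integralPointsDense_of_injective (h : IsRationalCurveWithBisection π 𝒟)
    (y : ℕ → (Spec (.of K) ⟶ (openComplement 𝒟).toScheme)) (hy : Function.Injective y)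
    (H : ∀ n, ∃ s : Spec (.of (OS K S)) ⟶ (openComplement 𝒟).toScheme,
      s ≫ (openComplement 𝒟).ι ≫ π = 𝟙 _ ∧ specMap (OS K S) K ≫ s = y n) :
    IntegralPointsDense π 𝒟 := by
  obtain ⟨Q, hp⟩ := exists_isPullback_line π h.rational
  have := h.flat
  have := h.proper
  let k := AlgebraicClosure K
  have hlft : LocallyOfFiniteType (lineStr k) :=
    MorphismProperty.of_isPullback (P := @LocallyOfFiniteType) hp inferInstance
  choose s hs hsy using H
  have hyπ (n) : y n ≫ (openComplement 𝒟).ι ≫ π = specMap (OS K S) K := by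
    rw [← hsy, Category.assoc, hs, Category.comp_id]
  let x (n : ℕ) : Spec (.of k) ⟶ Proj (lineGrading k) :=
    hp.lift (specMap K k ≫ y n ≫ (openComplement 𝒟).ι) (𝟙 _) (by
      rw [Category.assoc, Category.assoc, hyπ, Category.id_comp])
  have hx (n) : x n ≫ lineStr k = 𝟙 _ := hp.lift_snd _ _ _
  have hxQ (n) : x n ≫ Q = specMap K k ≫ y n ≫ (openComplement 𝒟).ι := hp.lift_fst _ _ _
  have : Flat (specMap K k) := Flat.SpecMap_iff.mpr (by
    change (algebraMap K k).Flat
    rw [RingHom.flat_algebraMap_iff]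
    infer_instance)
  have : Surjective (specMap K k) := ⟨fun z ↦ ⟨fieldPt k, Subsingleton.elim (α := PrimeSpectrum K) _ _⟩⟩
  have : Epi (specMap K k) := Flat.epi_of_flat_of_surjective _
  have hinj : Function.Injective fun n ↦ x n (fieldPt k) := by
    intro n m hnm
    have h₁ : x n = x m := ext_of_apply_closedPoint_eq (lineStr k) (hx n) (hx m) hnm
    have h₂ := hxQ n
    rw [h₁, hxQ m, cancel_epi, cancel_mono] at h₂
    exact hy h₂.symm
  rw [IntegralPointsDense, dense_iff_inter_open]
  intro W hW hne
  obtain ⟨z, hz⟩ := exists_mem_open_of_flat hp ⟨W, hW⟩ hne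
  obtain ⟨n, hn⟩ := exists_mem_open_of_injective x hx hinj (Q ⁻¹ᵁ ⟨W, hW⟩) ⟨z, hz⟩
  refine ⟨(x n ≫ Q) (fieldPt k), hn, s n ≫ (openComplement 𝒟).ι, ⟨?_, ?_⟩, ?_⟩
  · rw [Category.assoc, hs]
  · intro p
    exact (s n p).2
  · rw [hxQ, ← hsy]
    exact ⟨specMap K k (fieldPt k), rfl⟩

end ProjectiveLine

end ConicPoints

end

/-! ### Group schemes: congruences between powers and generically trivial sections -/

noncomputable section

namespace ConicPoints

lemma exists_specMap_eq_closedPoint {A : Type u} [CommRing A] [IsLocalRing A] {c : A}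
    (hc : c ∈ IsLocalRing.maximalIdeal A) :
    ∃ x : Spec (.of (A ⧸ Ideal.span {c})),
      specMap A (A ⧸ Ideal.span {c}) x = IsLocalRing.closedPoint A := by
  suffices IsLocalRing.closedPoint A ∈
      Set.range (PrimeSpectrum.comap (algebraMap A (A ⧸ Ideal.span {c}))) from this
  refine (range_comap_of_surjective _ (algebraMap A (A ⧸ Ideal.span {c}))
    Ideal.Quotient.mk_surjective).ge ?_
  suffices c ∈ (IsLocalRing.closedPoint A).asIdeal by simpa [PrimeSpectrum.mem_zeroLocus]
  exact hc

lemma finite_ringHom {R C F : Type*} [CommRing R] [CommRing C] [CommRing F] [Finite F]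
    (ρ : R →+* C) (hρ : ρ.FiniteType) (χ : R →+* F) : Finite {κ : C →+* F // κ.comp ρ = χ} := by
  let := ρ.toAlgebra
  let := χ.toAlgebra
  have : Algebra.FiniteType R C := hρ
  obtain ⟨s, hs⟩ := this.out
  refine Finite.of_injective (fun κ (x : s) ↦ κ.1 x) fun κ κ' h ↦ Subtype.ext ?_
  let κ₁ : C →ₐ[R] F := { κ.1 with commutes' := fun r ↦ congr($(κ.2) r) }
  let κ₂ : C →ₐ[R] F := { κ'.1 with commutes' := fun r ↦ congr($(κ'.2) r) }
  have : κ₁ = κ₂ := AlgHom.ext_of_adjoin_eq_top hs fun x hx ↦ congrFun h ⟨x, hx⟩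
  exact congrArg AlgHom.toRingHom this

/-- A scheme of finite type has finitely many points with values in a finite local ring. -/
lemma finite_hom {R F : Type u} [CommRing R] [CommRing F] [Algebra R F] [Finite F] [IsLocalRing F]
    {T : Scheme.{u}} (τ : T ⟶ Spec (.of R)) [LocallyOfFiniteType τ] [QuasiCompact τ] :
    Finite {f : Spec (.of F) ⟶ T // f ≫ τ = specMap R F} := by
  have : CompactSpace T := (quasiCompact_iff_compactSpace τ).mp inferInstance
  obtain ⟨s, hs, hs'⟩ := (isCompact_iff_finite_and_eq_biUnion_affineOpens (X := T) (U := ⊤)).mp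
    isCompact_univ
  have := hs.to_subtype
  have hW (W : T.affineOpens) :
      Finite {f : Spec (.of F) ⟶ T // f ≫ τ = specMap R F ∧ Set.range f ⊆ W.1} := by
    let ρ : R →+* Γ(T, W.1) := (Spec.preimage (W.2.fromSpec ≫ τ)).hom
    have hρ' : Spec.map (CommRingCat.ofHom ρ) = W.2.fromSpec ≫ τ := Spec.map_preimage _
    have hρ : ρ.FiniteType := by
      rw [← CommRingCat.hom_ofHom ρ, ← HasRingHomProperty.Spec_iff (P := @LocallyOfFiniteType), hρ']
      have := W.2.isOpenImmersion_fromSpec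
      infer_instance
    have := finite_ringHom ρ hρ (algebraMap R F)
    choose κ hκ using fun f : {f : Spec (.of F) ⟶ T // f ≫ τ = specMap R F ∧ Set.range f ⊆ W.1} ↦
      exists_ringHom_fromSpec W.2 f.1 f.2.2
    have hκρ (f) : (κ f).comp ρ = algebraMap R F := by
      have h₁ : Spec.map (CommRingCat.ofHom ((κ f).comp ρ)) = specMap R F := by
        rw [CommRingCat.ofHom_comp, Spec.map_comp, hρ', ← Category.assoc, hκ, f.2.1]
      exact congrArg CommRingCat.Hom.hom (Spec.map_injective h₁)
    refine Finite.of_injective (β := {κ : Γ(T, W.1) →+* F // κ.comp ρ = algebraMap R F})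
      (fun f ↦ ⟨κ f, hκρ f⟩) fun f f' h ↦ Subtype.ext ?_
    have h' : κ f = κ f' := congrArg Subtype.val h
    rw [← hκ f, h', hκ f']
  refine Finite.of_surjective
    (α := Σ W : s, {f : Spec (.of F) ⟶ T // f ≫ τ = specMap R F ∧ Set.range f ⊆ W.1.1})
    (fun x ↦ ⟨x.2.1, x.2.2.1⟩) fun ⟨f, hf⟩ ↦ ?_
  have : f (IsLocalRing.closedPoint F) ∈ ((⊤ : T.Opens) : Set T) := trivial
  rw [hs'] at this
  obtain ⟨W, hWs, hfW⟩ : ∃ W ∈ s, f (IsLocalRing.closedPoint F) ∈ W.1 := by simpa using this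
  exact ⟨⟨⟨W, hWs⟩, f, hf, range_subset_of_closedPoint_mem f hfW⟩, rfl⟩

section Sections

variable {R K : Type u} [CommRing R] [IsDomain R] [Field K] [Algebra R K] [IsFractionRing R K]

lemma specMap_localRing_closedPoint (p : PrimeSpectrum R) :
    specMap R (localRing R K p) (IsLocalRing.closedPoint (localRing R K p)) = p :=
  PrimeSpectrum.ext (IsLocalization.AtPrime.under_maximalIdeal (localRing R K p) p.asIdeal)

/-- Two morphisms that agree generically and at a point agree near this point. -/
lemma exists_opens_eq {T : Scheme.{u}} {h e : Spec (.of R) ⟶ T}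
    (hK : specMap R K ≫ h = specMap R K ≫ e) (p : PrimeSpectrum R) (hp : h p = e p) :
    ∃ O : (Spec (.of R)).Opens, p ∈ O ∧ O.ι ≫ h = O.ι ≫ e := by
  obtain ⟨_, ⟨W, hW, rfl⟩, hhW, -⟩ := T.isBasis_affineOpens.exists_subset_of_mem_open
    (Set.mem_univ (h p)) isOpen_univ
  have hloc : specMap R (localRing R K p) ≫ h = specMap R (localRing R K p) ≫ e := by
    obtain ⟨κ, hκ⟩ := exists_ringHom_fromSpec hW (specMap R (localRing R K p) ≫ h)
      (range_subset_of_closedPoint_mem _ (by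
        change h (specMap R (localRing R K p) _) ∈ W
        rw [specMap_localRing_closedPoint]
        exact hhW))
    obtain ⟨κ', hκ'⟩ := exists_ringHom_fromSpec hW (specMap R (localRing R K p) ≫ e)
      (range_subset_of_closedPoint_mem _ (by
        change e (specMap R (localRing R K p) _) ∈ W
        rw [specMap_localRing_closedPoint, ← hp]
        exact hhW))
    have : (algebraMap (localRing R K p) K).comp κ = (algebraMap (localRing R K p) K).comp κ' := by
      apply ringHom_ext_of_fromSpec hW
      rw [← specMap_comp_map, ← specMap_comp_map, Category.assoc, Category.assoc, hκ, hκ',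
        ← Category.assoc, ← Category.assoc, specMap_comp, hK]
    have hκκ : κ = κ' := by
      ext b
      exact congr($this b)
    rw [← hκ, ← hκ', hκκ]
  obtain ⟨i, hi⟩ := exists_iso_fromSpecStalk (localRing R K p) p
  have : (Spec (.of R)).IsGermInjective := inferInstance
  refine spread_out_unique_of_isGermInjective' (x := (p : Spec (.of R))) h e ?_
  rw [hi, Category.assoc, Category.assoc, hloc]

variable (𝒢 : Over (Spec (.of R))) [GrpObj 𝒢] [LocallyOfFiniteType 𝒢.hom] [QuasiCompact 𝒢.hom]
  (hR : ∀ a : R, a ≠ 0 → Finite (R ⧸ Ideal.span {a}))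

/-- The spectrum of an algebra, as a scheme over the base. -/
abbrev toBase (A : Type u) [CommRing A] [Algebra R A] :
    Over.mk (specMap R A) ⟶ Over.mk (𝟙 (Spec (.of R))) :=
  Over.homMk (specMap R A)

-- Reduction modulo `c` is a homomorphism to the group of points over a finite local (or zero) ring.
-- That group is finite, and its order serves as `k`.
include hR in
lemma exists_pow_eq_one (g : Over.mk (𝟙 (Spec (.of R))) ⟶ 𝒢) (p : PrimeSpectrum R)
    {c : localRing R K p} (hc : c ≠ 0) :
    ∃ k > 0, toBase (localRing R K p ⧸ Ideal.span {c}) ≫ g ^ k = 1 := by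
  let F := localRing R K p ⧸ Ideal.span {c}
  have : Finite F := finite_quotient_of_isLocalization p.asIdeal.primeCompl hR hc
  have : Finite (Over.mk (specMap R F) ⟶ 𝒢) := by
    obtain hF | hF := subsingleton_or_nontrivial F
    · have : IsEmpty (Spec (.of F)) := inferInstanceAs (IsEmpty (PrimeSpectrum F))
      have : Subsingleton (Over.mk (specMap R F) ⟶ 𝒢) :=
        ⟨fun f g ↦ Over.OverMorphism.ext ((isInitialOfIsEmpty (X := Spec (.of F))).hom_ext _ _)⟩
      infer_instance
    · have : IsLocalRing F := .of_surjective' _ Ideal.Quotient.mk_surjective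
      have := finite_hom (F := F) 𝒢.hom
      refine Finite.of_injective
        (fun f : Over.mk (specMap R F) ⟶ 𝒢 ↦
          (⟨f.left, Over.w f⟩ : {f : Spec (.of F) ⟶ 𝒢.left // f ≫ 𝒢.hom = specMap R F}))
        fun f f' h ↦ Over.OverMorphism.ext (congrArg Subtype.val h)
  refine ⟨Nat.card (Over.mk (specMap R F) ⟶ 𝒢), Nat.card_pos, ?_⟩
  rw [MonObj.comp_pow]
  exact pow_card_eq_one'

include hR in
/-- A section that is trivial generically is a torsion section. -/
lemma exists_pow_eq_one_of_generic (h : Over.mk (𝟙 (Spec (.of R))) ⟶ 𝒢)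
    (hK : toBase K ≫ h = 1) : ∃ m > 0, h ^ m = 1 := by
  have hK' (m : ℕ) : specMap R K ≫ (h ^ m).left =
      specMap R K ≫ (1 : Over.mk (𝟙 (Spec (.of R))) ⟶ 𝒢).left := by
    have : toBase K ≫ h ^ m = toBase K ≫ 1 := by
      rw [MonObj.comp_pow, hK, one_pow, MonObj.comp_one]
    exact congr(($this).left)
  -- `𝒢` is not assumed separated, so generic triviality only gives triviality on a neighbourhood
  -- `O` of the generic point. At the finitely many primes outside, a power of `h` passes through
  -- the unit section; two sections that agree generically and at a point agree near it.
  let z : Spec (.of R) := specMap R K (fieldPt K)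
  obtain ⟨O, hzO, hO⟩ := exists_opens_eq (hK' 1) z (congr($(hK' 1) (fieldPt K)))
  have hOm (m : ℕ) (p : Spec (.of R)) (hp : p ∈ O) :
      (h ^ m).left p = (1 : Over.mk (𝟙 (Spec (.of R))) ⟶ 𝒢).left p := by
    let j : Over.mk O.ι ⟶ Over.mk (𝟙 (Spec (.of R))) := Over.homMk O.ι
    have h₁ : j ≫ h = 1 := by
      rw [← MonObj.comp_one j]
      rw [pow_one] at hO
      exact Over.OverMorphism.ext hO
    have h₂ : j ≫ h ^ m = j ≫ 1 := by rw [MonObj.comp_pow, h₁, one_pow, MonObj.comp_one]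
    exact congr(($h₂).left ⟨p, hp⟩)
  obtain ⟨_, ⟨_, ⟨f, rfl⟩, rfl⟩, hzf, hfO⟩ :=
    PrimeSpectrum.isBasis_basic_opens.exists_subset_of_mem_open (show z ∈ (O : Set _) from hzO) O.2
  have hf : f ≠ 0 := by
    rintro rfl
    exact hzf (zero_mem _)
  have := hR f hf
  have hfin := finite_primes_of_finite_quotient f
  have key (p : PrimeSpectrum R) (hp : f ∈ p.asIdeal) : ∃ k > 0, ∀ m,
      (h ^ (k * m)).left p = (1 : Over.mk (𝟙 (Spec (.of R))) ⟶ 𝒢).left p := by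
    have hc : algebraMap R (localRing R K p) f ≠ 0 := by
      intro h0
      have := congrArg (algebraMap (localRing R K p) K) h0
      rw [← IsScalarTower.algebraMap_apply, map_zero,
        map_eq_zero_iff _ (IsFractionRing.injective R K)] at this
      exact hf this
    obtain ⟨k, hk, hk'⟩ := exists_pow_eq_one 𝒢 hR h p hc
    refine ⟨k, hk, fun m ↦ ?_⟩
    obtain ⟨x, hx⟩ := exists_specMap_eq_closedPoint
      ((IsLocalization.AtPrime.to_map_mem_maximal_iff (localRing R K p) p.asIdeal f).mpr hp)
    set F := localRing R K p ⧸ Ideal.span {algebraMap R (localRing R K p) f}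
    have h₁ : toBase F ≫ h ^ (k * m) = toBase F ≫ 1 := by
      rw [pow_mul, MonObj.comp_pow, hk', one_pow, MonObj.comp_one]
    have h₂ : (specMap R F ≫ (h ^ (k * m)).left) x =
        (specMap R F ≫ (1 : Over.mk (𝟙 (Spec (.of R))) ⟶ 𝒢).left) x := congr(($h₁).left x)
    have hx' : specMap R F x = p := by
      rw [← specMap_comp R (localRing R K p) F, Scheme.Hom.comp_apply, hx,
        specMap_localRing_closedPoint]
    rw [Scheme.Hom.comp_apply, Scheme.Hom.comp_apply, hx'] at h₂
    exact h₂
  choose! k hk hk' using key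
  refine ⟨∏ p ∈ hfin.toFinset, k p, Finset.prod_pos fun p hp ↦ hk p (by simpa using hp), ?_⟩
  refine Over.OverMorphism.ext (Scheme.hom_ext_of_forall _ _ fun p ↦ ?_)
  refine exists_opens_eq (hK' _) p ?_
  by_cases hp : p ∈ O
  · exact hOm _ p hp
  · have hfp : f ∈ p.asIdeal := by
      by_contra hfp
      exact hp (hfO hfp)
    obtain ⟨d, hd⟩ := Finset.dvd_prod_of_mem k (hfin.mem_toFinset.mpr hfp)
    rw [hd]
    exact hk' p hfp d

end Sections

end ConicPoints

end

/-! ### The orbit of the integral point under a torus of positive rank -/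

noncomputable section

namespace ConicPoints

lemma exists_infinite_order {Γ : Type u} [Group Γ] (h : 0 < groupRank Γ) :
    ∃ g : Γ, ∀ n > 0, g ^ n ≠ 1 := by
  rw [groupRank] at h
  obtain ⟨n, hn⟩ := lt_iSup_iff.mp h
  obtain ⟨⟨f, hf⟩, hn⟩ := lt_iSup_iff.mp hn
  have : NeZero n := ⟨by rintro rfl; simp at hn⟩
  refine ⟨f (.ofAdd (Pi.single 0 1)), fun m hm h1 ↦ ?_⟩
  rw [← map_pow, ← map_one f] at h1
  have h2 := congrFun (congrArg Multiplicative.toAdd (hf h1)) 0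
  simp at h2
  lia

lemma hasFiniteQuotients_fin {R : Type u} [CommRing R]
    (hR : ∀ a : R, a ≠ 0 → Finite (R ⧸ Ideal.span {a})) (f : R) (hf : f ≠ 0) :
    {p : PrimeSpectrum R | f ∈ p.asIdeal}.Finite :=
  have := hR f hf
  finite_primes_of_finite_quotient f

section Lift

variable {K : Type u} [Field K] [NumberField K] {S : Finset (HeightOneSpectrum (𝓞 K))}
  {𝒳 : Scheme.{u}} {π : 𝒳 ⟶ Spec (.of (OS K S))} {𝒟 : 𝒳.IdealSheafData}

lemma exists_lift_openComplement (hpt : (integralPoints π 𝒟).Nonempty) :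
    ∃ P₀ : Spec (.of (OS K S)) ⟶ (openComplement 𝒟).toScheme,
      P₀ ≫ (openComplement 𝒟).ι ≫ π = 𝟙 _ := by
  obtain ⟨s, hs, hs'⟩ := hpt
  refine ⟨IsOpenImmersion.lift (openComplement 𝒟).ι s ?_, ?_⟩
  · rw [Scheme.Opens.range_ι]
    rintro _ ⟨p, rfl⟩
    exact hs' p
  · rw [← Category.assoc, IsOpenImmersion.lift_fac, hs]

/-- Infinitely many of the points of a congruence-periodic family are integral, hence the integral
points are dense. -/
theorem integralPointsDense_of_family (h : IsRationalCurveWithBisection π 𝒟)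
    {T TK : Scheme.{u}} {τ : T ⟶ Spec (.of (OS K S))} {fst : TK ⟶ T} {snd : TK ⟶ Spec (.of K)}
    (hp : IsPullback fst snd τ (specMap (OS K S) K)) [QuasiCompact τ] [QuasiSeparated τ]
    (φ : TK ⟶ (openComplement 𝒟).toScheme)
    (hφ : φ ≫ (openComplement 𝒟).ι ≫ π = fst ≫ τ) (g : ℕ → (Spec (.of (OS K S)) ⟶ T))
    (hg : ∀ n, g n ≫ τ = 𝟙 _)
    (H : ∀ (p : PrimeSpectrum (OS K S)) (c : localRing (OS K S) K p), c ≠ 0 → ∃ k > 0, ∀ n,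
      specMap (OS K S) (localRing (OS K S) K p ⧸ Ideal.span {c}) ≫ g (k * n) =
        specMap (OS K S) (localRing (OS K S) K p ⧸ Ideal.span {c}) ≫ g 0)
    (y : ℕ → (Spec (.of K) ⟶ TK)) (hy : ∀ n, y n ≫ fst = specMap (OS K S) K ≫ g n)
    (hinj : Function.Injective fun n ↦ y n ≫ φ)
    (P₀ : Spec (.of (OS K S)) ⟶ (openComplement 𝒟).toScheme)
    (hP₀ : specMap (OS K S) K ≫ P₀ = y 0 ≫ φ) : IntegralPointsDense π 𝒟 := by
  have := h.proper
  have : IsSeparated π := inferInstance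
  have : LocallyOfFinitePresentation π := inferInstance
  obtain ⟨k, hk, hs⟩ := exists_sections
    (hasFiniteQuotients_fin (finite_quotient_OS K S)) hp ((openComplement 𝒟).ι ≫ π) φ hφ g hg
    H y hy P₀ hP₀
  refine integralPointsDense_of_injective h (fun n ↦ y (k * n) ≫ φ) (fun n m hnm ↦ ?_) hs
  exact Nat.eq_of_mul_eq_mul_left hk (hinj hnm)

/-- The family consists of the translates of `P₀` by the powers of a section `g` of infinite order,
carried to `U` by the orbit map on the generic fibre of the model. -/
theorem integralPointsDense_of_isTorsor (h : IsRationalCurveWithBisection π 𝒟)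
    (hpt : (integralPoints π 𝒟).Nonempty) (G : Over (Spec (.of K))) [GrpObj G]
    (hG : IsTorsor G (genericComplement π 𝒟)) (𝒢 : Over (Spec (.of (OS K S)))) [GrpObj 𝒢]
    (hm : IsModel 𝒢 G) (hr : 0 < sectionRank 𝒢) : IntegralPointsDense π 𝒟 := by
  obtain ⟨-, hMod, hiso⟩ := hG
  rw [ModObj.isIso_leftSMul_iff] at hiso
  obtain ⟨g, hg⟩ := exists_infinite_order hr
  obtain ⟨e, he⟩ := hm.generic
  obtain ⟨P₀, hP₀⟩ := exists_lift_openComplement hpt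
  have := hm.locallyOfFiniteType
  have := hm.quasiCompact
  -- Finite type over a noetherian base supplies the quasi-separatedness needed to spread out the
  -- orbit map.
  have : IsLocallyNoetherian 𝒢.left := LocallyOfFiniteType.isLocallyNoetherian 𝒢.hom
  have : QuasiSeparated 𝒢.hom := (quasiSeparated_iff_quasiSeparatedSpace _).mpr inferInstance
  let F := Over.pullback (specMap (OS K S) K)
  let U := genericComplement π 𝒟
  let x₀ : 𝟙_ (Over (Spec (.of K))) ⟶ U := Over.homMk (Limits.pullback.lift
    (specMap (OS K S) K ≫ P₀) (𝟙 _) (by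
      change (_ ≫ _) ≫ (openComplement 𝒟).ι ≫ π = _
      rw [Category.assoc, hP₀, Category.comp_id, Category.id_comp])) (Limits.pullback.lift_snd _ _ _)
  let orbit : genericFibre 𝒢 ⟶ U := e.hom • (toUnit _ ≫ x₀)
  let Y (n : ℕ) : 𝟙_ (Over (Spec (.of K))) ⟶ genericFibre 𝒢 :=
    Functor.LaxMonoidal.ε F ≫ F.map (g ^ n)
  have hε : (Functor.LaxMonoidal.ε F).left ≫ Limits.pullback.fst (𝟙 _) (specMap (OS K S) K) =
      specMap (OS K S) K := by
    have h₁ := Over.w (Functor.LaxMonoidal.ε F)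
    have h₂ := Limits.pullback.condition (f := 𝟙 _) (g := specMap (OS K S) K)
    rw [Category.comp_id] at h₂
    rw [h₂, ← Category.assoc]
    exact (congrArg (· ≫ specMap (OS K S) K) h₁).trans (Category.id_comp _)
  have hYfst (n : ℕ) : (Y n).left ≫ Limits.pullback.fst _ _ = specMap (OS K S) K ≫ (g ^ n).left := by
    have h₁ : (F.map (g ^ n)).left ≫ Limits.pullback.fst _ _ =
        Limits.pullback.fst (𝟙 _) _ ≫ (g ^ n).left := Limits.pullback.lift_fst _ _ _
    change ((Functor.LaxMonoidal.ε F).left ≫ (F.map (g ^ n)).left) ≫ _ = _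
    rw [Category.assoc, h₁, ← Category.assoc]
    exact congrArg (· ≫ (g ^ n).left) hε
  have hY0 : Y 0 ≫ e.hom = 1 := by
    have h₁ : Y 0 = MonObj.one := by
      change Functor.LaxMonoidal.ε F ≫ F.map (g ^ 0) = Functor.LaxMonoidal.ε F ≫ F.map MonObj.one
      congr 2
    rw [h₁, IsMonHom.one_hom, Hom.one_def, toUnit_unique (toUnit _) (𝟙 (𝟙_ _))]
    exact (Category.id_comp _).symm
  have hYo (n : ℕ) : Y n ≫ orbit = (Y n ≫ e.hom) • x₀ := by
    rw [ModObj.comp_smul, ← Category.assoc, toUnit_unique (Y n ≫ toUnit _) (𝟙 _), Category.id_comp]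
  refine integralPointsDense_of_family h
    (IsPullback.of_hasPullback 𝒢.hom (specMap (OS K S) K))
    (orbit.left ≫ Limits.pullback.fst _ _) ?_ (fun n ↦ (g ^ n).left) (fun n ↦ Over.w (g ^ n)) ?_
    (fun n ↦ (Y n).left) hYfst ?_ P₀ ?_
  · have h₁ := Limits.pullback.condition (f := (openComplement 𝒟).ι ≫ π) (g := specMap (OS K S) K)
    have h₂ := Limits.pullback.condition (f := 𝒢.hom) (g := specMap (OS K S) K)
    refine (Category.assoc _ _ _).trans ((congrArg (orbit.left ≫ ·) h₁).trans ?_)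
    refine (Category.assoc _ _ _).symm.trans (Eq.trans ?_ h₂.symm)
    exact congrArg (· ≫ specMap (OS K S) K) (Over.w orbit)
  · intro p c hc
    obtain ⟨k, hk, hk'⟩ := exists_pow_eq_one 𝒢 (finite_quotient_OS K S) g p hc
    refine ⟨k, hk, fun n ↦ ?_⟩
    have h₁ : toBase (localRing (OS K S) K p ⧸ Ideal.span {c}) ≫ g ^ (k * n) =
        toBase (localRing (OS K S) K p ⧸ Ideal.span {c}) ≫ g ^ 0 := by
      rw [pow_mul, MonObj.comp_pow, hk', one_pow, pow_zero, MonObj.comp_one]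
    exact congr(($h₁).left)
  -- The action is simply transitive, so equal translates force `g ^ n = g ^ m` over `K`. A power of
  -- `g` is then generically trivial, hence torsion, against the choice of `g`.
  · intro n m hnm
    have hmono := mono_fst (IsPullback.of_hasPullback ((openComplement 𝒟).ι ≫ π) (specMap (OS K S) K))
    have h₁ : Y n ≫ orbit = Y m ≫ orbit := by
      refine Over.OverMorphism.ext ((cancel_mono (Limits.pullback.fst ((openComplement 𝒟).ι ≫ π)
        (specMap (OS K S) K))).mp ?_)
      rw [Over.comp_left, Over.comp_left, Category.assoc, Category.assoc]
      exact hnm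
    rw [hYo, hYo] at h₁
    have h₂ : Y n = Y m := by
      rw [← cancel_mono e.hom]
      exact (hiso _ x₀ _).unique h₁ rfl
    have h₃ : specMap (OS K S) K ≫ (g ^ n).left = specMap (OS K S) K ≫ (g ^ m).left := by
      rw [← hYfst, ← hYfst, h₂]
    have h₄ : toBase K ≫ g ^ n = toBase K ≫ g ^ m := Over.OverMorphism.ext h₃
    rw [MonObj.comp_pow, MonObj.comp_pow] at h₄
    by_contra hne
    obtain ⟨d, hd, hd'⟩ : ∃ d > 0, (toBase K ≫ g) ^ d = 1 := by
      obtain hlt | hlt := lt_or_gt_of_ne hne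
      · exact ⟨m - n, by lia, by rw [pow_sub _ hlt.le, ← h₄, mul_inv_cancel]⟩
      · exact ⟨n - m, by lia, by rw [pow_sub _ hlt.le, h₄, mul_inv_cancel]⟩
    rw [← MonObj.comp_pow] at hd'
    obtain ⟨j, hj, hj'⟩ := exists_pow_eq_one_of_generic 𝒢 (finite_quotient_OS K S) _ hd'
    rw [← pow_mul] at hj'
    exact hg _ (Nat.mul_pos hd hj) hj'
  · have h₁ : Y 0 ≫ orbit = x₀ := by rw [hYo, hY0, one_smul]
    have h₂ : (Y 0).left ≫ orbit.left = x₀.left := congr(($h₁).left)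
    rw [← Category.assoc, h₂]
    exact (Limits.pullback.lift_fst _ _ _).symm

end Lift

end ConicPoints

end

/-! ### Integral evaluations of a form of the Laurent polynomial ring -/

noncomputable section

namespace ConicPoints

section Laurent

lemma LaurentPolynomial.ringHom_ext {k B : Type*} [CommRing k] [CommRing B] {f g : k[T;T⁻¹] →+* B}
    (hC : ∀ c, f (LaurentPolynomial.C c) = g (LaurentPolynomial.C c))
    (hT : f (LaurentPolynomial.T 1) = g (LaurentPolynomial.T 1)) : f = g := by
  refine IsLocalization.ringHom_ext (Submonoid.powers (Polynomial.X : Polynomial k)) ?_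
  refine Polynomial.ringHom_ext (fun c ↦ ?_) ?_
  · simpa [LaurentPolynomial.algebraMap_eq_toLaurent] using hC c
  · simpa [LaurentPolynomial.algebraMap_eq_toLaurent] using hT

/-- The units of the ring of Laurent polynomials over a field are the nonzero monomials. -/
lemma LaurentPolynomial.exists_eq_of_isUnit {k : Type*} [Field k] {f : k[T;T⁻¹]} (hf : IsUnit f) :
    ∃ c ≠ 0, ∃ n : ℤ, f = LaurentPolynomial.C c * LaurentPolynomial.T n := by
  obtain ⟨g, hg⟩ := hf.exists_right_inv
  obtain ⟨n, F, hF⟩ := LaurentPolynomial.exists_T_pow f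
  obtain ⟨m, G, hG⟩ := LaurentPolynomial.exists_T_pow g
  have hFG : F * G = Polynomial.X ^ (n + m) := by
    apply Polynomial.toLaurent_injective
    rw [map_mul, hF, hG, Polynomial.toLaurent_X_pow, Nat.cast_add, LaurentPolynomial.T_add,
      mul_mul_mul_comm, hg, one_mul]
  obtain ⟨i, -, u, hu⟩ := (dvd_prime_pow Polynomial.prime_X (n + m)).mp ⟨G, hFG.symm⟩
  obtain ⟨c, hc, hcu⟩ := Polynomial.isUnit_iff.mp u.isUnit
  have hc0 : c ≠ 0 := hc.ne_zero
  refine ⟨c⁻¹, inv_ne_zero hc0, i - n, ?_⟩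
  have h₁ : Polynomial.toLaurent F * LaurentPolynomial.C c = LaurentPolynomial.T i := by
    rw [← Polynomial.toLaurent_C, ← map_mul, hcu, hu, Polynomial.toLaurent_X_pow]
  rw [LaurentPolynomial.T_sub, ← h₁, hF]
  have h₂ : (LaurentPolynomial.T n : k[T;T⁻¹]) * LaurentPolynomial.T (-n) = 1 := by
    rw [← LaurentPolynomial.T_add, add_neg_cancel, LaurentPolynomial.T_zero]
  have h₃ : (LaurentPolynomial.C c⁻¹ : k[T;T⁻¹]) * LaurentPolynomial.C c = 1 := by
    rw [← map_mul, inv_mul_cancel₀ hc0, map_one]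
  calc f = f * (LaurentPolynomial.T n * LaurentPolynomial.T (-n)) *
        (LaurentPolynomial.C c⁻¹ * LaurentPolynomial.C c) := by rw [h₂, h₃, mul_one, mul_one]
    _ = _ := by ring

/-- The variable of the ring of Laurent polynomials, as a unit. -/
def laurentUnit (k : Type*) [CommRing k] : k[T;T⁻¹]ˣ where
  val := LaurentPolynomial.T 1
  inv := LaurentPolynomial.T (-1)
  val_inv := by rw [← LaurentPolynomial.T_add]; rfl
  inv_val := by rw [← LaurentPolynomial.T_add]; rfl

lemma val_laurentUnit_zpow (k : Type*) [CommRing k] (n : ℤ) :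
    ((laurentUnit k ^ n : k[T;T⁻¹]ˣ) : k[T;T⁻¹]) = LaurentPolynomial.T n := by
  obtain ⟨n, rfl | rfl⟩ := n.eq_nat_or_neg
  · rw [zpow_natCast, Units.val_pow_eq_pow_val]
    change LaurentPolynomial.T 1 ^ n = _
    rw [LaurentPolynomial.T_pow, mul_one]
  · rw [zpow_neg, ← inv_zpow, zpow_natCast, Units.val_pow_eq_pow_val]
    change LaurentPolynomial.T (-1) ^ n = _
    rw [LaurentPolynomial.T_pow, mul_neg_one]

end Laurent

section Congruence

variable {R k : Type*} [CommRing R] [Field k] [Algebra R k]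

/-- An integral unit has a power that is congruent to one modulo a given element of the base. -/
lemma exists_pow_sub_one_mem (hR : ∀ c : R, c ≠ 0 → Finite (R ⧸ Ideal.span {c}))
    (ε : (integralClosure R k)ˣ) (c : R) (hc : c ≠ 0) :
    ∃ n > 0, ∃ y, (ε : integralClosure R k) ^ n - 1 = algebraMap R _ c * y := by
  have hint : IsIntegral R ((ε : integralClosure R k)) :=
    (isIntegral_algebraMap_iff (B := k) Subtype.val_injective).mp ε.1.2
  -- The integral closure may be infinite over `R`, but `R[ε]` is a finite module, so its reduction
  -- modulo `c` is finite and two powers of `ε` coincide in it.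
  let E := Algebra.adjoin R {(ε : integralClosure R k)}
  have hE : Module.Finite R E := Module.Finite.iff_fg.mpr hint.fg_adjoin_singleton
  have := hR c hc
  have hfin : Finite (E ⧸ (Ideal.span {c} • (⊤ : Submodule R E))) :=
    Submodule.finite_quotient_smul _ Module.Finite.fg_top
  let e : E := ⟨ε, Algebra.self_mem_adjoin_singleton R _⟩
  obtain ⟨i, j, hij, h⟩ := Finite.exists_ne_map_eq_of_infinite fun n : ℕ ↦
    (Submodule.Quotient.mk (e ^ n) : E ⧸ (Ideal.span {c} • (⊤ : Submodule R E)))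
  wlog hlt : i < j generalizing i j
  · exact this j i hij.symm h.symm (by lia)
  rw [eq_comm, Submodule.Quotient.eq, Submodule.ideal_span_singleton_smul,
    Submodule.mem_smul_pointwise_iff_exists] at h
  obtain ⟨z, -, hz⟩ := h
  have hz' : algebraMap R (integralClosure R k) c * z.1 = (ε : integralClosure R k) ^ j - ε ^ i := by
    rw [← Algebra.smul_def]
    exact congrArg Subtype.val hz
  refine ⟨j - i, by lia, (ε⁻¹ ^ i : (integralClosure R k)ˣ) * z.1, ?_⟩
  have h₁ : ((ε⁻¹ ^ i : (integralClosure R k)ˣ) : integralClosure R k) * (ε : integralClosure R k) ^ i = 1 := by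
    rw [inv_pow, ← Units.val_pow_eq_pow_val, Units.inv_mul]
  calc (ε : integralClosure R k) ^ (j - i) - 1 =
      ((ε⁻¹ ^ i : (integralClosure R k)ˣ) * (ε : integralClosure R k) ^ i) * (ε ^ (j - i) - 1) := by
        rw [h₁, one_mul]
    _ = (ε⁻¹ ^ i : (integralClosure R k)ˣ) * (ε ^ (i + (j - i)) - ε ^ i) := by ring
    _ = (ε⁻¹ ^ i : (integralClosure R k)ˣ) * (algebraMap R _ c * z.1) := by
        rw [Nat.add_sub_cancel' hlt.le, hz']
    _ = _ := by ring

end Congruence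

section Integral

variable {R K k : Type u} [CommRing R] [Field K] [Algebra R K] [Field k] [Algebra K k]
  [Algebra R k] [IsScalarTower R K k]

/-- The Laurent polynomials in `t⁻¹ T` with integral coefficients. -/
def integralLaurent (R : Type u) {k : Type u} [CommRing R] [Field k] [Algebra R k] (t : kˣ) :
    (integralClosure R k)[T;T⁻¹] →+* k[T;T⁻¹] :=
  LaurentPolynomial.eval₂ (LaurentPolynomial.C.comp (algebraMap (integralClosure R k) k))
    (Units.map (LaurentPolynomial.C (R := k)).toMonoidHom t⁻¹ * laurentUnit k)

/-- At `T = t ε` the variable `t⁻¹ T` takes the integral unit value `ε`, so the values are integral.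
-/
lemma eval₂_integralLaurent (t : kˣ) (ε : (integralClosure R k)ˣ) (f : (integralClosure R k)[T;T⁻¹]) :
    LaurentPolynomial.eval₂ (RingHom.id k) (t * Units.map (algebraMap (integralClosure R k) k) ε)
      (integralLaurent R t f) =
    algebraMap _ k (LaurentPolynomial.eval₂ (RingHom.id (integralClosure R k)) ε f) := by
  refine congr($(LaurentPolynomial.ringHom_ext
    (f := (LaurentPolynomial.eval₂ (RingHom.id k) _).comp (integralLaurent R t))
    (g := (algebraMap _ k).comp (LaurentPolynomial.eval₂ (RingHom.id _) ε)) (fun c ↦ ?_) ?_) f)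
  · simp [integralLaurent]
  · simp [integralLaurent, laurentUnit]

/-- A term `a T ^ n` is `(a t ^ n) (t⁻¹ T) ^ n`, and the algebraic coefficient `a t ^ n` has an
integral multiple. -/
lemma exists_mul_mem_range_integralLaurent [IsDomain R] [FaithfulSMul R k] [Algebra.IsAlgebraic R k]
    (t : kˣ) (f : k[T;T⁻¹]) :
    ∃ r : R, r ≠ 0 ∧ LaurentPolynomial.C (algebraMap R k r) * f ∈ (integralLaurent R t).range := by
  have hC (x : integralClosure R k) : integralLaurent R t (LaurentPolynomial.C x) =
      LaurentPolynomial.C (x : k) := by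
    simp [integralLaurent]
  induction f using LaurentPolynomial.induction_on' with
  | add p q hp hq =>
    obtain ⟨r, hr, f, hf⟩ := hp
    obtain ⟨s, hs, g, hg⟩ := hq
    refine ⟨r * s, mul_ne_zero hr hs, LaurentPolynomial.C (algebraMap R _ s) * f +
      LaurentPolynomial.C (algebraMap R _ r) * g, ?_⟩
    rw [map_add, map_mul, map_mul, hf, hg, hC, hC, map_mul, map_mul]
    change LaurentPolynomial.C (algebraMap R k s) * _ + LaurentPolynomial.C (algebraMap R k r) * _ = _
    ring
  | C_mul_T n a =>
    obtain ⟨r, hr, hra⟩ := (Algebra.IsAlgebraic.isAlgebraic (R := R) (a * (t ^ n : kˣ))).exists_integral_multiple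
    refine ⟨r, hr, LaurentPolynomial.C ⟨_, hra⟩ * LaurentPolynomial.T n, ?_⟩
    have hT : integralLaurent R t (LaurentPolynomial.T n) =
        LaurentPolynomial.C (((t⁻¹) ^ n : kˣ) : k) * LaurentPolynomial.T n := by
      rw [integralLaurent, LaurentPolynomial.eval₂_T, mul_zpow, Units.val_mul, val_laurentUnit_zpow, ← map_zpow]
      rfl
    rw [map_mul, hC, hT, ← mul_assoc, ← map_mul, ← mul_assoc, ← map_mul]
    congr 2
    change r • (a * ((t ^ n : kˣ) : k)) * _ = _
    rw [Algebra.smul_def, mul_assoc, mul_assoc, ← Units.val_mul, ← mul_zpow, mul_inv_cancel, one_zpow,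
      Units.val_one, mul_one]

lemma exists_algHom_of_mem_range {A : Type*} [CommRing A] [Algebra R A]
    (h : Function.Injective (algebraMap R K)) (F : A →ₐ[R] K)
    (hF : ∀ a, ∃ x, algebraMap R K x = F a) : ∃ G : A →ₐ[R] R, ∀ a, algebraMap R K (G a) = F a := by
  choose G hG using hF
  refine ⟨AlgHom.mk ⟨⟨⟨G, h ?_⟩, fun a b ↦ h ?_⟩, h ?_, fun a b ↦ h ?_⟩ fun r ↦ h ?_, hG⟩ <;>
    simp [hG]

/-- Divisibility in an integrally closed domain can be checked in an integral closure. -/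
lemma dvd_of_integralClosure [IsDomain R] [IsFractionRing R K] [IsIntegrallyClosed R] {c d : R} (hc : c ≠ 0)
    (y : integralClosure R k) (h : algebraMap R k d = algebraMap R k c * y) : c ∣ d := by
  have hinj : Function.Injective (algebraMap K k) := (algebraMap K k).injective
  have hc' : algebraMap R K c ≠ 0 := by
    rwa [Ne, map_eq_zero_iff _ (IsFractionRing.injective R K)]
  have h₁ : algebraMap K k (algebraMap R K d / algebraMap R K c) = y := by
    rw [map_div₀, ← IsScalarTower.algebraMap_apply, ← IsScalarTower.algebraMap_apply, h,
      mul_div_cancel_left₀]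
    rwa [IsScalarTower.algebraMap_apply R K k, map_ne_zero]
  have h₂ : IsIntegral R (algebraMap R K d / algebraMap R K c) := by
    rw [← isIntegral_algebraMap_iff hinj, h₁]
    exact y.2
  obtain ⟨x, hx⟩ := IsIntegrallyClosed.isIntegral_iff.mp h₂
  refine ⟨x, IsFractionRing.injective R K ?_⟩
  rw [map_mul, hx, mul_div_cancel₀ _ hc']

end Integral

section Family

variable {R K k A : Type u} [CommRing R] [IsDomain R] [Field K] [Algebra R K] [IsFractionRing R K]
  [IsIntegrallyClosed R] [Field k] [Algebra K k] [IsGalois K k] [Algebra R k] [IsScalarTower R K k]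
  [CommRing A] [Algebra K A] [Algebra R A] [IsScalarTower R K A]

/-- Evaluating at the powers of a unit of infinite order which is compatible with the Galois action
on a form `A` of the ring of Laurent polynomials. -/
theorem exists_integral_family (hR : ∀ c : R, c ≠ 0 → Finite (R ⧸ Ideal.span {c}))
    (j : A →+* k[T;T⁻¹]) (hj : ∀ c : K, j (algebraMap K A c) = LaurentPolynomial.C (algebraMap K k c))
    (hgen : ∀ f g : k[T;T⁻¹] →+* k, (∀ a, f (j a) = g (j a)) →
      (∀ c, f (LaurentPolynomial.C c) = g (LaurentPolynomial.C c)) → f = g)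
    (κ₀ : A →ₐ[K] K) (κ : k[T;T⁻¹] →+* k) (hκC : ∀ c, κ (LaurentPolynomial.C c) = c)
    (hκj : ∀ a, κ (j a) = algebraMap K k (κ₀ a))
    (ε : (integralClosure R k)ˣ) (hε : ∀ n > 0, ε ^ n ≠ 1)
    (hα : ∀ σ : k ≃ₐ[K] k, ∃ α : k[T;T⁻¹] →+* k[T;T⁻¹], (∀ a, α (j a) = j a) ∧
      (∀ c, α (LaurentPolynomial.C c) = LaurentPolynomial.C (σ c)) ∧ ∃ c',
      (α (LaurentPolynomial.T 1) = LaurentPolynomial.C c' * LaurentPolynomial.T 1 ∧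
        σ (algebraMap _ k ε.1) = algebraMap _ k ε.1) ∨
      (α (LaurentPolynomial.T 1) = LaurentPolynomial.C c' * LaurentPolynomial.T (-1) ∧
        σ (algebraMap _ k ε.1) = algebraMap _ k (ε⁻¹).1)) :
    ∃ (B : Subalgebra R A) (ev : ℕ → A →ₐ[K] K) (evB : ℕ → B →ₐ[R] R),
      IsLocalization (Algebra.algebraMapSubmonoid B (nonZeroDivisors R)) A ∧
      Function.Injective ev ∧ ev 0 = κ₀ ∧ (∀ n b, algebraMap R K (evB n b) = ev n b) ∧
      ∀ c : R, c ≠ 0 → ∃ m > 0, ∀ n b, c ∣ evB (m * n) b - evB 0 b := by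
  let t : kˣ := Units.map κ.toMonoidHom (laurentUnit k)
  let e : kˣ := Units.map (algebraMap (integralClosure R k) k) ε
  -- The point `T = t ε ^ n`, where `t` is the coordinate of the base point `κ`.
  let E (n : ℕ) : k[T;T⁻¹] →+* k := LaurentPolynomial.eval₂ (RingHom.id k) (t * e ^ n)
  have hEC (n c) : E n (LaurentPolynomial.C c) = c := by simp [E]
  have hET (n) : E n (LaurentPolynomial.T 1) = t * e ^ n := by simp [E]
  have hET' (n) : E n (LaurentPolynomial.T (-1)) = t⁻¹ * e⁻¹ ^ n := by simp [E, mul_comm]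
  have hE0 : E 0 = κ := by
    refine LaurentPolynomial.ringHom_ext (fun c ↦ by rw [hEC, hκC]) ?_
    rw [hET, pow_zero, mul_one]
    rfl
  -- `E 0` intertwines `α` and `σ` because the base point is rational. Read at `T`, this says `σ t =
  -- c' t` or `σ t = c' t⁻¹`. As `σ` fixes or inverts `ε` accordingly, the same relation holds for
  -- `t ε ^ n`, so every `E n` is equivariant and takes values in `K` on the Galois-invariant ring
  -- `A`.
  have hσ (σ : k ≃ₐ[K] k) (n : ℕ) (a : A) : σ (E n (j a)) = E n (j a) := by
    obtain ⟨α, hα₁, hα₂, c', hα₃⟩ := hα σ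
    have h₀ : (σ : k →+* k).comp (E 0) = (E 0).comp α := by
      have h₁ := hgen (((σ.symm : k →+* k).comp (E 0)).comp α) (E 0) (fun a ↦ ?_) fun c ↦ ?_
      · refine RingHom.ext fun x ↦ (σ.symm_apply_eq.mp ?_).symm
        exact congr($h₁ x)
      · simp [hα₁, hE0, hκj]
      · simp [hα₂, hEC]
    have h₁ : (σ : k →+* k).comp (E n) = (E n).comp α := by
      refine LaurentPolynomial.ringHom_ext (fun c ↦ ?_) ?_
      · simp [hEC, hα₂]
      have h₂ : σ (E 0 (LaurentPolynomial.T 1)) = E 0 (α (LaurentPolynomial.T 1)) :=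
        congr($h₀ (LaurentPolynomial.T 1))
      change σ (E n (LaurentPolynomial.T 1)) = E n (α (LaurentPolynomial.T 1))
      rw [hET, pow_zero, mul_one] at h₂
      obtain ⟨h₃, h₄⟩ | ⟨h₃, h₄⟩ := hα₃
      · rw [h₃, map_mul, hEC, hET, pow_zero, mul_one] at h₂
        rw [h₃, map_mul, hEC, hET, map_mul, map_pow, h₂, show σ (e : k) = e from h₄, mul_assoc]
      · rw [h₃, map_mul, hEC, hET', pow_zero, mul_one] at h₂
        rw [h₃, map_mul, hEC, hET, hET', map_mul, map_pow, h₂,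
          show σ (e : k) = (e⁻¹ : kˣ) from h₄, mul_assoc, Units.val_inv_eq_inv_val e]
    have h₂ := congr($h₁ (j a))
    simpa [hα₁] using h₂
  let F (n : ℕ) : A →ₐ[K] k := AlgHom.mk ((E n).comp j) fun r ↦ by
    change E n (j _) = _
    rw [hj, hEC]
  have hF (n) := exists_algHom_of_mem_range (algebraMap K k).injective (F n) fun a ↦
    (InfiniteGalois.mem_range_algebraMap_iff_fixed _).mpr fun σ ↦ hσ σ n a
  choose ev hev using hF
  have hRA (r : R) : j (algebraMap R A r) = LaurentPolynomial.C (algebraMap R k r) := by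
    rw [IsScalarTower.algebraMap_apply R K A, hj, ← IsScalarTower.algebraMap_apply]
  -- The integral model of `A`: its elements are Laurent polynomials in `t⁻¹ T` with integral
  -- coefficients, so every `E n` sends them to integral elements of `K`, that is, to `R`.
  let B : Subalgebra R A := ⟨((integralLaurent R t).range.comap j).toSubsemiring, fun r ↦
    ⟨LaurentPolynomial.C (algebraMap R _ r), by
      rw [hRA]
      simp only [integralLaurent, LaurentPolynomial.eval₂_C]
      rfl⟩⟩
  have hB (b : B) : ∃ f, ∀ n, algebraMap K k (ev n b) =
      algebraMap (integralClosure R k) k (LaurentPolynomial.eval₂ (RingHom.id _) (ε ^ n) f) := by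
    obtain ⟨f, hf⟩ : j b ∈ (integralLaurent R t).range := b.2
    refine ⟨f, fun n ↦ ?_⟩
    rw [← eval₂_integralLaurent t, hf, hev, map_pow]
    rfl
  have hevB (n) := exists_algHom_of_mem_range (IsFractionRing.injective R K)
    (((ev n).restrictScalars R).comp B.val) fun b ↦ by
      obtain ⟨f, hf⟩ := hB b
      refine IsIntegrallyClosed.isIntegral_iff.mp ?_
      rw [← isIntegral_algebraMap_iff (B := k) (algebraMap K k).injective]
      exact hf n ▸ Subtype.property _
  choose evB hevB using hevB
  have hinjR : Function.Injective (algebraMap R k) := by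
    rw [IsScalarTower.algebraMap_eq R K k]
    exact (algebraMap K k).injective.comp (IsFractionRing.injective R K)
  refine ⟨B, ev, evB, ⟨?_, ?_, ?_⟩, ?_, ?_, hevB, ?_⟩
  · rintro ⟨_, r, hr, rfl⟩
    change IsUnit (algebraMap R A r)
    rw [IsScalarTower.algebraMap_apply R K A]
    refine (IsUnit.mk0 _ ?_).map _
    rw [Ne, map_eq_zero_iff _ (IsFractionRing.injective R K)]
    exact nonZeroDivisors.ne_zero hr
  · intro a
    have : FaithfulSMul R k := (faithfulSMul_iff_algebraMap_injective R k).mpr hinjR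
    have : Algebra.IsAlgebraic R k := (IsFractionRing.comap_isAlgebraic_iff (K := K)).mpr inferInstance
    obtain ⟨r, hr, hra⟩ := exists_mul_mem_range_integralLaurent (R := R) t (j a)
    refine ⟨⟨⟨algebraMap R A r * a, ?_⟩, ⟨_, r, mem_nonZeroDivisors_of_ne_zero hr, rfl⟩⟩, mul_comm _ _⟩
    change j _ ∈ (integralLaurent R t).range
    rwa [map_mul, hRA]
  · intro x y hxy
    exact ⟨1, by rw [Subtype.ext hxy]⟩
  · intro n m hnm
    have h₁ : E n = E m := hgen _ _ (fun a ↦ by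
      change F n a = F m a
      rw [← hev, ← hev, hnm]) fun c ↦ by rw [hEC, hEC]
    have h₂ : ε ^ n = ε ^ m := by
      have h₃ := congr($h₁ (LaurentPolynomial.T 1))
      rw [hET, hET] at h₃
      have h₄ : ((ε ^ n : (integralClosure R k)ˣ) : integralClosure R k).1 = (ε ^ m : (integralClosure R k)ˣ) := by
        simpa [e] using h₃
      exact Units.ext (Subtype.ext h₄)
    by_contra hne
    wlog hlt : n < m generalizing n m
    · exact this hnm.symm h₁.symm h₂.symm (Ne.symm hne) (by lia)
    exact hε (m - n) (by lia) (by rw [pow_sub _ hlt.le, ← h₂, mul_inv_cancel])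
  · ext a
    apply (algebraMap K k).injective
    rw [hev, ← hκj, ← hE0]
    rfl
  · intro c hc
    obtain ⟨m, hm, y, hy⟩ := exists_pow_sub_one_mem hR ε c hc
    refine ⟨m, hm, fun n b ↦ ?_⟩
    obtain ⟨f, hf⟩ := hB b
    let I := Ideal.span {algebraMap R (integralClosure R k) c}
    have h₁ : Ideal.Quotient.mk I ε.1 ^ m = 1 := by
      rw [← map_pow, ← map_one (Ideal.Quotient.mk I), Ideal.Quotient.eq, hy]
      exact Ideal.mul_mem_right _ _ (Ideal.mem_span_singleton_self _)
    -- With `ε ^ m = 1` modulo `c`, evaluation at `ε ^ (m * n)` and at `1` coincide modulo `c`.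
    have h₂ : (Ideal.Quotient.mk I).comp (LaurentPolynomial.eval₂ (RingHom.id _) (ε ^ (m * n))) =
        (Ideal.Quotient.mk I).comp (LaurentPolynomial.eval₂ (RingHom.id _) (ε ^ 0)) := by
      refine LaurentPolynomial.ringHom_ext (fun c ↦ by simp) ?_
      simp [pow_mul, h₁]
    obtain ⟨z, hz⟩ := Ideal.mem_span_singleton.mp (Ideal.Quotient.eq.mp congr($h₂ f))
    refine dvd_of_integralClosure (K := K) hc z ?_
    rw [map_sub, IsScalarTower.algebraMap_apply R K k, hevB, IsScalarTower.algebraMap_apply R K k, hevB]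
    change algebraMap K k (ev _ b) - algebraMap K k (ev _ b) = _
    rw [hf, hf, ← map_sub, hz, map_mul]
    rfl

end Family

end ConicPoints

end

/-! ### Galois action on the torus chart -/

noncomputable section

namespace ConicPoints

section Laurent

/-- A semilinear endomorphism of the ring of Laurent polynomials with a semilinear left inverse
maps the variable to a multiple of itself or of its inverse. -/
lemma LaurentPolynomial.map_T_of_leftInverse {k : Type*} [Field k] (α β : k[T;T⁻¹] →+* k[T;T⁻¹])
    (hβ : ∀ c, ∃ d, β (LaurentPolynomial.C c) = LaurentPolynomial.C d) (h : ∀ f, β (α f) = f) :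
    ∃ c ≠ 0, α (LaurentPolynomial.T 1) = LaurentPolynomial.C c * LaurentPolynomial.T 1 ∨
      α (LaurentPolynomial.T 1) = LaurentPolynomial.C c * LaurentPolynomial.T (-1) := by
  obtain ⟨c, hc, n, hα⟩ := LaurentPolynomial.exists_eq_of_isUnit ((LaurentPolynomial.isUnit_T 1).map α)
  obtain ⟨d, hd, m, hβ'⟩ := LaurentPolynomial.exists_eq_of_isUnit ((LaurentPolynomial.isUnit_T 1).map β)
  obtain ⟨c', hc'⟩ := hβ c
  have hu : Units.map β.toMonoidHom (laurentUnit k) =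
      Units.map (LaurentPolynomial.C (R := k)).toMonoidHom (Units.mk0 d hd) * laurentUnit k ^ m := by
    refine Units.ext ?_
    rw [Units.val_mul, val_laurentUnit_zpow]
    exact hβ'
  have hn : β (LaurentPolynomial.T n) =
      LaurentPolynomial.C ((Units.mk0 d hd ^ n : kˣ) : k) * LaurentPolynomial.T (m * n) := by
    rw [← val_laurentUnit_zpow, ← val_laurentUnit_zpow, zpow_mul]
    have := congrArg Units.val (congrArg (· ^ n) hu)
    simp only [mul_zpow, ← map_zpow] at this
    exact this
  have h₁ := h (LaurentPolynomial.T 1)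
  rw [hα, map_mul, hc', hn, ← mul_assoc, ← map_mul] at h₁
  have h₂ : c' * ((Units.mk0 d hd ^ n : kˣ) : k) ≠ 0 := by
    intro h₀
    rw [h₀, map_zero, zero_mul] at h₁
    exact (LaurentPolynomial.isUnit_T (R := k) 1).ne_zero h₁.symm
  -- The two maps multiply exponents by `n` and `m`; since one inverts the other, `n * m = 1`.
  have h₃ := congrArg LaurentPolynomial.degree h₁
  rw [LaurentPolynomial.degree_C_mul_T _ _ h₂, LaurentPolynomial.degree_T] at h₃
  have h₄ : n * m = 1 := by
    rw [mul_comm]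
    exact_mod_cast h₃
  refine ⟨c, hc, ?_⟩
  obtain rfl | rfl := Int.isUnit_iff.mp (IsUnit.of_mul_eq_one m h₄)
  · exact .inl hα
  · exact .inr hα

end Laurent

lemma VanishesAt.mul {B B₀ : Type u} [CommRing B] [CommRing B₀] {X : Scheme.{u}}
    {e : Spec (.of B) ⟶ X} {t : B} {p : X} (h : VanishesAt e t p) (l : X ⟶ Spec (.of B₀))
    (θ : B₀ →+* B) (hl : e ≫ l = Spec.map (CommRingCat.ofHom θ)) (c : B₀) :
    VanishesAt e (θ c * t) p := by
  obtain ⟨N, j, _, n, s, rfl, hs, H⟩ := h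
  refine ⟨N, j, inferInstance, n, globalMap (j ≫ l) c * s, rfl, ?_, fun Z a b hab ↦ ?_⟩
  · rw [Scheme.basicOpen_mul]
    exact fun h ↦ hs h.2
  · rw [map_mul, map_mul, H Z a b hab, ← globalMap_comp, ← globalMap_comp_map, ← hl, ← Category.assoc,
      hab, Category.assoc]

section Chart

attribute [local instance] MvPolynomial.gradedAlgebra

variable {R K : Type u} [CommRing R] [Field K] [Algebra R K]

/-- The action of an automorphism of `k` on `Spec k`. -/
abbrev specAut {k : Type u} [Field k] [Algebra K k] (σ : k ≃ₐ[K] k) : Spec (.of k) ⟶ Spec (.of k) :=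
  Spec.map (CommRingCat.ofHom (σ : k →+* k))

lemma specAut_specMap {k : Type u} [Field k] [Algebra K k] (σ : k ≃ₐ[K] k) :
    specAut σ ≫ specMap K k = specMap K k := by
  rw [← Spec.map_comp, ← CommRingCat.ofHom_comp]
  congr 2
  ext x
  simp

lemma specAut_symm_comp {k : Type u} [Field k] [Algebra K k] (σ : k ≃ₐ[K] k) :
    specAut σ.symm ≫ specAut σ = 𝟙 _ := by
  rw [← Spec.map_comp, ← CommRingCat.ofHom_comp, ← Spec.map_id]
  congr 1
  ext x
  simp

lemma specAut_comp_symm {k : Type u} [Field k] [Algebra K k] (σ : k ≃ₐ[K] k) :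
    specAut σ ≫ specAut σ.symm = 𝟙 _ := specAut_symm_comp σ.symm

/-- The semilinear action on a base change. -/
def baseAut {k : Type u} [Field k] [Algebra K k] {X P : Scheme.{u}} {x : X ⟶ Spec (.of R)}
    {Q : P ⟶ X} {l : P ⟶ Spec (.of k)} (hp : IsPullback Q l x (specMap K k ≫ specMap R K))
    (σ : k ≃ₐ[K] k) : P ⟶ P :=
  hp.lift Q (l ≫ specAut σ) (by
    rw [hp.w, Category.assoc, ← Category.assoc (specAut σ), specAut_specMap])

section

variable {k : Type u} [Field k] [Algebra K k] {X P : Scheme.{u}} {x : X ⟶ Spec (.of R)}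
    {Q : P ⟶ X} {l : P ⟶ Spec (.of k)} (hp : IsPullback Q l x (specMap K k ≫ specMap R K))
    (σ : k ≃ₐ[K] k)

lemma baseAut_fst : baseAut hp σ ≫ Q = Q := hp.lift_fst _ _ _

lemma baseAut_snd : baseAut hp σ ≫ l = l ≫ specAut σ := hp.lift_snd _ _ _

lemma baseAut_symm_comp : baseAut hp σ.symm ≫ baseAut hp σ = 𝟙 _ := by
  refine hp.hom_ext ?_ ?_
  · rw [Category.assoc, baseAut_fst, baseAut_fst, Category.id_comp]
  · rw [Category.assoc, baseAut_snd, ← Category.assoc, baseAut_snd, Category.assoc, specAut_symm_comp,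
      Category.comp_id, Category.id_comp]

/-- The semilinear action on a base change, as an isomorphism. -/
def baseAutIso : P ≅ P where
  hom := baseAut hp σ
  inv := baseAut hp σ.symm
  hom_inv_id := baseAut_symm_comp hp σ.symm
  inv_hom_id := baseAut_symm_comp hp σ

end

/-- Units of Laurent polynomials are monomials, so `σ` sends `T` to a multiple of `T` or `T⁻¹`.
Which of the two is decided by the zero of its image: `T` vanishes at the point over `d₀`, and `T⁻¹`
at the one over `d₁`. -/
theorem exists_torus_chart {𝒳 : Scheme.{u}} {π : 𝒳 ⟶ Spec (.of R)}
    {k : Type u} [Field k] [IsAlgClosed k] [Algebra K k] {Q : Proj (lineGrading k) ⟶ 𝒳}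
    [LocallyOfFiniteType (lineStr k)]
    (hp : IsPullback Q (lineStr k) π (specMap K k ≫ specMap R K)) (W : 𝒳.Opens)
    (d₀ d₁ : Spec (.of k) ⟶ 𝒳) (hd₀ : d₀ ≫ π = specMap K k ≫ specMap R K)
    (hd₁ : d₁ ≫ π = specMap K k ≫ specMap R K) (hne : d₀ ≠ d₁)
    (hW : ∀ p, Q p ∉ W ↔ ∃ x : Spec (.of k) ⟶ Proj (lineGrading k), x ≫ lineStr k = 𝟙 _ ∧
      x (fieldPt k) = p ∧ (x ≫ Q = d₀ ∨ x ≫ Q = d₁)) :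
    ∃ q : Spec (.of k[T;T⁻¹]) ⟶ W.toScheme,
      IsPullback q (specMap k k[T;T⁻¹]) (W.ι ≫ π) (specMap K k ≫ specMap R K) ∧
      ∀ σ : k ≃ₐ[K] k, ∃ α : k[T;T⁻¹] →+* k[T;T⁻¹], Spec.map (CommRingCat.ofHom α) ≫ q = q ∧
        (∀ c, α (LaurentPolynomial.C c) = LaurentPolynomial.C (σ c)) ∧ ∃ c,
        (specAut σ ≫ d₀ = d₀ → α (LaurentPolynomial.T 1) = LaurentPolynomial.C c * LaurentPolynomial.T 1) ∧
        (specAut σ ≫ d₀ = d₁ → α (LaurentPolynomial.T 1) = LaurentPolynomial.C c * LaurentPolynomial.T (-1)) := by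
  let x₀ := hp.lift d₀ (𝟙 _) (by rw [hd₀, Category.id_comp])
  let x₁ := hp.lift d₁ (𝟙 _) (by rw [hd₁, Category.id_comp])
  have hx₀ : x₀ ≫ lineStr k = 𝟙 _ := hp.lift_snd _ _ _
  have hx₁ : x₁ ≫ lineStr k = 𝟙 _ := hp.lift_snd _ _ _
  have hQ₀ : x₀ ≫ Q = d₀ := hp.lift_fst _ _ _
  have hQ₁ : x₁ ≫ Q = d₁ := hp.lift_fst _ _ _
  have hx (x : Spec (.of k) ⟶ Proj (lineGrading k)) (hx : x ≫ lineStr k = 𝟙 _) (i) (hi : x ≫ Q = i ≫ Q)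
      (hi' : i ≫ lineStr k = 𝟙 _) : x = i := hp.hom_ext hi (hx.trans hi'.symm)
  have hxne : x₀ (fieldPt k) ≠ x₁ (fieldPt k) := by
    intro h
    have h₁ : x₀ = x₁ := ext_of_apply_closedPoint_eq (lineStr k) hx₀ hx₁ h
    exact hne (by rw [← hQ₀, h₁, hQ₁])
  obtain ⟨e, _, he, hr, hv₀, hv₁⟩ := exists_lineChart x₀ x₁ hx₀ hx₁ hxne
  have hre : e.opensRange = Q ⁻¹ᵁ W := by
    ext p
    change p ∈ Set.range e ↔ Q p ∈ W
    rw [hr, Set.mem_compl_iff, ← not_iff_not, not_not, hW, Set.mem_insert_iff, Set.mem_singleton_iff]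
    constructor
    · rintro (rfl | rfl)
      · exact ⟨x₀, hx₀, rfl, .inl hQ₀⟩
      · exact ⟨x₁, hx₁, rfl, .inr hQ₁⟩
    · rintro ⟨x, hx', rfl, h | h⟩
      · exact .inl (by rw [hx x hx' x₀ (h.trans hQ₀.symm) hx₀])
      · exact .inr (by rw [hx x hx' x₁ (h.trans hQ₁.symm) hx₁])
  let q : Spec (.of k[T;T⁻¹]) ⟶ W.toScheme := IsOpenImmersion.lift W.ι (e ≫ Q) (by
    rw [Scheme.Opens.range_ι]
    rintro _ ⟨p, rfl⟩
    have : e p ∈ Q ⁻¹ᵁ W := hre ▸ (⟨p, rfl⟩ : e p ∈ e.opensRange)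
    exact this)
  have hq : q ≫ W.ι = e ≫ Q := IsOpenImmersion.lift_fac _ _ _
  have hpq : IsPullback q (specMap k k[T;T⁻¹]) (W.ι ≫ π) (specMap K k ≫ specMap R K) := by
    rw [← he]
    exact (IsOpenImmersion.isPullback q e W.ι Q hq.symm
      (by rw [hre, Scheme.Opens.opensRange_ι])).paste_vert hp
  refine ⟨q, hpq, fun σ ↦ ?_⟩
  have hα (σ : k ≃ₐ[K] k) : ∃ α : k[T;T⁻¹] →+* k[T;T⁻¹],
      Spec.map (CommRingCat.ofHom α) = baseAut hpq σ :=
    ⟨(Spec.preimage (baseAut hpq σ)).hom, by rw [CommRingCat.ofHom_hom, Spec.map_preimage]⟩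
  choose α hα using hα
  have hαC (σ : k ≃ₐ[K] k) (c : k) : α σ (LaurentPolynomial.C c) = LaurentPolynomial.C (σ c) := by
    have h₁ := baseAut_snd hpq σ
    rw [← hα, ← Spec.map_comp, ← Spec.map_comp] at h₁
    exact congr($(congrArg CommRingCat.Hom.hom (Spec.map_injective h₁)) c)
  have hαα (f) : α σ.symm (α σ f) = f := by
    have h₁ := baseAut_symm_comp hpq σ
    rw [← hα, ← hα, ← Spec.map_comp, ← Spec.map_id] at h₁
    exact congr($(congrArg CommRingCat.Hom.hom (Spec.map_injective h₁)) f)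
  have hαe : Spec.map (CommRingCat.ofHom (α σ)) ≫ e ≫ (baseAutIso hp σ.symm).hom = e := by
    refine hp.hom_ext ?_ ?_
    · rw [Category.assoc, Category.assoc]
      refine (congrArg (fun z ↦ _ ≫ e ≫ z) (baseAut_fst hp σ.symm)).trans ?_
      rw [← hq, hα, ← Category.assoc, baseAut_fst]
    · rw [Category.assoc, Category.assoc]
      refine (congrArg (fun z ↦ _ ≫ e ≫ z) (baseAut_snd hp σ.symm)).trans ?_
      rw [← Category.assoc e, he, hα, ← Category.assoc, baseAut_snd, Category.assoc,
        specAut_comp_symm, Category.comp_id]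
  -- Transport of structure: the image of `T` vanishes at the point of the line over the conjugate
  -- of `d₀`.
  have hv {d : Spec (.of k) ⟶ 𝒳} {x : Spec (.of k) ⟶ Proj (lineGrading k)} (hx : x ≫ lineStr k = 𝟙 _)
      (hxd : x ≫ Q = d) (hd : specAut σ ≫ d₀ = d) :
      VanishesAt e (α σ (LaurentPolynomial.T 1)) (x (fieldPt k)) := by
    have h₁ := hv₀.comp_iso (baseAutIso hp σ.symm) (α σ) hαe
    have h₂ : x₀ ≫ (baseAutIso hp σ.symm).hom = specAut σ.symm ≫ x := by
      refine hp.hom_ext ?_ ?_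
      · rw [Category.assoc, Category.assoc, hxd, ← hd, ← Category.assoc (specAut _), specAut_symm_comp,
          Category.id_comp]
        exact (congrArg (x₀ ≫ ·) (baseAut_fst hp σ.symm)).trans hQ₀
      · rw [Category.assoc, Category.assoc, hx, Category.comp_id]
        refine (congrArg (x₀ ≫ ·) (baseAut_snd hp σ.symm)).trans ?_
        rw [← Category.assoc, hx₀, Category.id_comp]
    have h₃ : (baseAutIso hp σ.symm).hom (x₀ (fieldPt k)) = x (fieldPt k) := by
      change (x₀ ≫ (baseAutIso hp σ.symm).hom) (fieldPt k) = _
      rw [h₂]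
      exact congrArg x (Subsingleton.elim (α := PrimeSpectrum k) _ _)
    rwa [h₃] at h₁
  have hscale {c : k} (hc : c ≠ 0) {t : k[T;T⁻¹]} {p} (h : VanishesAt e (LaurentPolynomial.C c * t) p) :
      VanishesAt e t p := by
    have h₁ := h.mul (lineStr k) LaurentPolynomial.C he c⁻¹
    rwa [← mul_assoc, ← map_mul, inv_mul_cancel₀ hc, map_one, one_mul] at h₁
  have hTT : (LaurentPolynomial.T 1 : k[T;T⁻¹]) * LaurentPolynomial.T (-1) = 1 :=
    (laurentUnit k).mul_inv
  obtain ⟨c, hc, h⟩ := LaurentPolynomial.map_T_of_leftInverse (α σ) (α σ.symm)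
    (fun c ↦ ⟨_, hαC _ c⟩) hαα
  refine ⟨α σ, (congrArg (· ≫ q) (hα σ)).trans (baseAut_fst hpq σ), hαC σ, c, fun h₀ ↦ ?_, fun h₁ ↦ ?_⟩
  · refine h.resolve_right fun h' ↦ ?_
    exact hv₀.not_of_mul_eq_one hTT (hscale hc (h' ▸ hv hx₀ hQ₀ h₀))
  · refine h.resolve_left fun h' ↦ ?_
    exact (hscale hc (h' ▸ hv hx₁ hQ₁ h₁)).not_of_mul_eq_one hTT hv₁

end Chart

end ConicPoints

end

/-! ### Descent of affineness and the family of points on the complement -/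

noncomputable section

namespace ConicPoints

section Affine

variable {K k : Type u} [Field K] [Field k] [Algebra K k]

lemma flat_specMap_field : Flat (specMap K k) := Flat.SpecMap_iff.mpr (by
  change (algebraMap K k).Flat
  rw [RingHom.flat_algebraMap_iff]
  infer_instance)

lemma surjective_specMap_field : Surjective (specMap K k) :=
  ⟨fun _ ↦ ⟨fieldPt k, Subsingleton.elim (α := PrimeSpectrum K) _ _⟩⟩

/-- Affineness descends along flat surjective morphisms of affine schemes. -/
lemma isAffine_of_isPullback {S T U V : Scheme.{u}} {q : V ⟶ U} {v : V ⟶ T} {x : U ⟶ S} {b : T ⟶ S}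
    (hp : IsPullback q v x b) [IsAffine S] [IsAffine T] [Flat b] [Surjective b] [QuasiCompact x]
    [QuasiSeparated x] [IsAffine V] : IsAffine U := by
  have : CompactSpace U := (quasiCompact_iff_compactSpace x).mp inferInstance
  have : QuasiSeparatedSpace U := (quasiSeparated_iff_quasiSeparatedSpace x).mp inferInstance
  -- By flat base change, global sections on `V` are those on `U` tensored up. So `V → Spec Γ(V)` is
  -- the base change of `U → Spec Γ(U)` along a flat surjective quasi-compact morphism, along which
  -- isomorphisms descend.
  have h₁ := (isIso_pushoutSection_iff hp (US := ⊤) (UT := ⊤) (UX := ⊤) (UY := ⊤) le_top le_top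
    (by simp)).mp (isIso_pushoutSection_of_isQuasiSeparated_of_flat_right hp _ _ _
    (isAffineOpen_top _) (isAffineOpen_top _) isCompact_univ isQuasiSeparated_univ)
  have happ {X Y : Scheme.{u}} (f : X ⟶ Y) : f.appLE ⊤ ⊤ le_top = f.appTop := Scheme.Hom.appLE_eq_app f
  rw [happ, happ, happ, happ] at h₁
  have h₂ := isPullback_SpecMap_of_isPushout _ _ _ _ h₁
  have hb : Spec.map b.appTop = T.isoSpec.inv ≫ b ≫ S.isoSpec.hom := by
    rw [Iso.eq_inv_comp]
    exact (Scheme.toSpecΓ_naturality b).symm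
  have : Surjective (Spec.map b.appTop) := hb ▸ inferInstance
  have : Flat (Spec.map b.appTop) := hb ▸ inferInstance
  have : Surjective (Spec.map q.appTop) :=
    MorphismProperty.of_isPullback (P := @Surjective) h₂.flip inferInstance
  have : Flat (Spec.map q.appTop) := MorphismProperty.of_isPullback (P := @Flat) h₂.flip inferInstance
  have hq : (@Surjective ⊓ @Flat ⊓ @QuasiCompact : MorphismProperty Scheme.{u}) (Spec.map q.appTop) :=
    ⟨⟨inferInstance, inferInstance⟩, inferInstance⟩
  have h₃ : IsPullback q V.toSpecΓ U.toSpecΓ (Spec.map q.appTop) := by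
    refine IsPullback.of_bot ?_ (Scheme.toSpecΓ_naturality q) h₂
    rw [← Scheme.toSpecΓ_naturality, ← Scheme.toSpecΓ_naturality]
    exact hp.paste_vert (IsPullback.of_vert_isIso ⟨Scheme.toSpecΓ_naturality b⟩)
  have h₄ : MorphismProperty.isomorphisms Scheme.{u} U.toSpecΓ :=
    MorphismProperty.of_isPullback_of_descendsAlong h₃.flip hq
      (inferInstanceAs (IsIso V.toSpecΓ))
  exact ⟨h₄⟩

end Affine

section Points

lemma ringHom_ext_of_specMap {B C : Type u} [CommRing B] [CommRing C] {f g : B →+* C}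
    (h : Spec.map (CommRingCat.ofHom f) = Spec.map (CommRingCat.ofHom g)) : f = g :=
  congrArg CommRingCat.Hom.hom (Spec.map_injective h)

lemma exists_ringHom_specMap {B C : Type u} [CommRing B] [CommRing C]
    (a : Spec (.of C) ⟶ Spec (.of B)) : ∃ f : B →+* C, Spec.map (CommRingCat.ofHom f) = a :=
  ⟨(Spec.preimage a).hom, by rw [CommRingCat.ofHom_hom, Spec.map_preimage]⟩

variable {R K k : Type u} [CommRing R] [IsDomain R] [Field K] [Algebra R K] [IsFractionRing R K]
  [IsIntegrallyClosed R] [Field k] [Algebra K k] [IsGalois K k] [Algebra R k] [IsScalarTower R K k]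

/-- The family of integral points of a model of a form of the punctured affine line. -/
theorem exists_family (hR : ∀ c : R, c ≠ 0 → Finite (R ⧸ Ideal.span {c}))
    {U : Scheme.{u}} {x : U ⟶ Spec (.of R)} [QuasiCompact x] [QuasiSeparated x]
    {q : Spec (.of k[T;T⁻¹]) ⟶ U}
    (hp : IsPullback q (specMap k k[T;T⁻¹]) x (specMap K k ≫ specMap R K))
    (P₀ : Spec (.of R) ⟶ U) (hP₀ : P₀ ≫ x = 𝟙 _)
    (ε : (integralClosure R k)ˣ) (hε : ∀ n > 0, ε ^ n ≠ 1)
    (hα : ∀ σ : k ≃ₐ[K] k, ∃ α : k[T;T⁻¹] →+* k[T;T⁻¹], Spec.map (CommRingCat.ofHom α) ≫ q = q ∧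
      (∀ c, α (LaurentPolynomial.C c) = LaurentPolynomial.C (σ c)) ∧ ∃ c',
      (α (LaurentPolynomial.T 1) = LaurentPolynomial.C c' * LaurentPolynomial.T 1 ∧
        σ (algebraMap _ k ε.1) = algebraMap _ k ε.1) ∨
      (α (LaurentPolynomial.T 1) = LaurentPolynomial.C c' * LaurentPolynomial.T (-1) ∧
        σ (algebraMap _ k ε.1) = algebraMap _ k (ε⁻¹).1)) :
    ∃ (T TK : Scheme.{u}) (τ : T ⟶ Spec (.of R)) (fst : TK ⟶ T) (snd : TK ⟶ Spec (.of K))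
      (_ : IsPullback fst snd τ (specMap R K)) (_ : QuasiCompact τ) (_ : QuasiSeparated τ)
      (φ : TK ⟶ U) (g : ℕ → (Spec (.of R) ⟶ T)) (y : ℕ → (Spec (.of K) ⟶ TK)),
      φ ≫ x = fst ≫ τ ∧ (∀ n, g n ≫ τ = 𝟙 _) ∧
      (∀ (p : PrimeSpectrum R) (c : localRing R K p), c ≠ 0 → ∃ m > 0, ∀ n,
        specMap R (localRing R K p ⧸ Ideal.span {c}) ≫ g (m * n) =
          specMap R (localRing R K p ⧸ Ideal.span {c}) ≫ g 0) ∧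
      (∀ n, y n ≫ fst = specMap R K ≫ g n) ∧ (Function.Injective fun n ↦ y n ≫ φ) ∧
      specMap R K ≫ P₀ = y 0 ≫ φ := by
  let UK := Limits.pullback x (specMap R K)
  let xK : UK ⟶ Spec (.of K) := Limits.pullback.snd _ _
  have hUK : IsPullback (Limits.pullback.fst _ _) xK x (specMap R K) := IsPullback.of_hasPullback _ _
  let qK : Spec (.of k[T;T⁻¹]) ⟶ UK := hUK.lift q (specMap k k[T;T⁻¹] ≫ specMap K k) (by
    rw [hp.w, Category.assoc])
  have hqK : qK ≫ Limits.pullback.fst _ _ = q := hUK.lift_fst _ _ _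
  have hpK : IsPullback qK (specMap k k[T;T⁻¹]) xK (specMap K k) :=
    IsPullback.of_right (by rwa [hqK]) (hUK.lift_snd _ _ _) hUK
  have := flat_specMap_field (K := K) (k := k)
  have := surjective_specMap_field (K := K) (k := k)
  have : IsAffine UK := isAffine_of_isPullback hpK
  let A : Type u := Γ(UK, ⊤)
  let _ : Algebra K A := (globalMap xK).toAlgebra
  let _ : Algebra R A := ((globalMap xK).comp (algebraMap R K)).toAlgebra
  have : IsScalarTower R K A := .of_algebraMap_eq fun _ ↦ rfl
  let f : UK ≅ Spec (.of A) := UK.isoSpec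
  have hx : f.hom ≫ specMap K A = xK := toSpecΓ_globalMap xK
  obtain ⟨j, hj⟩ := exists_ringHom_specMap (qK ≫ f.hom)
  have hpA : IsPullback (Spec.map (CommRingCat.ofHom j)) (specMap k k[T;T⁻¹]) (specMap K A)
      (specMap K k) := by
    rw [hj]
    refine hpK.of_iso (Iso.refl _) f (Iso.refl _) (Iso.refl _) ?_ ?_ ?_ ?_
    · exact (Category.id_comp _).symm
    · exact (Category.comp_id _).trans (Category.id_comp _).symm
    · exact (Category.comp_id _).trans hx.symm
    · exact (Category.comp_id _).trans (Category.id_comp _).symm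
  let P₁ : Spec (.of K) ⟶ UK := hUK.lift (specMap R K ≫ P₀) (𝟙 _) (by
    rw [Category.assoc, hP₀, Category.comp_id, Category.id_comp])
  obtain ⟨κ₀, hκ₀⟩ := exists_ringHom_specMap (P₁ ≫ f.hom)
  have hκ₀C : κ₀.comp (algebraMap K A) = RingHom.id K := by
    apply ringHom_ext_of_specMap
    rw [CommRingCat.ofHom_comp, Spec.map_comp, hκ₀, Category.assoc, hx]
    exact (hUK.lift_snd _ _ _).trans (Spec.map_id (.of K)).symm
  obtain ⟨κ, hκ⟩ := exists_ringHom_specMap (hpA.lift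
    (specMap K k ≫ Spec.map (CommRingCat.ofHom κ₀)) (𝟙 _) (by
      rw [Category.assoc, ← Spec.map_comp, ← CommRingCat.ofHom_comp, hκ₀C, Category.id_comp]
      exact (congrArg (_ ≫ ·) (Spec.map_id (.of K))).trans (Category.comp_id _)))
  -- `Spec k[T;T⁻¹]` is the fibre product of `Spec A` and `Spec k`, so a point is determined by its
  -- two projections.
  have hgen (f g : k[T;T⁻¹] →+* k) (h₁ : ∀ a, f (j a) = g (j a))
      (h₂ : ∀ c, f (LaurentPolynomial.C c) = g (LaurentPolynomial.C c)) : f = g := by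
    apply ringHom_ext_of_specMap
    refine hpA.hom_ext ?_ ?_
    · rw [← Spec.map_comp, ← Spec.map_comp, ← CommRingCat.ofHom_comp, ← CommRingCat.ofHom_comp]
      congr 2
      exact RingHom.ext h₁
    · rw [← Spec.map_comp, ← Spec.map_comp, ← CommRingCat.ofHom_comp, ← CommRingCat.ofHom_comp]
      congr 2
      exact RingHom.ext h₂
  have hjC (c : K) : j (algebraMap K A c) = LaurentPolynomial.C (algebraMap K k c) := by
    have h₁ := hpA.w
    rw [← Spec.map_comp, ← Spec.map_comp, ← CommRingCat.ofHom_comp, ← CommRingCat.ofHom_comp] at h₁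
    exact congr($(ringHom_ext_of_specMap h₁) c)
  have hκC (c : k) : κ (LaurentPolynomial.C c) = c := by
    have h₁ := hpA.lift_snd _ _ _ |>.symm.trans (congrArg (· ≫ specMap k k[T;T⁻¹]) hκ.symm)
    rw [← Spec.map_comp, ← CommRingCat.ofHom_comp] at h₁
    exact congr($(ringHom_ext_of_specMap ((Spec.map_id (.of k)).trans h₁)) c).symm
  have hκj (a : A) : κ (j a) = algebraMap K k (κ₀ a) := by
    have h₁ := hpA.lift_fst _ _ _ |>.symm.trans (congrArg (· ≫ Spec.map (CommRingCat.ofHom j)) hκ.symm)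
    rw [← Spec.map_comp, ← CommRingCat.ofHom_comp, ← Spec.map_comp, ← CommRingCat.ofHom_comp] at h₁
    exact congr($(ringHom_ext_of_specMap h₁) a).symm
  obtain ⟨B, ev, evB, hloc, hinj, hev₀, hevB, hdvd⟩ := exists_integral_family hR j hjC hgen
    (AlgHom.mk κ₀ fun c ↦ congr($hκ₀C c)) κ hκC hκj ε hε fun σ ↦ by
      obtain ⟨α, hα₁, hα₂, hα₃⟩ := hα σ
      refine ⟨α, fun a ↦ ?_, hα₂, hα₃⟩
      have h₁ : Spec.map (CommRingCat.ofHom α) ≫ qK = qK := by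
        refine hUK.hom_ext (by rw [Category.assoc, hqK, hα₁]) ?_
        have h₂ : qK ≫ xK = Spec.map (CommRingCat.ofHom
            ((LaurentPolynomial.C (R := k)).comp (algebraMap K k))) := by
          rw [hpK.w, ← Spec.map_comp, ← CommRingCat.ofHom_comp]
          rfl
        change (_ ≫ qK) ≫ xK = qK ≫ xK
        rw [Category.assoc, h₂, ← Spec.map_comp, ← CommRingCat.ofHom_comp]
        congr 2
        refine RingHom.ext fun c ↦ ?_
        change α (LaurentPolynomial.C _) = LaurentPolynomial.C _
        rw [hα₂, AlgEquiv.commutes]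
      have h₂ := congrArg (· ≫ f.hom) h₁
      simp only [Category.assoc, ← hj, ← Spec.map_comp, ← CommRingCat.ofHom_comp] at h₂
      exact congr($(ringHom_ext_of_specMap h₂) a)
  -- `A` is `B` with the nonzero elements of `R` inverted, so `Spec A` is the generic fibre of `Spec
  -- B`.
  have hpush : Algebra.IsPushout R B K A :=
    Algebra.isPushout_of_isLocalization (nonZeroDivisors R) K B A
  have hfx : f.inv ≫ Limits.pullback.fst _ _ ≫ x = specMap B A ≫ specMap R B := by
    rw [hUK.w, ← Category.assoc, (Iso.inv_comp_eq f).mpr hx.symm, specMap_comp, specMap_comp]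
  refine ⟨Spec (.of B), Spec (.of A), specMap R B, specMap B A, specMap K A,
    isPullback_SpecMap_of_isPushout _ _ _ _ (CommRingCat.isPushout_of_isPushout R B K A),
    inferInstance, inferInstance, f.inv ≫ Limits.pullback.fst _ _,
    fun n ↦ Spec.map (CommRingCat.ofHom (evB n : B →+* R)),
    fun n ↦ Spec.map (CommRingCat.ofHom (ev n : A →+* K)), ?_, fun n ↦ ?_, ?_, fun n ↦ ?_, ?_, ?_⟩
  · rw [Category.assoc, hfx]
  · rw [← Spec.map_comp, ← CommRingCat.ofHom_comp, ← Spec.map_id]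
    congr 2
    ext r
    exact (evB n).commutes r
  · intro p c hc
    -- Up to a unit of the local ring, `c` is an element `r` of `R`, for which the congruence is
    -- known globally.
    obtain ⟨⟨r, s⟩, hrs⟩ := IsLocalization.surj p.asIdeal.primeCompl c
    have hs : IsUnit (algebraMap R (localRing R K p) s) := IsLocalization.map_units _ s
    have hr : r ≠ 0 := by
      rintro rfl
      rw [map_zero] at hrs
      exact hc (hs.mul_left_eq_zero.mp hrs)
    obtain ⟨m, hm, h⟩ := hdvd r hr
    refine ⟨m, hm, fun n ↦ ?_⟩
    rw [← Spec.map_comp, ← Spec.map_comp, ← CommRingCat.ofHom_comp, ← CommRingCat.ofHom_comp]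
    congr 2
    ext b
    obtain ⟨d, hd⟩ := h n b
    change algebraMap R (localRing R K p ⧸ Ideal.span {c}) (evB (m * n) b) =
      algebraMap R (localRing R K p ⧸ Ideal.span {c}) (evB 0 b)
    rw [← sub_eq_zero, ← map_sub, hd, IsScalarTower.algebraMap_apply R (localRing R K p),
      Ideal.Quotient.algebraMap_eq, Ideal.Quotient.eq_zero_iff_mem, Ideal.mem_span_singleton,
      map_mul, ← hrs, mul_assoc]
    exact dvd_mul_right _ _
  · rw [← Spec.map_comp, ← Spec.map_comp, ← CommRingCat.ofHom_comp, ← CommRingCat.ofHom_comp]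
    congr 2
    ext b
    exact (hevB n b).symm
  · intro n m hnm
    have := mono_fst hUK
    dsimp only at hnm
    rw [← Category.assoc, ← Category.assoc, cancel_mono, cancel_mono] at hnm
    exact hinj (AlgHom.ext fun a ↦ congr($(ringHom_ext_of_specMap hnm) a))
  · dsimp only
    rw [hev₀]
    change _ = Spec.map (CommRingCat.ofHom κ₀) ≫ _
    rw [hκ₀, Category.assoc, Iso.hom_inv_id_assoc]
    exact (hUK.lift_fst _ _ _).symm

end Points

end ConicPoints

end

/-! ### Divisors of degree two and the two arithmetic criteria -/

noncomputable section

namespace ConicPoints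

section Quadratic

variable {K : Type u} [Field K]

/-- An algebra of dimension two has at most two homomorphisms to a field. -/
lemma algHom_eq_or_eq {E k : Type*} [CommRing E] [Algebra K E] [Module.Finite K E] [Field k] [Algebra K k]
    (hE : Module.finrank K E = 2) {ρ₀ ρ₁ : E →ₐ[K] k} (hne : ρ₀ ≠ ρ₁) (ρ : E →ₐ[K] k) :
    ρ = ρ₀ ∨ ρ = ρ₁ := by
  by_contra! h
  have hinj : Function.Injective ![ρ, ρ₀, ρ₁] := by
    intro i j hij
    fin_cases i <;> fin_cases j <;> simp_all [eq_comm]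
  -- Distinct algebra homomorphisms to a field are linearly independent, while linear maps from `E`
  -- to `k` form a `k`-space of dimension two.
  have h₁ := ((linearIndependent_toLinearMap K E k).comp _ hinj).fintype_card_le_finrank
  rw [Module.finrank_linearMap_self, hE] at h₁
  simp at h₁

/-- A quadratic algebra whose spectrum is reducible has two rational points. -/
lemma exists_algHom_ne {E : Type u} [CommRing E] [Algebra K E] [Module.Finite K E]
    (hE : Module.finrank K E = 2) (hirr : ¬ IrreducibleSpace (PrimeSpectrum E)) :
    ∃ ρ₀ ρ₁ : E →ₐ[K] K, ρ₀ ≠ ρ₁ := by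
  have : Nontrivial E := Module.nontrivial_of_finrank_pos (R := K) (by lia)
  have : IsArtinianRing E := IsArtinianRing.of_finite K E
  have : ∃ p q : PrimeSpectrum E, p ≠ q := by
    by_contra! h
    have : Subsingleton (PrimeSpectrum E) := ⟨h⟩
    have : PreirreducibleSpace (PrimeSpectrum E) := ⟨Set.subsingleton_univ.isPreirreducible⟩
    exact hirr ⟨inferInstance⟩
  obtain ⟨p, q, hpq⟩ := this
  have hmax (p : PrimeSpectrum E) : p.asIdeal.IsMaximal := inferInstance
  have key (p q : PrimeSpectrum E) (hpq : p ≠ q) : ∃ ρ : E →ₐ[K] K, RingHom.ker ρ = p.asIdeal := by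
    -- With two maximal ideals neither is zero, so each residue algebra has dimension less than two,
    -- hence is `K`.
    have hp : p.asIdeal ≠ ⊥ := by
      intro h
      exact hpq (PrimeSpectrum.ext ((hmax p).eq_of_le (hmax q).ne_top (h ▸ bot_le)))
    have := hmax p
    let F := E ⧸ p.asIdeal
    let m : E →ₐ[K] F := Ideal.Quotient.mkₐ K p.asIdeal
    have hm : Function.Surjective m := Ideal.Quotient.mk_surjective
    have h₁ := LinearMap.finrank_range_add_finrank_ker m.toLinearMap
    rw [LinearMap.range_eq_top.mpr hm, finrank_top, hE] at h₁
    have h₂ : 0 < Module.finrank K (LinearMap.ker m.toLinearMap) := by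
      rw [Module.finrank_pos_iff, Submodule.nontrivial_iff_ne_bot]
      obtain ⟨x, hx, hx0⟩ := Submodule.exists_mem_ne_zero_of_ne_bot hp
      exact (Submodule.ne_bot_iff _).mpr ⟨x, Ideal.Quotient.eq_zero_iff_mem.mpr hx, hx0⟩
    have : Module.Finite K F := Module.Finite.of_surjective m.toLinearMap hm
    have h₃ : 0 < Module.finrank K F := Module.finrank_pos
    let e : K ≃ₐ[K] F := AlgEquiv.ofBijective (Algebra.ofId K F)
      (Algebra.finrank_eq_one_iff_bijective_algebraMap.mp (by lia))
    refine ⟨e.symm.toAlgHom.comp m, ?_⟩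
    ext x
    change e.symm (m x) = 0 ↔ _
    rw [map_eq_zero_iff _ e.symm.injective]
    exact Ideal.Quotient.eq_zero_iff_mem
  obtain ⟨ρ₀, h₀⟩ := key p q hpq
  obtain ⟨ρ₁, h₁⟩ := key q p hpq.symm
  exact ⟨ρ₀, ρ₁, fun h ↦ hpq (PrimeSpectrum.ext (by rw [← h₀, ← h₁, h]))⟩

lemma exists_iso_specOver (D : Over (Spec (.of K))) [IsFinite D.hom] :
    ∃ (E : Type u) (_ : CommRing E) (_ : Algebra K E), Nonempty (D ≅ specOver K E) := by
  have : IsAffine D.left := isAffine_of_isAffineHom D.hom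
  let _ : Algebra K Γ(D.left, ⊤) := (globalMap D.hom).toAlgebra
  exact ⟨Γ(D.left, ⊤), inferInstance, inferInstance,
    ⟨Over.isoMk D.left.isoSpec (toSpecΓ_globalMap D.hom)⟩⟩

lemma finite_of_iso_specOver {D : Over (Spec (.of K))} [IsFinite D.hom] {E : Type u} [CommRing E]
    [Algebra K E] (i : D ≅ specOver K E) : Module.Finite K E := by
  have h : IsFinite (specMap K E) := by
    have : IsIso i.inv.left := inferInstanceAs (IsIso ((Over.forget _).map i.inv))
    have : specMap K E = i.inv.left ≫ D.hom := (Over.w i.inv).symm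
    rw [this]
    infer_instance
  have := (IsFinite.SpecMap_iff _).mp h
  exact RingHom.finite_algebraMap.mp this

lemma finrank_of_iso_specOver {D : Over (Spec (.of K))} [IsFinite D.hom] {E : Type u} [CommRing E]
    [Algebra K E] (i : D ≅ specOver K E) (hD : ∀ x, D.hom.finrank x = 2) : Module.finrank K E = 2 := by
  have := finite_of_iso_specOver i
  have hw : specMap K E = i.inv.left ≫ D.hom := (Over.w i.inv).symm
  have h₁ := Scheme.Hom.finrank_SpecMap_algebraMap K E (fieldPt K)
  have : IsIso i.inv.left := inferInstanceAs (IsIso ((Over.forget _).map i.inv))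
  have : IsIso i.hom.left := inferInstanceAs (IsIso ((Over.forget _).map i.hom))
  have : Flat (specMap K E) := Flat.SpecMap_iff.mpr (by
    change (algebraMap K E).Flat
    rw [RingHom.flat_algebraMap_iff]
    infer_instance)
  have hw' : D.hom = i.hom.left ≫ specMap K E := (Over.w i.hom).symm
  have : Flat D.hom := by
    rw [hw']
    infer_instance
  have h₂ := congrFun (Scheme.Hom.finrank_comp_left_of_isIso i.inv.left D.hom) (fieldPt K)
  rw [← hw, hD] at h₂
  rw [Module.rankAtStalk_eq_finrank_of_free] at h₁
  exact h₁.symm.trans h₂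

end Quadratic

section Dense

attribute [local instance] MvPolynomial.gradedAlgebra

/-- A scheme finite over a field is discrete, so each point is closed, and over an algebraically
closed field closed points are rational. -/
lemma exists_section_through {k : Type u} [Field k] [IsAlgClosed k] {Z : Scheme.{u}} (l : Z ⟶ Spec (.of k))
    [IsFinite l] (z : Z) : ∃ s : Spec (.of k) ⟶ Z, s ≫ l = 𝟙 _ ∧ s (fieldPt k) = z := by
  have : IsLocallyArtinian (Spec (.of k)) :=
    Scheme.isLocallyArtinianScheme_Spec.mpr (inferInstanceAs (IsArtinianRing k))
  have := IsLocallyArtinian.of_locallyQuasiFinite l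
  have hz : IsClosed {z} := isClosed_discrete _
  exact ⟨pointOfClosedPoint l z hz, pointOfClosedPoint_comp l z hz, pointOfClosedPoint_apply l z hz _⟩

variable {R K k : Type u} [CommRing R] [Field K] [Algebra R K] [Field k] [Algebra K k] [IsAlgClosed k]

/-- The points of the geometric generic fibre on a divisor whose generic fibre is finite. -/
lemma notMem_iff_exists_algHom {𝒳 P : Scheme.{u}} {π : 𝒳 ⟶ Spec (.of R)} {𝒟 : 𝒳.IdealSheafData}
    {Q : P ⟶ 𝒳} {l : P ⟶ Spec (.of k)} (hp : IsPullback Q l π (specMap K k ≫ specMap R K))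
    {E : Type u} [CommRing E] [Algebra K E] [Module.Finite K E] {δ : Spec (.of E) ⟶ 𝒟.subscheme}
    (hδ : IsPullback δ (specMap K E) (𝒟.subschemeι ≫ π) (specMap R K)) (p : P) :
    Q p ∉ openComplement 𝒟 ↔ ∃ x : Spec (.of k) ⟶ P, x ≫ l = 𝟙 _ ∧ x (fieldPt k) = p ∧
      ∃ ρ : E →ₐ[K] k, x ≫ Q = Spec.map (CommRingCat.ofHom (ρ : E →+* k)) ≫ δ ≫ 𝒟.subschemeι := by
  have hmem (z : 𝒳) : z ∉ openComplement 𝒟 ↔ z ∈ Set.range 𝒟.subschemeι := by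
    rw [Scheme.IdealSheafData.range_subschemeι]
    exact not_not
  rw [hmem]
  constructor
  · rintro ⟨d, hd⟩
    -- The geometric divisor: it is the base change of `Spec E` to `k`, hence finite over `k`, and
    -- its points are rational.
    let Z := Limits.pullback 𝒟.subschemeι Q
    obtain ⟨z, -, hz⟩ : ∃ z : Z, Limits.pullback.fst 𝒟.subschemeι Q z = d ∧
        Limits.pullback.snd 𝒟.subschemeι Q z = p := Scheme.Pullback.exists_preimage_pullback d p hd
    let lZ : Z ⟶ Spec (.of k) := Limits.pullback.snd _ _ ≫ l
    have hZ : IsPullback (Limits.pullback.fst 𝒟.subschemeι Q) lZ (𝒟.subschemeι ≫ π)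
        (specMap K k ≫ specMap R K) := (IsPullback.of_hasPullback 𝒟.subschemeι Q).paste_vert hp
    let w : Z ⟶ Spec (.of E) := hδ.lift (Limits.pullback.fst _ _) (lZ ≫ specMap K k)
      (hZ.w.trans (Category.assoc _ _ _).symm)
    have hw : w ≫ δ = Limits.pullback.fst _ _ := hδ.lift_fst _ _ _
    have hwZ : IsPullback w lZ (specMap K E) (specMap K k) :=
      IsPullback.of_right (by rwa [hw]) (hδ.lift_snd _ _ _) hδ
    have : IsFinite (specMap K E) := (IsFinite.SpecMap_iff _).mpr (RingHom.finite_algebraMap.mpr ‹_›)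
    have : IsFinite lZ := MorphismProperty.of_isPullback (P := @IsFinite) hwZ inferInstance
    obtain ⟨s, hs, hsz⟩ := exists_section_through lZ z
    obtain ⟨ρ, hρ⟩ := exists_ringHom_specMap (s ≫ w)
    have hρK : ρ.comp (algebraMap K E) = algebraMap K k := by
      apply ringHom_ext_of_specMap
      rw [CommRingCat.ofHom_comp, Spec.map_comp, hρ, Category.assoc, hwZ.w, ← Category.assoc, hs,
        Category.id_comp]
    refine ⟨s ≫ Limits.pullback.snd _ _, (Category.assoc _ _ _).trans hs, ?_,
      AlgHom.mk ρ fun c ↦ congr($hρK c), ?_⟩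
    · rw [← hz, ← hsz]
      rfl
    · change _ = Spec.map (CommRingCat.ofHom ρ) ≫ _
      rw [hρ, Category.assoc, Category.assoc, ← Category.assoc w, hw, Limits.pullback.condition]
  · rintro ⟨x, -, rfl, ρ, hρ⟩
    refine ⟨(Spec.map (CommRingCat.ofHom (ρ : E →+* k)) ≫ δ) (fieldPt k), ?_⟩
    change ((Spec.map (CommRingCat.ofHom (ρ : E →+* k)) ≫ δ) ≫ 𝒟.subschemeι) (fieldPt k) =
      (x ≫ Q) (fieldPt k)
    rw [hρ, Category.assoc]

end Dense

section Arithmetic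

variable {K : Type u} [Field K] [NumberField K] {S : Finset (HeightOneSpectrum (𝓞 K))}
  {𝒳 : Scheme.{u}} {π : 𝒳 ⟶ Spec (.of (OS K S))} {𝒟 : 𝒳.IdealSheafData}

/-- The integral points are dense if there is an integral unit of infinite order on which the Galois
group acts as on the two geometric points of the divisor. -/
theorem integralPointsDense_of_unit (h : IsRationalCurveWithBisection π 𝒟)
    (hpt : (integralPoints π 𝒟).Nonempty) {E : Type u} [CommRing E] [Algebra K E]
    (i : genericDivisor π 𝒟 ≅ specOver K E) (ρ₀ ρ₁ : E →ₐ[K] AlgebraicClosure K) (hne : ρ₀ ≠ ρ₁)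
    (ε : (integralClosure (OS K S) (AlgebraicClosure K))ˣ) (hε : ∀ n > 0, ε ^ n ≠ 1)
    (hσ : ∀ σ : AlgebraicClosure K ≃ₐ[K] AlgebraicClosure K,
      (σ.toAlgHom.comp ρ₀ = ρ₀ ∧ σ ε.1.1 = ε.1.1) ∨
      (σ.toAlgHom.comp ρ₀ = ρ₁ ∧ σ ε.1.1 = (ε⁻¹).1.1)) : IntegralPointsDense π 𝒟 := by
  let k := AlgebraicClosure K
  have := h.generic_finite
  have := h.proper
  have := finite_of_iso_specOver i
  have hE := finrank_of_iso_specOver i h.generic_degree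
  obtain ⟨Q, hp⟩ := exists_isPullback_line π h.rational
  obtain ⟨P₀, hP₀⟩ := exists_lift_openComplement hpt
  have : LocallyOfFiniteType (lineStr k) :=
    MorphismProperty.of_isPullback (P := @LocallyOfFiniteType) hp inferInstance
  let δ : Spec (.of E) ⟶ 𝒟.subscheme := i.inv.left ≫ Limits.pullback.fst _ _
  have hδ : IsPullback δ (specMap K E) (𝒟.subschemeι ≫ π) (specMap (OS K S) K) := by
    have h₁ := IsPullback.of_hasPullback (𝒟.subschemeι ≫ π) (specMap (OS K S) K)
    have h₂ : IsIso i.inv.left := inferInstanceAs (IsIso ((Over.forget _).map i.inv))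
    have h₃ : IsPullback i.inv.left (specMap K E) (genericDivisor π 𝒟).hom (𝟙 _) :=
      IsPullback.of_horiz_isIso ⟨(Over.w i.inv).trans (Category.comp_id _).symm⟩
    have h₄ := h₃.paste_horiz h₁
    rwa [Category.id_comp] at h₄
  -- The geometric points of the divisor; Galois acts on them by composition with `ρ`.
  let d (ρ : E →ₐ[K] k) : Spec (.of k) ⟶ 𝒳 :=
    Spec.map (CommRingCat.ofHom (ρ : E →+* k)) ≫ δ ≫ 𝒟.subschemeι
  have hd (ρ) : d ρ ≫ π = specMap K k ≫ specMap (OS K S) K := by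
    change (_ ≫ δ ≫ _) ≫ π = _
    rw [Category.assoc, Category.assoc, hδ.w, ← Category.assoc, ← Spec.map_comp,
      ← CommRingCat.ofHom_comp, ρ.comp_algebraMap]
  have hdinj {ρ ρ'} (h : d ρ = d ρ') : ρ = ρ' := by
    have := mono_fst hδ
    change _ ≫ _ = _ ≫ _ at h
    rw [cancel_mono] at h
    exact AlgHom.coe_ringHom_injective (ringHom_ext_of_specMap h)
  have hdσ (σ : k ≃ₐ[K] k) (ρ) : specAut σ ≫ d ρ = d (σ.toAlgHom.comp ρ) := by
    change _ = Spec.map (CommRingCat.ofHom ((σ : k →+* k).comp (ρ : E →+* k))) ≫ _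
    rw [CommRingCat.ofHom_comp, Spec.map_comp, Category.assoc]
  obtain ⟨q, hq, hα⟩ := exists_torus_chart hp (openComplement 𝒟) (d ρ₀) (d ρ₁) (hd _) (hd _)
    (fun h ↦ hne (hdinj h)) fun p ↦ by
      rw [notMem_iff_exists_algHom hp hδ]
      refine exists_congr fun x ↦ and_congr_right fun _ ↦ and_congr_right fun _ ↦ ⟨?_, ?_⟩
      · rintro ⟨ρ, hρ⟩
        obtain rfl | rfl := algHom_eq_or_eq hE hne ρ
        · exact .inl hρ
        · exact .inr hρ
      · rintro (h | h)
        · exact ⟨_, h⟩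
        · exact ⟨_, h⟩
  have : IsLocallyNoetherian 𝒳 := LocallyOfFiniteType.isLocallyNoetherian π
  obtain ⟨T, TK, τ, fst, snd, hTK, _, _, φ, g, y, hφ, hg, H, hy, hinj, hy₀⟩ :=
    exists_family (finite_quotient_OS K S) hq P₀ hP₀ ε hε fun σ ↦ by
      obtain ⟨α, hα₁, hα₂, c, hα₃, hα₄⟩ := hα σ
      refine ⟨α, hα₁, hα₂, c, ?_⟩
      obtain ⟨h₁, h₂⟩ | ⟨h₁, h₂⟩ := hσ σ
      · exact .inl ⟨hα₃ (by rw [hdσ, h₁]), h₂⟩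
      · exact .inr ⟨hα₄ (by rw [hdσ, h₁]), h₂⟩
  exact integralPointsDense_of_family h hTK φ hφ g hg H y hy hinj P₀ hy₀

/-- The divisor consists of two `K`-points, both fixed by Galois, so any unit of infinite order in
the `S`-integers will do. -/
theorem integralPointsDense_of_not_irreducibleSpace (h : IsRationalCurveWithBisection π 𝒟)
    (hpt : (integralPoints π 𝒟).Nonempty) (hirr : ¬ IrreducibleSpace (genericDivisor π 𝒟).left)
    (hS : 1 < numPlaces K S) : IntegralPointsDense π 𝒟 := by
  have := h.generic_finite
  obtain ⟨E, _, _, ⟨i⟩⟩ := exists_iso_specOver (genericDivisor π 𝒟)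
  have := finite_of_iso_specOver i
  have hE := finrank_of_iso_specOver i h.generic_degree
  have h₁ : ¬ IrreducibleSpace (PrimeSpectrum E) := by
    intro h₁
    have : IrreducibleSpace (Spec (.of E)) := h₁
    let e : (genericDivisor π 𝒟).left ≅ Spec (.of E) := (Over.forget _).mapIso i
    exact hirr (e.inv.homeomorph.surjective.irreducibleSpace e.inv.continuous)
  obtain ⟨ρ₀, ρ₁, hne⟩ := exists_algHom_ne hE h₁
  obtain ⟨ε, hεu, hε⟩ := exists_unit_OS K S hS
  let k := AlgebraicClosure K
  have hinj : Function.Injective (algebraMap (OS K S) (integralClosure (OS K S) k)) := by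
    refine Function.Injective.of_comp (f := Subtype.val) ?_
    exact (algebraMap K k).injective.comp (IsFractionRing.injective (OS K S) K)
  let u := Units.map (algebraMap (OS K S) (integralClosure (OS K S) k)).toMonoidHom hεu.unit
  have hu (σ : k ≃ₐ[K] k) : σ u.1.1 = u.1.1 := σ.commutes (ε : K)
  refine integralPointsDense_of_unit h hpt i ((Algebra.ofId K k).comp ρ₀) ((Algebra.ofId K k).comp ρ₁)
    (fun h ↦ hne ?_) u (fun n hn h₂ ↦ hε n hn ?_) fun σ ↦ .inl ⟨?_, hu σ⟩
  · ext x
    exact (algebraMap K k).injective congr($h x)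
  · apply hinj
    rw [map_pow, map_one]
    exact congrArg Units.val h₂
  · ext x
    exact σ.commutes (ρ₀ x)

/-- The two geometric points are an embedding `ρ` of `L` and its conjugate `ρ ∘ τ`. A Galois
automorphism swaps them exactly when it acts on the image of `L` through `τ`, and then it inverts `ρ
ε` because `ε` has norm one. -/
theorem integralPointsDense_of_existsSplitPlace (h : IsRationalCurveWithBisection π 𝒟)
    (hpt : (integralPoints π 𝒟).Nonempty) {L : Type u} [Field L] [NumberField L] [Algebra K L]
    (i : genericDivisor π 𝒟 ≅ specOver K L) (hL : ExistsSplitPlace K S L) :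
    IntegralPointsDense π 𝒟 := by
  have := h.generic_finite
  have := finite_of_iso_specOver i
  obtain ⟨τ, ε, hτ, hτ', hε0, hεint, hτε, hε⟩ :=
    exists_norm_one S (finrank_of_iso_specOver i h.generic_degree) hL
  let k := AlgebraicClosure K
  let ρ : L →ₐ[K] k := IsAlgClosed.lift
  have hτint : IsIntegral (OS K S) ε⁻¹ := hτε ▸ hεint.map (τ.toAlgHom.restrictScalars (OS K S))
  let u : (integralClosure (OS K S) k)ˣ :=
    { val := ⟨ρ ε, hεint.map (ρ.restrictScalars (OS K S))⟩
      inv := ⟨ρ ε⁻¹, hτint.map (ρ.restrictScalars (OS K S))⟩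
      val_inv := Subtype.ext (by
        change ρ ε * ρ ε⁻¹ = 1
        rw [← map_mul, mul_inv_cancel₀ hε0, map_one])
      inv_val := Subtype.ext (by
        change ρ ε⁻¹ * ρ ε = 1
        rw [← map_mul, inv_mul_cancel₀ hε0, map_one]) }
  have hne : ρ ≠ ρ.comp τ.toAlgHom := fun h₁ ↦ hτ (AlgEquiv.ext fun x ↦ ρ.injective congr($h₁ x).symm)
  refine integralPointsDense_of_unit h hpt i ρ (ρ.comp τ.toAlgHom) hne u
    (fun n hn h₂ ↦ hε n hn ?_) fun σ ↦ ?_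
  · apply ρ.injective
    rw [map_pow, map_one]
    exact congrArg (fun v : (integralClosure (OS K S) k)ˣ ↦ v.1.1) h₂
  · obtain h₁ | h₁ := algHom_eq_or_eq (finrank_of_iso_specOver i h.generic_degree) hne
      (σ.toAlgHom.comp ρ)
    · exact .inl ⟨h₁, congr($h₁ ε)⟩
    · refine .inr ⟨h₁, congr($h₁ ε).trans ?_⟩
      exact congrArg ρ hτε

end Arithmetic

end ConicPoints

end

theorem mainTheorem9 {K : Type u} [Field K] [NumberField K]
    (S : Finset (HeightOneSpectrum (𝓞 K)))
    {𝒳 : Scheme.{u}} (π : 𝒳 ⟶ Spec (.of (ConicPoints.OS K S))) (𝒟 : 𝒳.IdealSheafData)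
    (h : ConicPoints.IsRationalCurveWithBisection π 𝒟)
    (hpt : (ConicPoints.integralPoints π 𝒟).Nonempty) :
    -- the form of the multiplicative group under which the open curve is a torsor has positive rank
    (∀ (G : Over (Spec (.of K))) [GrpObj G], ConicPoints.IsFormOfGm G →
      ConicPoints.IsTorsor G (ConicPoints.genericComplement π 𝒟) →
      ∀ (𝒢 : Over (Spec (.of (ConicPoints.OS K S)))) [GrpObj 𝒢], ConicPoints.IsModel 𝒢 G →
      0 < ConicPoints.sectionRank 𝒢 → ConicPoints.IntegralPointsDense π 𝒟) ∧
    -- the generic divisor is reducible and there is more than one place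
    (¬ IrreducibleSpace (ConicPoints.genericDivisor π 𝒟).left → 1 < ConicPoints.numPlaces K S →
      ConicPoints.IntegralPointsDense π 𝒟) ∧
    -- the generic divisor is irreducible, with function field `L`, and some place splits in `L`
    (∀ (L : Type u) [Field L] [NumberField L] [Algebra K L],
      Nonempty (ConicPoints.genericDivisor π 𝒟 ≅ ConicPoints.specOver K L) →
      ConicPoints.ExistsSplitPlace K S L → ConicPoints.IntegralPointsDense π 𝒟) := by
  exact ⟨fun G _ _ hG 𝒢 _ hm hr ↦ ConicPoints.integralPointsDense_of_isTorsor h hpt G hG 𝒢 hm hr,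
    ConicPoints.integralPointsDense_of_not_irreducibleSpace h hpt,
    fun L _ _ _ ⟨i⟩ hL ↦ ConicPoints.integralPointsDense_of_existsSplitPlace h hpt i hL⟩
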